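/- **Lemma 3.1.** Let $d\in\{2,3\}$, $T>0$ and $\mathbb T^d=\mathbb R^d/\mathbb Z^d$. Let $A_n\in C([0,T];L^2(\mathbb T^d;\mathbb R^d))$ and $v_n\in L^2(0,T;H^1(\mathbb T^d;\mathbb R^d))\cap L^1(0,T;W^{1,\infty}(\mathbb T^d;\mathbb R^d))$, $n\in\mathbb N$, satisfy $$\|A_n\|_{L^\infty(0,T;L^2)}+\|v_n\|_{L^2(0,T;H^1)}+\|v_n\|_{L^1(0,T;W^{1,\infty})}\le M$$ for some constant $M$ independent of $n$. Suppose that $$\partial_t A_n+\operatorname{div}(A_n\otimes v_n)=\operatorname{div}(v_n\otimes A_n),\qquad \operatorname{div}A_n=\operatorname{div}v_n=0\qquad\text{in }\mathcal D'((0,T)\times\mathbb T^d),$$ with $A_n|_{t=0}=A_{0,n}$, where $(a\otimes b)^{ij}=a^ib^j$ and $(\operatorname{div}M)^i=\sum_j\partial_jM^{ij}$. Suppose also that $A_{0,n}\to A_0$ strongly in $L^2(\mathbb T^d)$ and that $v_n\to v$ strongly in $L^1(0,T;W^{1,\infty}(\mathbb T^d))$. Then there are a subsequence $(A_{n_k})_k$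 and a function $A\in C([0,T];L^2(\mathbb T^d))$ such that $A_{n_k}\to A$ strongly in $C([0,T];L^2(\mathbb T^d))$, and $A$ is a solution of $$\partial_t A+\operatorname{div}(A\otimes v)=\operatorname{div}(v\otimes A),\qquad \operatorname{div}A=\operatorname{div}v=0\qquad\text{in }\mathcal D'((0,T)\times\mathbb T^d),$$ with $A|_{t=0}=A_0$ almost everywhere in $\mathbb T^d$. Moreover, $A$ is the unique solution of this problem in the class $L^\infty(0,T;L^2(\mathbb T^d))$: every $B\in L^\infty(0,T;L^2(\mathbb T^d))$ that satisfies these equations in $\mathcal D'((0,T)\times\mathbb T^d)$, and for which $B(t)\to A_0$ in $\mathcal D'(\mathbb T^d)$ as $t\to0^+$ outside a null set of times, equals $A$ almost everywhere. -/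

import Mathlib

open MeasureTheory Filter Topology Set
open scoped ENNReal NNReal

/-! Function spaces on the flat torus `𝕋^d = ℝ^d / ℤ^d` (Mathlib's `UnitAddTorus (Fin d)`, with its
Lebesgue measure `volume`), and the active vector equation
`∂ₜA + div (A ⊗ v) = div (v ⊗ A)`, `div A = div v = 0`, in the sense of distributions. -/

namespace ActiveVector

/-- The Euclidean space `ℝ^d` of values of a vector field. -/
abbrev Vec (d : ℕ) : Type := EuclideanSpace ℝ (Fin d)

/-- `L²(𝕋^d; ℝ^d)`. -/
abbrev L2Field (d : ℕ) : Type :=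
  Lp (Vec d) 2 (volume : Measure (UnitAddTorus (Fin d)))

/-- The quotient map `ℝ^d → 𝕋^d`. -/
def toTorus {d : ℕ} (y : Fin d → ℝ) : UnitAddTorus (Fin d) := fun i => (y i : UnitAddCircle)

/-- `ψ ∈ C^∞(𝕋^d)`: the `ℤ^d`-periodic lift of `ψ` to `ℝ^d` is smooth. -/
def IsSmooth {d : ℕ} (ψ : UnitAddTorus (Fin d) → ℝ) : Prop :=
  ContDiff ℝ ((⊤ : ℕ∞) : WithTop ℕ∞) (fun y : Fin d → ℝ => ψ (toTorus y))

/-- The classical partial derivative `∂_j ψ (x) = d/ds ψ (x + s e_j)` at `s = 0`. -/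
noncomputable def partialDeriv {d : ℕ} (j : Fin d) (ψ : UnitAddTorus (Fin d) → ℝ)
    (x : UnitAddTorus (Fin d)) : ℝ :=
  deriv (fun s : ℝ => ψ (x + Pi.single j (s : UnitAddCircle))) 0

/-- `φ = φ(t, x)` belongs to `𝓓((0,T) × 𝕋^d)`: it is smooth on `ℝ × 𝕋^d` and vanishes for `t` outside
a compact subinterval of `(0,T)`. -/
structure IsTestFunction {d : ℕ} (T : ℝ) (φ : ℝ → UnitAddTorus (Fin d) → ℝ) : Prop where
  smooth : ContDiff ℝ ((⊤ : ℕ∞) : WithTop ℕ∞) (fun p : ℝ × (Fin d → ℝ) => φ p.1 (toTorus p.2))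
  support : ∃ a b : ℝ, 0 < a ∧ b < T ∧ ∀ t, t ∉ Icc a b → ∀ x, φ t x = 0

/-- `g = ∂_j f` in the weak sense on `𝕋^d`, for integrable vector fields `f` and `g`. -/
structure HasWeakPartial {d : ℕ} (j : Fin d) (f g : UnitAddTorus (Fin d) → Vec d) : Prop where
  integrable_left : Integrable f
  integrable_right : Integrable g
  integral_eq : ∀ ψ : UnitAddTorus (Fin d) → ℝ, IsSmooth ψ →
    ∫ x, partialDeriv j ψ x • f x = - ∫ x, ψ x • g x

/-- The norm `‖f‖_{W^{1,p}} = ‖f‖_{L^p} + ∑ⱼ ‖∂ⱼ f‖_{L^p}` of `W^{1,p}(𝕋^d; ℝ^d)`, with value `∞` when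
`f` has no weak partial derivatives.  (Weak derivatives are unique up to null sets, so that the
infimum runs over a single value.)  `H¹` is `W^{1,2}`. -/
noncomputable def sobolevNorm {d : ℕ} (p : ℝ≥0∞) (f : UnitAddTorus (Fin d) → Vec d) : ℝ≥0∞ :=
  ⨅ (g : Fin d → UnitAddTorus (Fin d) → Vec d) (_ : ∀ j, HasWeakPartial j f (g j)),
    (eLpNorm f p volume + ∑ j, eLpNorm (g j) p volume)

/-- The norm of `L^q(0,T; W^{1,p}(𝕋^d))`: the `L^q(0,T)` norm of `t ↦ ‖u(t)‖_{W^{1,p}}`. -/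
noncomputable def timeSobolevNorm {d : ℕ} (T : ℝ) (q p : ℝ≥0∞) (u : ℝ → L2Field d) : ℝ≥0∞ :=
  eLpNorm (fun t : ℝ => sobolevNorm p (u t)) q (volume.restrict (Ioo 0 T))

/-- `u ∈ L^q(0,T; W^{1,p}(𝕋^d))`.  Measurability in time is asked for with values in `L²(𝕋^d)`;
only `p = 2, ∞` are used, for which `W^{1,p} ⊆ L²`. -/
def MemTimeSobolev {d : ℕ} (T : ℝ) (q p : ℝ≥0∞) (u : ℝ → L2Field d) : Prop :=
  AEStronglyMeasurable u (volume.restrict (Ioo 0 T)) ∧ timeSobolevNorm T q p u < ∞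

/-- `div u = 0` in `𝓓'((0,T) × 𝕋^d)`. -/
def IsDivFree {d : ℕ} (T : ℝ) (u : ℝ → L2Field d) : Prop :=
  ∀ φ : ℝ → UnitAddTorus (Fin d) → ℝ, IsTestFunction T φ →
    ∫ t in Ioo 0 T, ∫ x, ∑ j, u t x j * partialDeriv j (φ t) x = 0

/-- `∂ₜA + div (A ⊗ v) = div (v ⊗ A)` and `div A = div v = 0` in `𝓓'((0,T) × 𝕋^d)`.
Here `(a ⊗ b)ⁱʲ = aⁱ bʲ` and `(div M)ⁱ = ∑ⱼ ∂ⱼ Mⁱʲ`; the first equation is tested in each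
component `i`. -/
structure IsSolution {d : ℕ} (T : ℝ) (A v : ℝ → L2Field d) : Prop where
  equation : ∀ (i : Fin d) (φ : ℝ → UnitAddTorus (Fin d) → ℝ), IsTestFunction T φ →
    ∫ t in Ioo 0 T, ∫ x, (A t x i * deriv (fun s => φ s x) t
      + ∑ j, (A t x i * v t x j) * partialDeriv j (φ t) x
      - ∑ j, (v t x i * A t x j) * partialDeriv j (φ t) x) = 0
  div_left : IsDivFree T A
  div_right : IsDivFree T v

/-- `A|_{t=0} = A₀` for a field `A` which is only defined for almost every time: outside a null set
of times, `A(t) → A₀` in `𝓓'(𝕋^d)` as `t → 0+`. -/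
def HasInitialTrace {d : ℕ} (A : ℝ → L2Field d) (A₀ : L2Field d) : Prop :=
  ∀ ψ : UnitAddTorus (Fin d) → ℝ, IsSmooth ψ →
    Tendsto (fun t : ℝ => ∫ x, ψ x • A t x) (𝓝[>] 0 ⊓ ae volume) (𝓝 (∫ x, ψ x • A₀ x))

end ActiveVector

/-!
The proof rests on a cancellation in the resolvent energy `E_ε(A) = ⟨A, (1 - εΔ)⁻¹ A⟩`.  For
divergence-free `A` and `v`, differentiating `E_ε` along `∂ₜA + div (A ⊗ v - v ⊗ A) = 0` seems to
cost a derivative of `A`, but `transportForm_eq` rewrites the result as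
`∫ (aʲaⁱ + aⁱaʲ) ∂ⱼvⁱ`, `a = (1 - εΔ)⁻¹A`, plus `ε` times a form in `∇a` with coefficients `∇v`.
Hence `|d/dt E_ε| ≤ C ‖∇v‖_∞ E_ε` with `C` independent of `ε`, and the remainder vanishes as
`ε → 0`.  By bilinearity and density the identity need only be checked on pairs of Fourier modes,
where it is an identity between polynomials in the frequencies (`mode_identity`).

* With `ε = 1` the energy is a square norm of `H⁻¹`, and `exists_energy_stability` bounds the
  difference of two solutions, with different velocities, in that norm.  This gives uniqueness in
  `L^∞(0,T; L²)` (`ae_eq_of_evolvesTo`), and shows that `Aₙ` is a Cauchy sequence in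
  `C([0,T]; H⁻¹)`; being bounded in `L²`, it has a limit `A` weakly in `L²` at each time, which
  solves the limit equation.
* With `ε → 0` one gets the energy identity
  `‖A(t)‖² = ‖A(0)‖² + ∫₀ᵗ ∫ (AʲAⁱ + AⁱAʲ) ∂ⱼvⁱ` (`energy_identity`) for `Aₙ` and for `A`, although
  these are too rough to be test functions in their own equations.

Subtracting the energy identities and expanding `‖Aₙ - A‖² = ‖Aₙ‖² - ‖A‖² - 2⟨A, Aₙ - A⟩` yields a
Grönwall inequality for `‖Aₙ - A‖²`, whose inhomogeneous terms involve `Aₙ - A` only through weak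
convergence.  They are small uniformly in time, because the Fourier tails of `A(t)` are, by Dini's
theorem and the continuity of `‖A(t)‖²`.  So the whole sequence converges in `C([0,T]; L²)`, up to
the finitely many `n` for which `vₙ - v` has infinite norm.

The equation is used through the Fourier coefficients of its solutions, which are absolutely
continuous in time.  The fields are taken complex valued, component by component, so that the
coefficients of an arbitrary element of `L²` are available.
-/

namespace ActiveVector

/-! ### Fourier analysis on the torus -/

/-- The complex space `L²(𝕋^d; ℂ)`, in which the components of vector fields are expanded in
Fourier series. -/
abbrev ScalarL2 (d : ℕ) : Type :=
  Lp ℂ 2 (volume : Measure (UnitAddTorus (Fin d)))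

/-- The space `L^∞(𝕋^d; ℂ)`. -/
abbrev ScalarLinf (d : ℕ) : Type :=
  Lp ℂ ∞ (volume : Measure (UnitAddTorus (Fin d)))

-- Mathlib's Fourier theory on `UnitAddTorus` uses a local instance for the measure on the circle,
-- which agrees with the global one only propositionally.
theorem volume_unitAddTorus (d : ℕ) :
    (volume : Measure (UnitAddTorus (Fin d))) = Measure.pi (fun _ => AddCircle.haarAddCircle) := by
  rw [volume_pi]
  congr 1; ext1 i
  simp [volume, AddCircle.haarAddCircle]

instance isProbabilityMeasure_volume (d : ℕ) :
    IsProbabilityMeasure (volume : Measure (UnitAddTorus (Fin d))) := by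
  rw [volume_unitAddTorus]; infer_instance

/-- The exponential `x ↦ e^{2πi k·x}` as an element of `L²(𝕋^d; ℂ)`. -/
noncomputable def expMode {d : ℕ} (k : Fin d → ℤ) : ScalarL2 d :=
  ContinuousMap.toLp 2 volume ℂ (UnitAddTorus.mFourier k)

theorem orthonormal_expMode (d : ℕ) : Orthonormal ℂ (expMode (d := d)) := by
  have key : ∀ μ : Measure (UnitAddTorus (Fin d)), ∀ [IsFiniteMeasure μ],
      μ = Measure.pi (fun _ => AddCircle.haarAddCircle) →
      Orthonormal ℂ (fun k => ContinuousMap.toLp (E := ℂ) 2 μ ℂ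
        (UnitAddTorus.mFourier (d := Fin d) k)) := by
    rintro μ _ rfl
    exact UnitAddTorus.orthonormal_mFourier (d := Fin d)
  exact key _ (volume_unitAddTorus d)

theorem span_expMode_closure (d : ℕ) :
    (Submodule.span ℂ (range (expMode (d := d)))).topologicalClosure = ⊤ := by
  have key : ∀ μ : Measure (UnitAddTorus (Fin d)), ∀ [IsFiniteMeasure μ],
      μ = Measure.pi (fun _ => AddCircle.haarAddCircle) →
      (Submodule.span ℂ (range (fun k => ContinuousMap.toLp (E := ℂ) 2 μ ℂ
        (UnitAddTorus.mFourier (d := Fin d) k)))).topologicalClosure = ⊤ := by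
    rintro μ _ rfl
    exact UnitAddTorus.span_mFourierLp_closure_eq_top (d := Fin d) (p := 2) (by simp)
  exact key _ (volume_unitAddTorus d)

/-- The Fourier basis of `L²(𝕋^d; ℂ)`. -/
noncomputable def fourierBasis (d : ℕ) : HilbertBasis (Fin d → ℤ) ℂ (ScalarL2 d) :=
  HilbertBasis.mk (orthonormal_expMode d) (span_expMode_closure d).ge

@[simp] theorem coe_fourierBasis (d : ℕ) : ⇑(fourierBasis d) = expMode :=
  HilbertBasis.coe_mk _ _

theorem coeFn_expMode {d : ℕ} (k : Fin d → ℤ) :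
    expMode k =ᵐ[volume] UnitAddTorus.mFourier k :=
  ContinuousMap.coeFn_toLp (𝕜 := ℂ) volume (UnitAddTorus.mFourier k)

/-- The `k`-th Fourier coefficient of `f`. -/
noncomputable def coeff {d : ℕ} (f : ScalarL2 d) (k : Fin d → ℤ) : ℂ := inner ℂ (expMode k) f

theorem repr_eq_coeff {d : ℕ} (f : ScalarL2 d) (k : Fin d → ℤ) :
    (fourierBasis d).repr f k = coeff f k := by
  rw [HilbertBasis.repr_apply_apply, coe_fourierBasis, coeff]

theorem coeff_eq_integral {d : ℕ} (f : ScalarL2 d) (k : Fin d → ℤ) :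
    coeff f k = ∫ x, UnitAddTorus.mFourier (-k) x * f x := by
  rw [coeff, MeasureTheory.L2.inner_def]
  apply integral_congr_ae
  filter_upwards [coeFn_expMode k] with x hx
  rw [hx, RCLike.inner_apply, UnitAddTorus.mFourier_neg, mul_comm]

@[simp] theorem coeff_add {d : ℕ} (f g : ScalarL2 d) (k : Fin d → ℤ) :
    coeff (f + g) k = coeff f k + coeff g k := inner_add_right _ _ _

@[simp] theorem coeff_sub {d : ℕ} (f g : ScalarL2 d) (k : Fin d → ℤ) :
    coeff (f - g) k = coeff f k - coeff g k := inner_sub_right _ _ _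

@[simp] theorem coeff_smul {d : ℕ} (a : ℂ) (f : ScalarL2 d) (k : Fin d → ℤ) :
    coeff (a • f) k = a * coeff f k := inner_smul_right _ _ _

theorem coeff_expMode {d : ℕ} (p k : Fin d → ℤ) :
    coeff (expMode p : ScalarL2 d) k = if k = p then 1 else 0 :=
  orthonormal_iff_ite.mp (orthonormal_expMode d) k p

@[simp] theorem norm_expMode {d : ℕ} (k : Fin d → ℤ) : ‖(expMode k : ScalarL2 d)‖ = 1 :=
  (orthonormal_expMode d).1 k

theorem norm_coeff_le {d : ℕ} (f : ScalarL2 d) (k : Fin d → ℤ) : ‖coeff f k‖ ≤ ‖f‖ := by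
  simpa [coeff] using norm_inner_le_norm (𝕜 := ℂ) (expMode k) f

theorem hasSum_coeff_smul {d : ℕ} (f : ScalarL2 d) :
    HasSum (fun k => coeff f k • (expMode k : ScalarL2 d)) f := by
  simpa [repr_eq_coeff] using (fourierBasis d).hasSum_repr f

theorem hasSum_conj_coeff_mul {d : ℕ} (f g : ScalarL2 d) :
    HasSum (fun k => (starRingEnd ℂ) (coeff f k) * coeff g k) (inner ℂ f g) := by
  simpa [coeff, inner_conj_symm] using (fourierBasis d).hasSum_inner_mul_inner f g

theorem hasSum_sq_coeff {d : ℕ} (f : ScalarL2 d) :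
    HasSum (fun k => ‖coeff f k‖ ^ 2) (‖f‖ ^ 2) := by
  have h := Complex.hasSum_re (hasSum_conj_coeff_mul f f)
  rw [inner_self_eq_norm_sq_to_K] at h
  convert h using 1
  · ext k
    rw [Complex.conj_mul', ← Complex.ofReal_pow, Complex.ofReal_re]
  · norm_cast

theorem ext_coeff {d : ℕ} {f g : ScalarL2 d} (h : ∀ k, coeff f k = coeff g k) : f = g := by
  apply (fourierBasis d).repr.injective
  ext k
  rw [repr_eq_coeff, repr_eq_coeff, h]

/-- Every square summable family is the family of Fourier coefficients of some `f ∈ L²`. -/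
theorem exists_coeff_eq {d : ℕ} (b : (Fin d → ℤ) → ℂ) (hb : Summable fun k => ‖b k‖ ^ 2) :
    ∃ f : ScalarL2 d, ∀ k, coeff f k = b k := by
  have hm : Memℓp b 2 := by
    refine memℓp_gen ?_
    simpa using hb
  refine ⟨(fourierBasis d).repr.symm ⟨b, hm⟩, fun k => ?_⟩
  rw [← repr_eq_coeff, LinearIsometryEquiv.apply_symm_apply]

theorem summable_mul_coeff {d : ℕ} {c : (Fin d → ℤ) → ℂ} {C : ℝ} (hc : ∀ k, ‖c k‖ ≤ C)
    (f : ScalarL2 d) : Summable fun k => ‖c k * coeff f k‖ ^ 2 := by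
  refine Summable.of_nonneg_of_le (fun k => by positivity) (fun k => ?_)
    ((hasSum_sq_coeff f).summable.mul_left (C ^ 2))
  rw [norm_mul, mul_pow]
  gcongr
  exact hc k

open Classical in
/-- The Fourier multiplier with symbol `c`: it multiplies the `k`-th Fourier coefficient by `c k`.
It is defined to be `0` when `c` is unbounded. -/
noncomputable def fourierMult {d : ℕ} (c : (Fin d → ℤ) → ℂ) : ScalarL2 d →L[ℂ] ScalarL2 d :=
  if h : ∃ C : ℝ, ∀ k, ‖c k‖ ≤ C then
    LinearMap.mkContinuous
      { toFun := fun f => (exists_coeff_eq (fun k => c k * coeff f k)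
          (summable_mul_coeff h.choose_spec f)).choose
        map_add' := fun f g => ext_coeff fun k => by
          have H := fun f => (exists_coeff_eq (fun k => c k * coeff f k)
            (summable_mul_coeff h.choose_spec f)).choose_spec
          refine (H (f + g) k).trans ?_
          rw [coeff_add, coeff_add, mul_add]
          exact congrArg₂ _ (H f k).symm (H g k).symm
        map_smul' := fun a f => ext_coeff fun k => by
          have H := fun f => (exists_coeff_eq (fun k => c k * coeff f k)
            (summable_mul_coeff h.choose_spec f)).choose_spec
          refine (H (a • f) k).trans ?_
          rw [RingHom.id_apply, coeff_smul, coeff_smul, mul_left_comm]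
          exact congrArg _ (H f k).symm } h.choose
      (fun f => by
        have H := (exists_coeff_eq (fun k => c k * coeff f k)
            (summable_mul_coeff h.choose_spec f)).choose_spec
        have hC : 0 ≤ h.choose := (norm_nonneg _).trans (h.choose_spec 0)
        refine le_of_sq_le_sq ?_ (by positivity)
        rw [mul_pow]
        refine hasSum_le (fun k => ?_) (hasSum_sq_coeff _)
          ((hasSum_sq_coeff f).mul_left (h.choose ^ 2))
        refine (congrArg (fun z : ℂ => ‖z‖ ^ 2) (H k)).trans_le ?_
        rw [norm_mul, mul_pow]
        gcongr
        exact h.choose_spec k)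
  else 0

theorem coeff_fourierMult {d : ℕ} {c : (Fin d → ℤ) → ℂ} {C : ℝ} (hc : ∀ k, ‖c k‖ ≤ C)
    (f : ScalarL2 d) (k : Fin d → ℤ) : coeff (fourierMult c f) k = c k * coeff f k := by
  have h : ∃ C : ℝ, ∀ k, ‖c k‖ ≤ C := ⟨C, hc⟩
  rw [fourierMult, dif_pos h]
  exact (exists_coeff_eq (fun k => c k * coeff f k)
            (summable_mul_coeff h.choose_spec f)).choose_spec k

theorem fourierMult_expMode {d : ℕ} {c : (Fin d → ℤ) → ℂ} {C : ℝ} (hc : ∀ k, ‖c k‖ ≤ C)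
    (p : Fin d → ℤ) : fourierMult c (expMode p) = c p • expMode p := by
  refine ext_coeff fun k => ?_
  rw [coeff_fourierMult hc, coeff_smul, coeff_expMode]
  split_ifs with h <;> simp [h]

theorem hasSum_sq_fourierMult {d : ℕ} {c : (Fin d → ℤ) → ℂ} {C : ℝ} (hc : ∀ k, ‖c k‖ ≤ C)
    (f : ScalarL2 d) : HasSum (fun k => ‖c k‖ ^ 2 * ‖coeff f k‖ ^ 2) (‖fourierMult c f‖ ^ 2) := by
  convert hasSum_sq_coeff (fourierMult c f) using 2 with k
  rw [coeff_fourierMult hc, norm_mul, mul_pow]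

theorem norm_fourierMult_le {d : ℕ} {c : (Fin d → ℤ) → ℂ} {C : ℝ} (hc : ∀ k, ‖c k‖ ≤ C)
    (f : ScalarL2 d) : ‖fourierMult c f‖ ≤ C * ‖f‖ := by
  have hC : 0 ≤ C := (norm_nonneg _).trans (hc 0)
  refine le_of_sq_le_sq ?_ (by positivity)
  rw [mul_pow]
  refine hasSum_le (fun k => ?_) (hasSum_sq_fourierMult hc f)
    ((hasSum_sq_coeff f).mul_left (C ^ 2))
  gcongr
  exact hc k

/-- Multipliers which are uniformly bounded and converge to `0` pointwise converge to `0`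
strongly. -/
theorem tendsto_norm_fourierMult_zero {d : ℕ} {c : ℕ → (Fin d → ℤ) → ℂ} {C : ℝ}
    (hc : ∀ n k, ‖c n k‖ ≤ C) (h0 : ∀ k, Tendsto (fun n => c n k) atTop (𝓝 0)) (f : ScalarL2 d) :
    Tendsto (fun n => ‖fourierMult (c n) f‖) atTop (𝓝 0) := by
  have h1 : Tendsto (fun n => ∑' k, ‖c n k‖ ^ 2 * ‖coeff f k‖ ^ 2) atTop
      (𝓝 (∑' k : Fin d → ℤ, (0 : ℝ))) := by
    refine tendsto_tsum_of_dominated_convergence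
      (bound := fun k => C ^ 2 * ‖coeff f k‖ ^ 2)
      ((hasSum_sq_coeff f).summable.mul_left _) (fun k => ?_) (Eventually.of_forall fun n k => ?_)
    · simpa using ((h0 k).norm.pow 2).mul_const (‖coeff f k‖ ^ 2)
    · rw [Real.norm_of_nonneg (by positivity)]
      gcongr
      exact hc n k
  simp only [(hasSum_sq_fourierMult (hc _) f).tsum_eq, tsum_zero] at h1
  have h2 := h1.sqrt
  simpa [Real.sqrt_sq (norm_nonneg _)] using h2

/-- Multiplication by a function in `L^∞`, as an operator on `L²`. -/
noncomputable def mulOp {d : ℕ} (T : ScalarLinf d) : ScalarL2 d →L[ℂ] ScalarL2 d :=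
  (ContinuousLinearMap.mul ℂ ℂ).holderL volume ∞ 2 2 T

theorem coeFn_mulOp {d : ℕ} (T : ScalarLinf d) (f : ScalarL2 d) :
    mulOp T f =ᵐ[volume] fun x => T x * f x :=
  (ContinuousLinearMap.mul ℂ ℂ).coeFn_holder T f

theorem norm_mulOp_le {d : ℕ} (T : ScalarLinf d) (f : ScalarL2 d) :
    ‖mulOp T f‖ ≤ ‖T‖ * ‖f‖ := by
  have h := (ContinuousLinearMap.mul ℂ ℂ).norm_holder_apply_apply_le (r := 2) T f
  simpa [mulOp] using h

theorem mulOp_add {d : ℕ} (S T : ScalarLinf d) : mulOp (S + T) = mulOp S + mulOp T :=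
  map_add _ _ _

/-- The Fourier coefficients of a bounded function. -/
noncomputable def coeffLinf {d : ℕ} (T : ScalarLinf d) (k : Fin d → ℤ) : ℂ :=
  ∫ x, UnitAddTorus.mFourier (-k) x * T x

theorem inner_expMode_mulOp {d : ℕ} (T : ScalarLinf d) (p q : Fin d → ℤ) :
    inner ℂ (expMode p) (mulOp T (expMode q)) = coeffLinf T (p - q) := by
  rw [← coeff, coeff_eq_integral, coeffLinf]
  apply integral_congr_ae
  filter_upwards [coeFn_mulOp T (expMode q), coeFn_expMode q] with x h1 h2
  rw [h1, h2, neg_sub, sub_eq_add_neg, UnitAddTorus.mFourier_add]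
  ring

/-- Multiplication by a real-valued function is symmetric. -/
theorem inner_mulOp_left {d : ℕ} {T : ScalarLinf d} (hT : ∀ᵐ x, (starRingEnd ℂ) (T x) = T x)
    (f g : ScalarL2 d) : inner ℂ (mulOp T f) g = inner ℂ f (mulOp T g) := by
  rw [MeasureTheory.L2.inner_def, MeasureTheory.L2.inner_def]
  apply integral_congr_ae
  filter_upwards [coeFn_mulOp T f, coeFn_mulOp T g, hT] with x h1 h2 h3
  rw [h1, h2, RCLike.inner_apply, RCLike.inner_apply, map_mul, h3]
  ring

/-! ### The cancellation identity for the resolvent energy -/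

/-- The angular frequency `2π kⱼ`. -/
noncomputable def freq {d : ℕ} (k : Fin d → ℤ) (j : Fin d) : ℝ := 2 * Real.pi * k j

/-- The symbol `1 / (1 + ε |2πk|²)` of the resolvent `(1 - ε Δ)⁻¹`. -/
noncomputable def resSymbol {d : ℕ} (ε : ℝ) (k : Fin d → ℤ) : ℝ := (1 + ε * ∑ j, freq k j ^ 2)⁻¹

/-- The resolvent `(1 - ε Δ)⁻¹` on `L²(𝕋^d)`. -/
noncomputable def resolventOp {d : ℕ} (ε : ℝ) : ScalarL2 d →L[ℂ] ScalarL2 d :=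
  fourierMult fun k => (resSymbol ε k : ℂ)

/-- The operator `∂ⱼ (1 - ε Δ)⁻¹` on `L²(𝕋^d)`, for `ε > 0`. -/
noncomputable def derivResolventOp {d : ℕ} (ε : ℝ) (j : Fin d) : ScalarL2 d →L[ℂ] ScalarL2 d :=
  fourierMult fun k => Complex.I * freq k j * resSymbol ε k

section symbol

variable {d : ℕ} {ε : ℝ}

theorem one_le_inv_resSymbol (hε : 0 ≤ ε) (k : Fin d → ℤ) : 1 ≤ 1 + ε * ∑ j, freq k j ^ 2 := by
  have : 0 ≤ ε * ∑ j, freq k j ^ 2 := mul_nonneg hε (Finset.sum_nonneg fun j _ => sq_nonneg _)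
  linarith

theorem resSymbol_pos (hε : 0 ≤ ε) (k : Fin d → ℤ) : 0 < resSymbol ε k :=
  inv_pos.mpr (lt_of_lt_of_le one_pos (one_le_inv_resSymbol hε k))

theorem resSymbol_le_one (hε : 0 ≤ ε) (k : Fin d → ℤ) : resSymbol ε k ≤ 1 :=
  inv_le_one_of_one_le₀ (one_le_inv_resSymbol hε k)

theorem resSymbol_mul (hε : 0 ≤ ε) (k : Fin d → ℤ) :
    resSymbol ε k * (1 + ε * ∑ j, freq k j ^ 2) = 1 :=
  inv_mul_cancel₀ (lt_of_lt_of_le one_pos (one_le_inv_resSymbol hε k)).ne'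

theorem eps_mul_freq_sq_le (hε : 0 ≤ ε) (k : Fin d → ℤ) (j : Fin d) :
    ε * freq k j ^ 2 * resSymbol ε k ≤ 1 := by
  have h1 : freq k j ^ 2 ≤ ∑ j, freq k j ^ 2 :=
    Finset.single_le_sum (f := fun j => freq k j ^ 2) (fun j _ => sq_nonneg _) (Finset.mem_univ j)
  have h2 := resSymbol_mul hε k
  have h3 := resSymbol_pos hε k
  nlinarith [mul_le_mul_of_nonneg_left (mul_le_mul_of_nonneg_left h1 hε) h3.le]

theorem abs_freq_mul_resSymbol_le (hε : 0 < ε) (k : Fin d → ℤ) (j : Fin d) :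
    |freq k j| * resSymbol ε k ≤ 1 + ε⁻¹ := by
  have h1 := eps_mul_freq_sq_le hε.le k j
  have h3 := resSymbol_pos hε.le k
  have h4 := resSymbol_le_one hε.le k
  have h5 : freq k j ^ 2 * resSymbol ε k ≤ ε⁻¹ := by
    rw [← mul_one ε⁻¹, ← div_eq_inv_mul, le_div_iff₀ hε]
    linarith
  have h6 : |freq k j| ≤ 1 + freq k j ^ 2 := by
    rw [← sq_abs]; nlinarith [sq_nonneg (|freq k j| - 1)]
  nlinarith [mul_le_mul_of_nonneg_right h6 h3.le]

theorem norm_resSymbol_le (hε : 0 ≤ ε) (k : Fin d → ℤ) : ‖(resSymbol ε k : ℂ)‖ ≤ 1 := by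
  rw [Complex.norm_real, Real.norm_of_nonneg (resSymbol_pos hε k).le]
  exact resSymbol_le_one hε k

theorem norm_derivSymbol (hε : 0 ≤ ε) (k : Fin d → ℤ) (j : Fin d) :
    ‖Complex.I * freq k j * resSymbol ε k‖ = |freq k j| * resSymbol ε k := by
  rw [norm_mul, norm_mul, Complex.norm_I, one_mul, Complex.norm_real, Complex.norm_real,
    Real.norm_of_nonneg (resSymbol_pos hε k).le, Real.norm_eq_abs]

theorem norm_derivSymbol_le (hε : 0 < ε) (j : Fin d) (k : Fin d → ℤ) :
    ‖Complex.I * freq k j * resSymbol ε k‖ ≤ 1 + ε⁻¹ := by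
  rw [norm_derivSymbol hε.le]
  exact abs_freq_mul_resSymbol_le hε k j

end symbol

/-- Finite-dimensional algebra behind the cancellation identity: the case of two Fourier modes with
frequencies `-P` and `Q`. -/
theorem mode_identity {d : ℕ} (ε : ℂ) (P Q V u b : Fin d → ℂ)
    (hu : ∑ j, u j * P j = 0) (hb : ∑ j, Q j * b j = 0)
    (hV : ∑ j, (P j - Q j) * V j = 0) :
    ∑ i, ∑ j, ((-Complex.I * P j * u i) * (V j * b i - V i * b j) * (1 + ε * ∑ k, Q k ^ 2)
        + (u i * V j - u j * V i) * (Complex.I * Q j * b i) * (1 + ε * ∑ k, P k ^ 2)) =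
      ∑ i, ∑ j, (u j * b i * (Complex.I * (P j - Q j) * V i)
        + u i * b j * (Complex.I * (P j - Q j) * V i))
      + ε * ∑ i, ∑ j, ∑ k,
        ((-Complex.I * P k * u i) * (Complex.I * Q j * b i) * (Complex.I * (P k - Q k) * V j)
        + (-Complex.I * P j * u i) * (Complex.I * Q k * b i) * (Complex.I * (P k - Q k) * V j)
        - (-Complex.I * P k * u j) * (Complex.I * Q j * b i) * (Complex.I * (P k - Q k) * V i)
        - (-Complex.I * P j * u i) * (Complex.I * Q k * b j) * (Complex.I * (P k - Q k) * V i)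
        + (-Complex.I * P k * u j) * (Complex.I * Q k * b i) * (Complex.I * (P j - Q j) * V i)
        + (-Complex.I * P k * u i) * (Complex.I * Q k * b j)
            * (Complex.I * (P j - Q j) * V i)) := by
  set MP := 1 + ε * ∑ k, P k ^ 2 with hMP
  set MQ := 1 + ε * ∑ k, Q k ^ 2 with hMQ
  set l : Fin d → ℂ := fun j => P j - Q j with hl
  have e1 : ∀ i j, ((-Complex.I * P j * u i) * (V j * b i - V i * b j) * MQ
        + (u i * V j - u j * V i) * (Complex.I * Q j * b i) * MP) =
      (-Complex.I * MQ) * ((u i * b i) * (P j * V j))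
        + (Complex.I * MQ) * ((u i * V i) * (P j * b j))
      + (Complex.I * MP) * ((u i * b i) * (Q j * V j))
      - (Complex.I * MP) * ((V i * b i) * (u j * Q j)) := fun i j => by ring
  have e2 : ∀ i j, (u j * b i * (Complex.I * (P j - Q j) * V i)
        + u i * b j * (Complex.I * (P j - Q j) * V i)) =
      Complex.I * ((V i * b i) * (u j * l j)) + Complex.I * ((u i * V i) * (l j * b j)) :=
    fun i j => by simp only [hl]; ring
  have e3 : ∀ i j k,
      ((-Complex.I * P k * u i) * (Complex.I * Q j * b i) * (Complex.I * (P k - Q k) * V j)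
        + (-Complex.I * P j * u i) * (Complex.I * Q k * b i) * (Complex.I * (P k - Q k) * V j)
        - (-Complex.I * P k * u j) * (Complex.I * Q j * b i) * (Complex.I * (P k - Q k) * V i)
        - (-Complex.I * P j * u i) * (Complex.I * Q k * b j) * (Complex.I * (P k - Q k) * V i)
        + (-Complex.I * P k * u j) * (Complex.I * Q k * b i) * (Complex.I * (P j - Q j) * V i)
        + (-Complex.I * P k * u i) * (Complex.I * Q k * b j) * (Complex.I * (P j - Q j) * V i)) =
      Complex.I * ((u i * b i) * ((Q j * V j) * (P k * l k)))
      + Complex.I * ((u i * b i) * ((P j * V j) * (Q k * l k)))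
      - Complex.I * ((V i * b i) * ((u j * Q j) * (P k * l k)))
      - Complex.I * ((u i * V i) * ((P j * b j) * (Q k * l k)))
      + Complex.I * ((V i * b i) * ((u j * l j) * (P k * Q k)))
      + Complex.I * ((u i * V i) * ((l j * b j) * (P k * Q k))) := fun i j k => by
    have hI : Complex.I * Complex.I = -1 := Complex.I_mul_I
    simp only [hl]
    linear_combination (-Complex.I * ((u i * b i) * ((Q j * V j) * (P k * l k)))
      - Complex.I * ((u i * b i) * ((P j * V j) * (Q k * l k)))
      + Complex.I * ((V i * b i) * ((u j * Q j) * (P k * l k)))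
      + Complex.I * ((u i * V i) * ((P j * b j) * (Q k * l k)))
      - Complex.I * ((V i * b i) * ((u j * l j) * (P k * Q k)))
      - Complex.I * ((u i * V i) * ((l j * b j) * (P k * Q k)))) * hI
  simp only [e1, e2, e3, Finset.sum_add_distrib, Finset.sum_sub_distrib, ← Finset.mul_sum,
    ← Finset.sum_mul]
  have hul : ∑ j, u j * l j = - ∑ j, u j * Q j := by
    simp only [hl, mul_sub, Finset.sum_sub_distrib, hu, zero_sub]
  have hlb : ∑ j, l j * b j = ∑ j, P j * b j := by
    simp only [hl, sub_mul, Finset.sum_sub_distrib, hb, sub_zero]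
  have hPV : ∑ j, P j * V j = ∑ j, Q j * V j := by
    simp only [sub_mul, Finset.sum_sub_distrib] at hV
    exact sub_eq_zero.mp hV
  have hPl : ∑ k, P k * l k = ∑ k, P k ^ 2 - ∑ k, P k * Q k := by
    rw [← Finset.sum_sub_distrib]
    exact Finset.sum_congr rfl fun k _ => by simp only [hl]; ring
  have hQl : ∑ k, Q k * l k = ∑ k, P k * Q k - ∑ k, Q k ^ 2 := by
    rw [← Finset.sum_sub_distrib]
    exact Finset.sum_congr rfl fun k _ => by simp only [hl]; ring
  rw [hul, hlb, hPV, hPl, hQl, hMP, hMQ]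
  ring

/-- A velocity field `v` on the torus with components in `L^∞`, real-valued and divergence-free,
together with its weak gradient `g k j = ∂ₖ vʲ`, also in `L^∞`.  Derivatives are expressed through
Fourier coefficients. -/
structure IsLipField {d : ℕ} (v : Fin d → ScalarLinf d) (g : Fin d → Fin d → ScalarLinf d) :
    Prop where
  real : ∀ j, ∀ᵐ x, (starRingEnd ℂ) (v j x) = v j x
  grad : ∀ k j l, coeffLinf (g k j) l = Complex.I * freq l k * coeffLinf (v j) l
  div : ∀ l, ∑ j, (freq l j : ℂ) * coeffLinf (v j) l = 0

/-- `div A = 0`, expressed through Fourier coefficients. -/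
def IsSolenoidal {d : ℕ} (A : Fin d → ScalarL2 d) : Prop :=
  ∀ k, ∑ j, (freq k j : ℂ) * coeff (A j) k = 0

/-- The antisymmetric tensor `A ⊗ v - v ⊗ A`. -/
noncomputable def flux {d : ℕ} (v : Fin d → ScalarLinf d) (A : Fin d → ScalarL2 d) (i j : Fin d) :
    ScalarL2 d := mulOp (v j) (A i) - mulOp (v i) (A j)

/-- The sesquilinear form `(A, B) ↦ ∫ (A⊗v - v⊗A) : ∇(1-εΔ)⁻¹B + ∇(1-εΔ)⁻¹A : (B⊗v - v⊗B)`, which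
is the time derivative of `⟨A, (1-εΔ)⁻¹B⟩` along two solutions of the equation. -/
noncomputable def transportForm {d : ℕ} (ε : ℝ) (v : Fin d → ScalarLinf d)
    (A B : Fin d → ScalarL2 d) : ℂ :=
  ∑ i, ∑ j, (inner ℂ (derivResolventOp ε j (A i)) (flux v B i j)
    + inner ℂ (flux v A i j) (derivResolventOp ε j (B i)))

/-- The form `∫ (Aʲ Bⁱ + Aⁱ Bʲ) ∂ⱼvⁱ`. -/
noncomputable def gradForm {d : ℕ} (g : Fin d → Fin d → ScalarLinf d)
    (A B : Fin d → ScalarL2 d) : ℂ :=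
  ∑ i, ∑ j, (inner ℂ (A j) (mulOp (g j i) (B i)) + inner ℂ (A i) (mulOp (g j i) (B j)))

/-- The remainder which is left, after one integration by parts, from the terms of
`transportForm` that contain a Laplacian. -/
noncomputable def remainderForm {d : ℕ} (ε : ℝ) (g : Fin d → Fin d → ScalarLinf d)
    (A B : Fin d → ScalarL2 d) : ℂ :=
  ∑ i, ∑ j, ∑ k,
    (inner ℂ (derivResolventOp ε k (A i)) (mulOp (g k j) (derivResolventOp ε j (B i)))
    + inner ℂ (derivResolventOp ε j (A i)) (mulOp (g k j) (derivResolventOp ε k (B i)))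
    - inner ℂ (derivResolventOp ε k (A j)) (mulOp (g k i) (derivResolventOp ε j (B i)))
    - inner ℂ (derivResolventOp ε j (A i)) (mulOp (g k i) (derivResolventOp ε k (B j)))
    + inner ℂ (derivResolventOp ε k (A j)) (mulOp (g j i) (derivResolventOp ε k (B i)))
    + inner ℂ (derivResolventOp ε k (A i)) (mulOp (g j i) (derivResolventOp ε k (B j))))

/-- `F` is a continuous sesquilinear form on `L²` fields. -/
def IsSesquilinear {d : ℕ} (F : (Fin d → ScalarL2 d) → (Fin d → ScalarL2 d) → ℂ) : Prop :=
  ∃ Φ : (Fin d → ScalarL2 d) →L⋆[ℂ] (Fin d → ScalarL2 d) →L[ℂ] ℂ, ∀ A B, F A B = Φ A B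

namespace IsSesquilinear

variable {d : ℕ} {F G : (Fin d → ScalarL2 d) → (Fin d → ScalarL2 d) → ℂ}

theorem add (hF : IsSesquilinear F) (hG : IsSesquilinear G) :
    IsSesquilinear fun A B => F A B + G A B := by
  obtain ⟨Φ, hΦ⟩ := hF
  obtain ⟨Ψ, hΨ⟩ := hG
  exact ⟨Φ + Ψ, fun A B => by simp [hΦ, hΨ]⟩

theorem sub (hF : IsSesquilinear F) (hG : IsSesquilinear G) :
    IsSesquilinear fun A B => F A B - G A B := by
  obtain ⟨Φ, hΦ⟩ := hF
  obtain ⟨Ψ, hΨ⟩ := hG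
  exact ⟨Φ - Ψ, fun A B => by simp [hΦ, hΨ]⟩

theorem const_mul (c : ℂ) (hF : IsSesquilinear F) : IsSesquilinear fun A B => c * F A B := by
  obtain ⟨Φ, hΦ⟩ := hF
  exact ⟨c • Φ, fun A B => by simp [hΦ]⟩

theorem sum {ι : Type*} (s : Finset ι)
    {F : ι → (Fin d → ScalarL2 d) → (Fin d → ScalarL2 d) → ℂ}
    (hF : ∀ i, IsSesquilinear (F i)) : IsSesquilinear fun A B => ∑ i ∈ s, F i A B := by
  choose Φ hΦ using hF
  exact ⟨∑ i ∈ s, Φ i, fun A B => by simp [hΦ]⟩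

theorem inner (X Y : ScalarL2 d →L[ℂ] ScalarL2 d) (i j : Fin d) :
    IsSesquilinear fun A B => inner ℂ (X (A i)) (Y (B j)) :=
  ⟨(innerSL ℂ).bilinearComp (X.comp (ContinuousLinearMap.proj i))
    (Y.comp (ContinuousLinearMap.proj j)), fun A B => by simp⟩

/-- A continuous sesquilinear form which vanishes on divergence-free Fourier modes vanishes on
divergence-free fields. -/
theorem eq_zero_of_modes (hF : IsSesquilinear F)
    (h : ∀ (p q : Fin d → ℤ) (a b : Fin d → ℂ), ∑ j, (freq p j : ℂ) * a j = 0 →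
      ∑ j, (freq q j : ℂ) * b j = 0 →
      F (fun i => a i • expMode p) (fun i => b i • expMode q) = 0)
    {A B : Fin d → ScalarL2 d} (hA : IsSolenoidal A) (hB : IsSolenoidal B) : F A B = 0 := by
  obtain ⟨Φ, hΦ⟩ := hF
  have hs : ∀ A : Fin d → ScalarL2 d,
      HasSum (fun k => fun i => coeff (A i) k • (expMode k : ScalarL2 d)) A := fun A =>
    Pi.hasSum.mpr fun i => hasSum_coeff_smul (A i)
  have h1 : ∀ (p : Fin d → ℤ) (a : Fin d → ℂ), ∑ j, (freq p j : ℂ) * a j = 0 →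
      Φ (fun i => a i • expMode p) B = 0 := by
    intro p a ha
    have := (Φ (fun i => a i • expMode p)).hasSum (hs B)
    refine this.unique ?_
    convert hasSum_zero using 2 with k
    exact (hΦ _ _).symm.trans (h p k a _ ha (hB k))
  have h2 := (Φ.flip B).hasSum (hs A)
  rw [hΦ]
  refine h2.unique ?_
  convert hasSum_zero using 2 with k
  exact h1 k _ (hA k)

end IsSesquilinear

section forms

variable {d : ℕ} (ε : ℝ) (v : Fin d → ScalarLinf d) (g : Fin d → Fin d → ScalarLinf d)

theorem isSesquilinear_transportForm : IsSesquilinear (transportForm ε v) := by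
  unfold transportForm
  refine .sum _ fun i => .sum _ fun j => ?_
  simp only [flux, inner_sub_left, inner_sub_right]
  exact ((IsSesquilinear.inner (derivResolventOp ε j) (mulOp (v j)) i i).sub
    (.inner (derivResolventOp ε j) (mulOp (v i)) i j)).add
    ((IsSesquilinear.inner (mulOp (v j)) (derivResolventOp ε j) i i).sub
    (.inner (mulOp (v i)) (derivResolventOp ε j) j i))

theorem isSesquilinear_gradForm : IsSesquilinear (gradForm g) := by
  unfold gradForm
  refine .sum _ fun i => .sum _ fun j => ?_
  exact (IsSesquilinear.inner (.id ℂ _) (mulOp (g j i)) j i).add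
    (.inner (.id ℂ _) (mulOp (g j i)) i j)

theorem isSesquilinear_gradForm_resolvent : IsSesquilinear fun A B =>
    gradForm g (fun i => resolventOp ε (A i)) (fun i => resolventOp ε (B i)) := by
  unfold gradForm
  refine .sum _ fun i => .sum _ fun j => ?_
  exact (IsSesquilinear.inner (resolventOp ε) ((mulOp (g j i)).comp (resolventOp ε)) j i).add
    (.inner (resolventOp ε) ((mulOp (g j i)).comp (resolventOp ε)) i j)

theorem isSesquilinear_remainderForm : IsSesquilinear (remainderForm ε g) := by
  unfold remainderForm
  refine .sum _ fun i => .sum _ fun j => .sum _ fun k => ?_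
  have H : ∀ a b x y i' j', IsSesquilinear fun A B : Fin d → ScalarL2 d =>
      inner ℂ (derivResolventOp ε a (A i')) (mulOp (g x y) (derivResolventOp ε b (B j'))) :=
    fun a b x y i' j' => IsSesquilinear.inner (derivResolventOp ε a)
      ((mulOp (g x y)).comp (derivResolventOp ε b)) i' j'
  exact (((((H _ _ _ _ _ _).add (H _ _ _ _ _ _)).sub (H _ _ _ _ _ _)).sub (H _ _ _ _ _ _)).add
    (H _ _ _ _ _ _)).add (H _ _ _ _ _ _)

variable {ε v g}

/-- **Cancellation identity.**  For divergence-free fields the form `transportForm`, which contains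
derivatives of the fields of order one, only depends on the gradient of the velocity, on
`u = (1-εΔ)⁻¹A` and on `√ε ∇u`. -/
theorem transportForm_eq (hε : 0 < ε) (hv : IsLipField v g) {A B : Fin d → ScalarL2 d}
    (hA : IsSolenoidal A) (hB : IsSolenoidal B) :
    transportForm ε v A B = gradForm g (fun i => resolventOp ε (A i))
      (fun i => resolventOp ε (B i)) + ε * remainderForm ε g A B := by
  rw [← sub_eq_zero]
  refine ((isSesquilinear_transportForm ε v).sub ((isSesquilinear_gradForm_resolvent ε g).add
    ((isSesquilinear_remainderForm ε g).const_mul ε))).eq_zero_of_modes ?_ hA hB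
  intro p q a b ha hb
  have hR : ∀ (c : ℂ) (p : Fin d → ℤ), resolventOp ε (c • expMode p)
      = (resSymbol ε p * c) • expMode p := fun c p => by
    rw [map_smul, resolventOp, fourierMult_expMode (norm_resSymbol_le hε.le), smul_smul, mul_comm]
  have hD : ∀ (c : ℂ) (p : Fin d → ℤ) (j : Fin d), derivResolventOp ε j (c • expMode p)
      = (Complex.I * freq p j * resSymbol ε p * c) • expMode p := fun c p j => by
    rw [map_smul, derivResolventOp, fourierMult_expMode (norm_derivSymbol_le hε j), smul_smul,
      mul_comm]
  have hm : ∀ (c c' : ℂ) (T : ScalarLinf d), inner ℂ (c • expMode p) (mulOp T (c' • expMode q)) =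
      (starRingEnd ℂ) c * c' * coeffLinf T (p - q) := fun c c' T => by
    rw [map_smul, inner_smul_left, inner_smul_right, inner_expMode_mulOp]
    ring
  have hm' : ∀ (c c' : ℂ) (j : Fin d), inner ℂ (mulOp (v j) (c • expMode p)) (c' • expMode q) =
      (starRingEnd ℂ) c * c' * coeffLinf (v j) (p - q) := fun c c' j => by
    rw [inner_mulOp_left (hv.real j), hm]
  have hfreq : ∀ k, (freq (p - q) k : ℂ) = freq p k - freq q k := fun k => by
    simp only [freq, Pi.sub_apply]; push_cast; ring
  have hdiv := hv.div (p - q)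
  simp only [hfreq] at hdiv
  have hmp : (resSymbol ε p : ℂ) * (1 + ε * ∑ j, (freq p j : ℂ) ^ 2) = 1 := by
    exact_mod_cast resSymbol_mul hε.le p
  have hmq : (resSymbol ε q : ℂ) * (1 + ε * ∑ j, (freq q j : ℂ) ^ 2) = 1 := by
    exact_mod_cast resSymbol_mul hε.le q
  have ha' : ∑ j, ((resSymbol ε p : ℂ) * (starRingEnd ℂ) (a j)) * (freq p j : ℂ) = 0 := by
    have := congrArg (starRingEnd ℂ) ha
    simp only [map_sum, map_mul, Complex.conj_ofReal, map_zero] at this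
    rw [← mul_zero (resSymbol ε p : ℂ), ← this, Finset.mul_sum]
    exact Finset.sum_congr rfl fun j _ => by ring
  have hb' : ∑ j, (freq q j : ℂ) * ((resSymbol ε q : ℂ) * b j) = 0 := by
    rw [← mul_zero (resSymbol ε q : ℂ), ← hb, Finset.mul_sum]
    exact Finset.sum_congr rfl fun j _ => by ring
  have key := mode_identity (ε : ℂ) (fun j => (freq p j : ℂ)) (fun j => (freq q j : ℂ))
    (fun j => coeffLinf (v j) (p - q)) (fun j => (resSymbol ε p : ℂ) * (starRingEnd ℂ) (a j))
    (fun j => (resSymbol ε q : ℂ) * b j) ha' hb' hdiv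
  rw [sub_eq_zero]
  convert key using 1
  · unfold transportForm
    refine Finset.sum_congr rfl fun i _ => Finset.sum_congr rfl fun j _ => ?_
    simp only [flux, inner_sub_left, inner_sub_right, hD, hm, hm', map_mul, Complex.conj_I,
      Complex.conj_ofReal]
    linear_combination (Complex.I * freq p j * resSymbol ε p * (starRingEnd ℂ) (a i) *
        (coeffLinf (v j) (p - q) * b i - coeffLinf (v i) (p - q) * b j)) * hmq
      - (Complex.I * freq q j * resSymbol ε q * b i * ((starRingEnd ℂ) (a i) *
        coeffLinf (v j) (p - q) - (starRingEnd ℂ) (a j) * coeffLinf (v i) (p - q))) * hmp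
  · unfold gradForm remainderForm
    simp only [hD, hR, hm, map_mul, Complex.conj_I, Complex.conj_ofReal, hv.grad, hfreq]
    refine congrArg₂ (· + ·) ?_ (congrArg ((ε : ℂ) * ·) ?_)
    · refine Finset.sum_congr rfl fun i _ => Finset.sum_congr rfl fun j _ => ?_
      ring
    · refine Finset.sum_congr rfl fun i _ => Finset.sum_congr rfl fun j _ =>
        Finset.sum_congr rfl fun k _ => ?_
      ring

end forms

/-! ### Estimates for the resolvent energy -/

/-- The squared `L²` norm of a field. -/
noncomputable def fieldSq {d : ℕ} (A : Fin d → ScalarL2 d) : ℝ := ∑ i, ‖A i‖ ^ 2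

/-- The resolvent energy `⟨A, (1-εΔ)⁻¹A⟩`, an equivalent square norm of `H⁻¹`. -/
noncomputable def energy {d : ℕ} (ε : ℝ) (A : Fin d → ScalarL2 d) : ℝ :=
  ∑ i, ∑' k, resSymbol ε k * ‖coeff (A i) k‖ ^ 2

section energy

variable {d : ℕ} {ε : ℝ}

theorem summable_energy (hε : 0 ≤ ε) (f : ScalarL2 d) :
    Summable fun k => resSymbol ε k * ‖coeff f k‖ ^ 2 := by
  refine Summable.of_nonneg_of_le (fun k => mul_nonneg (resSymbol_pos hε k).le (sq_nonneg _))
    (fun k => ?_) (hasSum_sq_coeff f).summable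
  exact mul_le_of_le_one_left (sq_nonneg _) (resSymbol_le_one hε k)

theorem energy_term_nonneg (hε : 0 ≤ ε) (f : ScalarL2 d) :
    0 ≤ ∑' k, resSymbol ε k * ‖coeff f k‖ ^ 2 :=
  tsum_nonneg fun k => mul_nonneg (resSymbol_pos hε k).le (sq_nonneg _)

theorem energy_nonneg (hε : 0 ≤ ε) (A : Fin d → ScalarL2 d) : 0 ≤ energy ε A :=
  Finset.sum_nonneg fun i _ => energy_term_nonneg hε (A i)

theorem fieldSq_nonneg (A : Fin d → ScalarL2 d) : 0 ≤ fieldSq A :=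
  Finset.sum_nonneg fun _ _ => sq_nonneg _

theorem norm_sq_le_fieldSq (A : Fin d → ScalarL2 d) (i : Fin d) : ‖A i‖ ^ 2 ≤ fieldSq A :=
  Finset.single_le_sum (f := fun i => ‖A i‖ ^ 2) (fun _ _ => sq_nonneg _) (Finset.mem_univ i)

theorem energy_term_le (hε : 0 ≤ ε) (A : Fin d → ScalarL2 d) (i : Fin d) :
    ∑' k, resSymbol ε k * ‖coeff (A i) k‖ ^ 2 ≤ energy ε A :=
  Finset.single_le_sum (f := fun i => ∑' k, resSymbol ε k * ‖coeff (A i) k‖ ^ 2)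
    (fun i _ => energy_term_nonneg hε (A i)) (Finset.mem_univ i)

theorem energy_le_fieldSq (hε : 0 ≤ ε) (A : Fin d → ScalarL2 d) : energy ε A ≤ fieldSq A := by
  refine Finset.sum_le_sum fun i _ => ?_
  refine hasSum_le (fun k => ?_) (summable_energy hε (A i)).hasSum (hasSum_sq_coeff (A i))
  exact mul_le_of_le_one_left (sq_nonneg _) (resSymbol_le_one hε k)

theorem resSymbol_mul_sq_coeff_le (hε : 0 ≤ ε) (A : Fin d → ScalarL2 d) (i : Fin d)
    (k : Fin d → ℤ) : resSymbol ε k * ‖coeff (A i) k‖ ^ 2 ≤ energy ε A :=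
  ((summable_energy hε (A i)).le_tsum k fun j _ =>
    mul_nonneg (resSymbol_pos hε j).le (sq_nonneg _)).trans (energy_term_le hε A i)

theorem norm_resolventOp_sq_le (hε : 0 ≤ ε) (A : Fin d → ScalarL2 d) (i : Fin d) :
    ‖resolventOp ε (A i)‖ ^ 2 ≤ energy ε A := by
  refine le_trans ?_ (energy_term_le hε A i)
  refine hasSum_le (fun k => ?_) (hasSum_sq_fourierMult (norm_resSymbol_le hε) (A i))
    (summable_energy hε (A i)).hasSum
  gcongr
  rw [Complex.norm_real, Real.norm_of_nonneg (resSymbol_pos hε k).le, sq]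
  exact mul_le_of_le_one_left (resSymbol_pos hε k).le (resSymbol_le_one hε k)

theorem eps_mul_norm_derivResolventOp_sq_le (hε : 0 < ε) (A : Fin d → ScalarL2 d) (i j : Fin d) :
    ε * ‖derivResolventOp ε j (A i)‖ ^ 2 ≤ energy ε A := by
  refine le_trans ?_ (energy_term_le hε.le A i)
  refine hasSum_le (fun k => ?_)
    ((hasSum_sq_fourierMult (norm_derivSymbol_le hε j) (A i)).mul_left ε)
    (summable_energy hε.le (A i)).hasSum
  rw [← mul_assoc]
  gcongr
  rw [norm_derivSymbol hε.le, mul_pow, sq_abs]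
  have h1 := eps_mul_freq_sq_le hε.le k j
  have h2 := (resSymbol_pos hε.le k).le
  nlinarith [mul_le_mul_of_nonneg_right h1 h2]

theorem norm_inner_mulOp_le {T : ScalarLinf d} {L : ℝ} (hT : ‖T‖ ≤ L) (f g : ScalarL2 d) :
    ‖inner ℂ f (mulOp T g)‖ ≤ L * (‖f‖ * ‖g‖) := by
  refine (norm_inner_le_norm _ _).trans ?_
  calc ‖f‖ * ‖mulOp T g‖ ≤ ‖f‖ * (‖T‖ * ‖g‖) := by gcongr; exact norm_mulOp_le T g
    _ ≤ ‖f‖ * (L * ‖g‖) := by gcongr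
    _ = _ := by ring

theorem norm_gradForm_le {g : Fin d → Fin d → ScalarLinf d} {L E F : ℝ}
    (hg : ∀ k j, ‖g k j‖ ≤ L) {A B : Fin d → ScalarL2 d} (hA : ∀ i, ‖A i‖ ≤ E)
    (hB : ∀ i, ‖B i‖ ≤ F) : ‖gradForm g A B‖ ≤ 2 * d ^ 2 * (L * (E * F)) := by
  unfold gradForm
  have hi : ∀ i j i' j', ‖inner ℂ (A i) (mulOp (g i' j') (B j))‖ ≤ L * (E * F) := by
    intro i j i' j'
    have hL : 0 ≤ L := (norm_nonneg _).trans (hg i' j')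
    refine (norm_inner_mulOp_le (hg i' j') _ _).trans ?_
    have := (norm_nonneg _).trans (hA i)
    gcongr
    exacts [hA i, hB j]
  calc _ ≤ ∑ i : Fin d, ∑ j : Fin d, (2 * (L * (E * F))) := by
        refine norm_sum_le_of_le _ fun i _ => norm_sum_le_of_le _ fun j _ => ?_
        refine (norm_add_le _ _).trans ?_
        linarith [hi j i j i, hi i j j i]
    _ = _ := by simp; ring

theorem norm_gradForm_self_le {g : Fin d → Fin d → ScalarLinf d} {L : ℝ}
    (hg : ∀ k j, ‖g k j‖ ≤ L) (A : Fin d → ScalarL2 d) :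
    ‖gradForm g A A‖ ≤ 2 * d ^ 2 * (L * fieldSq A) := by
  have h : ∀ i, ‖A i‖ ≤ √(fieldSq A) := fun i =>
    Real.le_sqrt_of_sq_le (norm_sq_le_fieldSq A i)
  have := norm_gradForm_le hg h h
  rwa [Real.mul_self_sqrt (fieldSq_nonneg A)] at this

theorem norm_remainderForm_le (hε : 0 < ε) {g : Fin d → Fin d → ScalarLinf d} {L E : ℝ}
    (hg : ∀ k j, ‖g k j‖ ≤ L) {A : Fin d → ScalarL2 d}
    (hA : ∀ i j, ε * ‖derivResolventOp ε j (A i)‖ ^ 2 ≤ E) :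
    ‖(ε : ℂ) * remainderForm ε g A A‖ ≤ 6 * d ^ 3 * (L * E) := by
  unfold remainderForm
  have hi : ∀ i j k l k' l', ε * ‖inner ℂ (derivResolventOp ε k (A i))
      (mulOp (g k' l') (derivResolventOp ε l (A j)))‖ ≤ L * E := by
    intro i j k l k' l'
    have hL : 0 ≤ L := (norm_nonneg _).trans (hg k' l')
    have h1 := norm_inner_mulOp_le (hg k' l') (derivResolventOp ε k (A i))
      (derivResolventOp ε l (A j))
    have h2 : ε * (‖derivResolventOp ε k (A i)‖ * ‖derivResolventOp ε l (A j)‖) ≤ E := by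
      have := hA i k
      have := hA j l
      nlinarith [mul_nonneg hε.le
        (sq_nonneg (‖derivResolventOp ε k (A i)‖ - ‖derivResolventOp ε l (A j)‖))]
    calc _ ≤ ε * (L * (‖derivResolventOp ε k (A i)‖ * ‖derivResolventOp ε l (A j)‖)) := by gcongr
      _ = L * (ε * (‖derivResolventOp ε k (A i)‖ * ‖derivResolventOp ε l (A j)‖)) := by ring
      _ ≤ L * E := by gcongr
  rw [norm_mul, Complex.norm_real, Real.norm_of_nonneg hε.le]
  calc _ ≤ ε * ∑ i : Fin d, ∑ j : Fin d, ∑ k : Fin d, (6 * (L * E) / ε) := by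
        refine mul_le_mul_of_nonneg_left ?_ hε.le
        refine norm_sum_le_of_le _ fun i _ => norm_sum_le_of_le _ fun j _ =>
          norm_sum_le_of_le _ fun k _ => ?_
        rw [le_div_iff₀ hε, mul_comm]
        refine (mul_le_mul_of_nonneg_left ((norm_add_le _ _).trans (add_le_add_left
          ((norm_add_le _ _).trans (add_le_add_left ((norm_sub_le _ _).trans (add_le_add_left
          ((norm_sub_le _ _).trans (add_le_add_left (norm_add_le _ _) _)) _)) _)) _))
        hε.le).trans ?_
        linarith [hi i i k j k j, hi i i j k k j, hi j i k j k i, hi i j j k k i, hi j i k k j i,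
          hi i j k k j i]
    _ = _ := by
      simp only [Finset.sum_const, Finset.card_univ, Fintype.card_fin, nsmul_eq_mul]
      field_simp

/-- The time derivative of the resolvent energy is controlled by the resolvent energy, uniformly in
`ε`. -/
theorem norm_transportForm_le (hε : 0 < ε) {v : Fin d → ScalarLinf d}
    {g : Fin d → Fin d → ScalarLinf d} (hv : IsLipField v g) {L : ℝ} (hg : ∀ k j, ‖g k j‖ ≤ L)
    {A : Fin d → ScalarL2 d} (hA : IsSolenoidal A) :
    ‖transportForm ε v A A‖ ≤ (2 * d ^ 2 + 6 * d ^ 3) * (L * energy ε A) := by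
  rw [transportForm_eq hε hv hA hA, add_mul]
  have hR : ∀ i, ‖resolventOp ε (A i)‖ ≤ √(energy ε A) := fun i =>
    Real.le_sqrt_of_sq_le (norm_resolventOp_sq_le hε.le A i)
  refine (norm_add_le _ _).trans (add_le_add ?_ ?_)
  · have := norm_gradForm_le hg hR hR
    rwa [Real.mul_self_sqrt (energy_nonneg hε.le A)] at this
  · exact norm_remainderForm_le hε hg fun i j => eps_mul_norm_derivResolventOp_sq_le hε A i j

/-- A sequence of positive parameters with limit `0`. -/
noncomputable def epsSeq (n : ℕ) : ℝ := 1 / ((n : ℝ) + 1)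

theorem epsSeq_pos (n : ℕ) : 0 < epsSeq n := Nat.one_div_pos_of_nat

theorem tendsto_epsSeq : Tendsto epsSeq atTop (𝓝 0) := tendsto_one_div_add_atTop_nhds_zero_nat

theorem tendsto_resSymbol (k : Fin d → ℤ) :
    Tendsto (fun n => resSymbol (epsSeq n) k) atTop (𝓝 1) := by
  have h : Tendsto (fun n => (1 + epsSeq n * ∑ j, freq k j ^ 2)⁻¹) atTop
      (𝓝 (1 + 0 * ∑ j, freq k j ^ 2)⁻¹) :=
    ((tendsto_epsSeq.mul_const _).const_add 1).inv₀ (by simp)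
  simpa [resSymbol] using h

theorem tendsto_energy (A : Fin d → ScalarL2 d) :
    Tendsto (fun n => energy (epsSeq n) A) atTop (𝓝 (fieldSq A)) := by
  refine tendsto_finsetSum _ fun i _ => ?_
  rw [← (hasSum_sq_coeff (A i)).tsum_eq]
  refine tendsto_tsum_of_dominated_convergence (hasSum_sq_coeff (A i)).summable (fun k => ?_)
    (Eventually.of_forall fun n k => ?_)
  · simpa using (tendsto_resSymbol k).mul_const (‖coeff (A i) k‖ ^ 2)
  · rw [Real.norm_of_nonneg (mul_nonneg (resSymbol_pos (epsSeq_pos n).le k).le (sq_nonneg _))]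
    exact mul_le_of_le_one_left (sq_nonneg _) (resSymbol_le_one (epsSeq_pos n).le k)

theorem tendsto_resolventOp (f : ScalarL2 d) :
    Tendsto (fun n => resolventOp (epsSeq n) f) atTop (𝓝 f) := by
  have hb : ∀ n (k : Fin d → ℤ), ‖(resSymbol (epsSeq n) k : ℂ) - 1‖ ≤ 2 := fun n k =>
    (norm_sub_le _ _).trans (by
      have := norm_resSymbol_le (epsSeq_pos n).le k
      rw [norm_one]; linarith)
  have h := tendsto_norm_fourierMult_zero hb (fun k => by
    have := (Complex.continuous_ofReal.tendsto _).comp (tendsto_resSymbol k)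
    simpa [Function.comp_def] using this.sub_const 1) f
  rw [tendsto_iff_norm_sub_tendsto_zero]
  refine h.congr fun n => congrArg norm (ext_coeff fun k => ?_)
  rw [coeff_sub, resolventOp, coeff_fourierMult (hb n),
    coeff_fourierMult (norm_resSymbol_le (epsSeq_pos n).le)]
  ring

theorem tendsto_eps_mul_norm_derivResolventOp_sq (f : ScalarL2 d) (j : Fin d) :
    Tendsto (fun n => epsSeq n * ‖derivResolventOp (epsSeq n) j f‖ ^ 2) atTop (𝓝 0) := by
  have key : ∀ n (k : Fin d → ℤ), epsSeq n * ‖Complex.I * freq k j * resSymbol (epsSeq n) k‖ ^ 2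
      ≤ 1 := fun n k => by
    rw [norm_derivSymbol (epsSeq_pos n).le, mul_pow, sq_abs]
    have h1 := eps_mul_freq_sq_le (epsSeq_pos n).le k j
    have h2 := (resSymbol_pos (epsSeq_pos n).le k).le
    have h3 := resSymbol_le_one (epsSeq_pos n).le k
    nlinarith [mul_le_mul_of_nonneg_right h1 h2]
  have hs : ∀ n, epsSeq n * ‖derivResolventOp (epsSeq n) j f‖ ^ 2 =
      ∑' k, epsSeq n * ‖Complex.I * freq k j * resSymbol (epsSeq n) k‖ ^ 2 * ‖coeff f k‖ ^ 2 :=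
    fun n => by
    rw [derivResolventOp, ← ((hasSum_sq_fourierMult (norm_derivSymbol_le (epsSeq_pos n) j)
      f).mul_left (epsSeq n)).tsum_eq]
    simp only [mul_assoc]
  simp only [hs]
  rw [← tsum_zero (β := Fin d → ℤ)]
  refine tendsto_tsum_of_dominated_convergence (hasSum_sq_coeff f).summable (fun k => ?_)
    (Eventually.of_forall fun n k => ?_)
  · have h1 : Tendsto (fun n => epsSeq n * ‖Complex.I * freq k j * resSymbol (epsSeq n) k‖ ^ 2)
        atTop (𝓝 (0 * (|freq k j| * 1) ^ 2)) := by
      simp only [norm_derivSymbol (epsSeq_pos _).le]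
      exact tendsto_epsSeq.mul (((tendsto_resSymbol k).const_mul _).pow 2)
    simpa using h1.mul_const (‖coeff f k‖ ^ 2)
  · rw [Real.norm_of_nonneg (mul_nonneg (mul_nonneg (epsSeq_pos n).le (sq_nonneg _))
      (sq_nonneg _))]
    exact mul_le_of_le_one_left (sq_nonneg _) (key n k)

theorem IsSesquilinear.continuous {F : (Fin d → ScalarL2 d) → (Fin d → ScalarL2 d) → ℂ}
    (hF : IsSesquilinear F) : Continuous fun A => F A A := by
  obtain ⟨Φ, hΦ⟩ := hF
  simp only [hΦ]
  fun_prop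

theorem tendsto_transportForm {v : Fin d → ScalarLinf d}
    {g : Fin d → Fin d → ScalarLinf d} (hv : IsLipField v g) {L : ℝ} (hg : ∀ k j, ‖g k j‖ ≤ L)
    {A : Fin d → ScalarL2 d} (hA : IsSolenoidal A) :
    Tendsto (fun n => transportForm (epsSeq n) v A A) atTop (𝓝 (gradForm g A A)) := by
  simp only [transportForm_eq (epsSeq_pos _) hv hA hA]
  rw [← add_zero (gradForm g A A)]
  refine Tendsto.add ?_ ?_
  · exact ((isSesquilinear_gradForm g).continuous.tendsto A).comp
      (tendsto_pi_nhds.mpr fun i => tendsto_resolventOp (A i))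
  · have h : Tendsto (fun n => ∑ i, ∑ j, epsSeq n * ‖derivResolventOp (epsSeq n) j (A i)‖ ^ 2)
        atTop (𝓝 (∑ i : Fin d, ∑ j : Fin d, (0 : ℝ))) :=
      tendsto_finsetSum _ fun i _ => tendsto_finsetSum _ fun j _ =>
        tendsto_eps_mul_norm_derivResolventOp_sq (A i) j
    refine squeeze_zero_norm (fun n => norm_remainderForm_le (epsSeq_pos n) hg
      (E := ∑ i, ∑ j, epsSeq n * ‖derivResolventOp (epsSeq n) j (A i)‖ ^ 2) fun i j => ?_) ?_
    · have hn : ∀ i j, 0 ≤ epsSeq n * ‖derivResolventOp (epsSeq n) j (A i)‖ ^ 2 := fun i j =>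
        mul_nonneg (epsSeq_pos n).le (sq_nonneg _)
      exact (Finset.single_le_sum
        (f := fun j => epsSeq n * ‖derivResolventOp (epsSeq n) j (A i)‖ ^ 2)
        (fun j _ => hn i j) (Finset.mem_univ j)).trans
        (Finset.single_le_sum (f := fun i => ∑ j, epsSeq n *
          ‖derivResolventOp (epsSeq n) j (A i)‖ ^ 2)
          (fun i _ => Finset.sum_nonneg fun j _ => hn i j) (Finset.mem_univ i))
    · simpa using (h.const_mul L).const_mul (6 * (d : ℝ) ^ 3)

/-- The power `2 Re ∑ ⟨∂ⱼ(1-εΔ)⁻¹Aⁱ, Gⁱʲ⟩` which the flux `G` transfers to the resolvent energy. -/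
noncomputable def power (ε : ℝ) (A : Fin d → ScalarL2 d) (G : Fin d → Fin d → ScalarL2 d) : ℝ :=
  ∑ i, ∑ j, 2 * (inner ℂ (derivResolventOp ε j (A i)) (G i j)).re

theorem power_flux (v : Fin d → ScalarLinf d) (A : Fin d → ScalarL2 d) :
    power ε A (flux v A) = (transportForm ε v A A).re := by
  simp only [power, transportForm, Complex.re_sum, Complex.add_re]
  refine Finset.sum_congr rfl fun i _ => Finset.sum_congr rfl fun j _ => ?_
  rw [← inner_conj_symm (flux v A i j), Complex.conj_re]
  ring

theorem power_add (A : Fin d → ScalarL2 d) (G F : Fin d → Fin d → ScalarL2 d) :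
    power ε A (fun i j => G i j + F i j) = power ε A G + power ε A F := by
  simp only [power, inner_add_right, Complex.add_re, mul_add, Finset.sum_add_distrib]

theorem norm_derivResolventOp_le (hε : 0 < ε) (j : Fin d) (f : ScalarL2 d) :
    ‖derivResolventOp ε j f‖ ≤ (1 + ε⁻¹) * ‖f‖ :=
  norm_fourierMult_le (norm_derivSymbol_le hε j) f

theorem abs_power_le (hε : 0 < ε) {A : Fin d → ScalarL2 d} {G : Fin d → Fin d → ScalarL2 d}
    {K γ : ℝ} (hA : ∀ i, ‖A i‖ ≤ K) (hG : ∀ i j, ‖G i j‖ ≤ γ) :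
    |power ε A G| ≤ 2 * d ^ 2 * ((1 + ε⁻¹) * K * γ) := by
  calc _ ≤ ∑ i : Fin d, ∑ j : Fin d, (2 * ((1 + ε⁻¹) * K * γ)) := by
        refine (Finset.abs_sum_le_sum_abs _ _).trans (Finset.sum_le_sum fun i _ =>
          (Finset.abs_sum_le_sum_abs _ _).trans (Finset.sum_le_sum fun j _ => ?_))
        rw [abs_mul, abs_two]
        refine mul_le_mul_of_nonneg_left ?_ two_pos.le
        refine (Complex.abs_re_le_norm _).trans ((norm_inner_le_norm _ _).trans ?_)
        have h1 := (norm_derivResolventOp_le hε j (A i)).trans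
          (mul_le_mul_of_nonneg_left (hA i) (by positivity))
        exact mul_le_mul h1 (hG i j) (norm_nonneg _) ((norm_nonneg _).trans h1)
    _ = _ := by simp; ring

/-- The rate of change of the `k`-th Fourier coefficient of `Aⁱ` when `∂ₜA + div G = 0`. -/
noncomputable def rate (G : Fin d → Fin d → ScalarL2 d) (i : Fin d) (k : Fin d → ℤ) : ℂ :=
  ∑ j, (starRingEnd ℂ) (Complex.I * freq k j) * coeff (G i j) k

theorem hasSum_power_term (hε : 0 < ε) (A : Fin d → ScalarL2 d) (G : Fin d → Fin d → ScalarL2 d)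
    (i : Fin d) :
    HasSum (fun k => 2 * (resSymbol ε k * ((starRingEnd ℂ) (coeff (A i) k) * rate G i k).re))
      (∑ j, 2 * (inner ℂ (derivResolventOp ε j (A i)) (G i j)).re) := by
  have h := hasSum_sum (s := Finset.univ) (fun j _ =>
    (Complex.hasSum_re (hasSum_conj_coeff_mul (derivResolventOp ε j (A i)) (G i j))).mul_left 2)
  refine h.congr_fun fun k => ?_
  rw [← Finset.mul_sum, ← Complex.re_sum, ← Complex.re_ofReal_mul, rate, Finset.mul_sum,
    Finset.mul_sum]
  congr 2
  refine Finset.sum_congr rfl fun j _ => ?_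
  rw [derivResolventOp, coeff_fourierMult (norm_derivSymbol_le hε j)]
  simp only [map_mul, Complex.conj_ofReal]
  ring

end energy

/-! ### Functions of time: distributional derivatives and Gronwall's inequality -/

theorem intervalIntegrable_of_Ioo {E : Type*} [NormedAddCommGroup E] {T : ℝ} {f : ℝ → E}
    (hf : IntegrableOn f (Ioo 0 T)) {a b : ℝ} (ha : a ∈ Icc 0 T) (hb : b ∈ Icc 0 T) :
    IntervalIntegrable f volume a b := by
  have h : IntervalIntegrable f volume 0 T :=
    (intervalIntegrable_iff_integrableOn_Ioo_of_le (ha.1.trans ha.2)).mpr hf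
  refine h.mono_set ?_
  rw [uIcc_of_le (ha.1.trans ha.2)]
  exact uIcc_subset_Icc ha hb

theorem ae_restrict_Icc_of_Ioo {T t : ℝ} {p : ℝ → Prop}
    (h : ∀ᵐ s ∂volume.restrict (Ioo 0 T), p s) (ht : t ∈ Icc 0 T) :
    ∀ᵐ s ∂volume.restrict (Icc 0 t), p s := by
  rw [Measure.restrict_congr_set Ioo_ae_eq_Icc] at h
  exact ae_mono (Measure.restrict_mono (Icc_subset_Icc_right ht.2) le_rfl) h

theorem continuousOn_primitive_Icc {E : Type*} [NormedAddCommGroup E] [NormedSpace ℝ E] {T : ℝ}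
    (hT : 0 < T) {f : ℝ → E} (hf : IntegrableOn f (Ioo 0 T)) :
    ContinuousOn (fun t => ∫ s in (0 : ℝ)..t, f s) (Icc 0 T) := by
  have h := intervalIntegral.continuousOn_primitive_interval (μ := volume) (f := f) (a := 0)
    (b := T) (by rw [uIcc_of_le hT.le, integrableOn_Icc_iff_integrableOn_Ioo]; exact hf)
  rwa [uIcc_of_le hT.le] at h

/-- A smooth function of time with compact support in `(0, T)`. -/
structure IsTimeTest (T : ℝ) (η : ℝ → ℝ) : Prop where
  smooth : ContDiff ℝ ((⊤ : ℕ∞) : WithTop ℕ∞) η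
  support : ∃ a b : ℝ, 0 < a ∧ b < T ∧ ∀ t, t ∉ Icc a b → η t = 0

theorem exists_Icc_of_tsupport_subset {T : ℝ} {ζ : ℝ → ℝ} (hc : HasCompactSupport ζ)
    (hs : tsupport ζ ⊆ Ioo 0 T) : ∃ a b : ℝ, 0 < a ∧ b < T ∧ ∀ t, t ∉ Icc a b → ζ t = 0 := by
  rcases (tsupport ζ).eq_empty_or_nonempty with h | h
  · refine ⟨1, T - 1, one_pos, by linarith, fun t _ => ?_⟩
    exact image_eq_zero_of_notMem_tsupport (by rw [h]; exact notMem_empty t)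
  · obtain ⟨a, ha, ha'⟩ := hc.isCompact.exists_isLeast h
    obtain ⟨b, hb, hb'⟩ := hc.isCompact.exists_isGreatest h
    refine ⟨a, b, (hs ha).1, (hs hb).2, fun t ht => ?_⟩
    refine image_eq_zero_of_notMem_tsupport fun hmem => ht ⟨ha' hmem, hb' hmem⟩

theorem absolutelyContinuous_primitive {T : ℝ} {N : ℝ → ℝ}
    (hN : IntegrableOn N (Ioo 0 T)) (C : ℝ) {t : ℝ} (ht : t ∈ Icc 0 T) :
    AbsolutelyContinuousOnInterval (fun t => C + ∫ r in (0 : ℝ)..t, N r) 0 t := by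
  have h0 : (0 : ℝ) ∈ Icc 0 T := ⟨le_rfl, ht.1.trans ht.2⟩
  have hi := intervalIntegrable_of_Ioo hN h0 ht
  refine AbsolutelyContinuousOnInterval.add ?_
    (hi.absolutelyContinuousOnInterval_intervalIntegral (c := 0) (by simp))
  exact ((LipschitzWith.const C).lipschitzOnWith (s := uIcc 0 t)).absolutelyContinuousOnInterval

theorem ae_deriv_primitive {T : ℝ} {N : ℝ → ℝ}
    (hN : IntegrableOn N (Ioo 0 T)) (C : ℝ) {t : ℝ} (ht : t ∈ Icc 0 T) :
    ∀ᵐ x, x ∈ uIoc 0 t → deriv (fun t => C + ∫ r in (0 : ℝ)..t, N r) x = N x := by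
  have h0 : (0 : ℝ) ∈ Icc 0 T := ⟨le_rfl, ht.1.trans ht.2⟩
  filter_upwards [(intervalIntegrable_of_Ioo hN h0 ht).ae_hasDerivAt_integral] with x hx hxt
  exact ((hx (uIoc_subset_uIcc hxt) 0 (by simp)).const_add C).deriv

/-- The square of an absolutely continuous function. -/
theorem sq_primitive {T : ℝ} {N : ℝ → ℝ} (hN : IntegrableOn N (Ioo 0 T)) (C : ℝ) {t : ℝ}
    (ht : t ∈ Icc 0 T) :
    (C + ∫ r in (0 : ℝ)..t, N r) ^ 2 =
      C ^ 2 + ∫ s in (0 : ℝ)..t, 2 * ((C + ∫ r in (0 : ℝ)..s, N r) * N s) := by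
  have h := absolutelyContinuous_primitive hN C ht
  have h1 := h.integral_deriv_mul_eq_sub h
  have h2 : ∫ s in (0 : ℝ)..t, 2 * ((C + ∫ r in (0 : ℝ)..s, N r) * N s) =
      (C + ∫ r in (0 : ℝ)..t, N r) * (C + ∫ r in (0 : ℝ)..t, N r) - C * C := by
    have h3 : C + ∫ r in (0 : ℝ)..0, N r = C := by simp
    rw [h3] at h1
    rw [← h1]
    refine intervalIntegral.integral_congr_ae ?_
    filter_upwards [ae_deriv_primitive hN C ht] with x hx hxt
    rw [hx hxt]; ring
  rw [h2]; ring

theorem integrableOn_re {T : ℝ} {N : ℝ → ℂ} (hN : IntegrableOn N (Ioo 0 T)) :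
    IntegrableOn (fun s => (N s).re) (Ioo 0 T) := hN.re

theorem integrableOn_im {T : ℝ} {N : ℝ → ℂ} (hN : IntegrableOn N (Ioo 0 T)) :
    IntegrableOn (fun s => (N s).im) (Ioo 0 T) := hN.im

theorem intervalIntegral_re {a b : ℝ} {N : ℝ → ℂ} (hN : IntervalIntegrable N volume a b) :
    (∫ r in a..b, N r).re = ∫ r in a..b, (N r).re :=
  (Complex.reCLM.intervalIntegral_comp_comm hN).symm

theorem intervalIntegral_im {a b : ℝ} {N : ℝ → ℂ} (hN : IntervalIntegrable N volume a b) :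
    (∫ r in a..b, N r).im = ∫ r in a..b, (N r).im :=
  (Complex.imCLM.intervalIntegral_comp_comm hN).symm

/-- The squared modulus of a complex-valued absolutely continuous function. -/
theorem normSq_primitive {T : ℝ} {N : ℝ → ℂ} (hN : IntegrableOn N (Ioo 0 T)) (C : ℂ) {t : ℝ}
    (ht : t ∈ Icc 0 T) :
    ‖C + ∫ r in (0 : ℝ)..t, N r‖ ^ 2 = ‖C‖ ^ 2 + ∫ s in (0 : ℝ)..t,
      2 * ((starRingEnd ℂ) (C + ∫ r in (0 : ℝ)..s, N r) * N s).re := by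
  have h0 : (0 : ℝ) ∈ Icc 0 T := ⟨le_rfl, ht.1.trans ht.2⟩
  have hsq : ∀ z : ℂ, ‖z‖ ^ 2 = z.re ^ 2 + z.im ^ 2 := fun z => by
    rw [← Complex.normSq_eq_norm_sq, Complex.normSq_apply]; ring
  have hre : ∀ s ∈ Icc 0 T, (C + ∫ r in (0 : ℝ)..s, N r).re =
      C.re + ∫ r in (0 : ℝ)..s, (N r).re := fun s hs => by
    rw [Complex.add_re, intervalIntegral_re (intervalIntegrable_of_Ioo hN h0 hs)]
  have him : ∀ s ∈ Icc 0 T, (C + ∫ r in (0 : ℝ)..s, N r).im =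
      C.im + ∫ r in (0 : ℝ)..s, (N r).im := fun s hs => by
    rw [Complex.add_im, intervalIntegral_im (intervalIntegrable_of_Ioo hN h0 hs)]
  have hii : ∀ (D : ℝ) (M : ℝ → ℝ), IntegrableOn M (Ioo 0 T) → IntervalIntegrable
      (fun s => 2 * ((D + ∫ r in (0 : ℝ)..s, M r) * M s)) volume 0 t := fun D M hM => by
    refine IntervalIntegrable.const_mul ?_ 2
    exact (intervalIntegrable_of_Ioo hM h0 ht).continuousOn_mul
      (absolutelyContinuous_primitive hM D ht).continuousOn
  rw [hsq, hsq, hre t ht, him t ht, sq_primitive (integrableOn_re hN) _ ht,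
    sq_primitive (integrableOn_im hN) _ ht]
  have : ∫ s in (0 : ℝ)..t, 2 * ((starRingEnd ℂ) (C + ∫ r in (0 : ℝ)..s, N r) * N s).re =
      ∫ s in (0 : ℝ)..t, (2 * ((C.re + ∫ r in (0 : ℝ)..s, (N r).re) * (N s).re) +
        2 * ((C.im + ∫ r in (0 : ℝ)..s, (N r).im) * (N s).im)) := by
    refine intervalIntegral.integral_congr fun s hs => ?_
    rw [uIcc_of_le ht.1] at hs
    have hs' : s ∈ Icc 0 T := ⟨hs.1, hs.2.trans ht.2⟩
    simp only [Complex.mul_re, Complex.conj_re, Complex.conj_im]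
    rw [hre s hs', him s hs']
    ring
  rw [this, intervalIntegral.integral_add (hii _ _ (integrableOn_re hN))
    (hii _ _ (integrableOn_im hN))]
  ring

theorem integral_timeTest_mul {T : ℝ} (hT : 0 < T) {N : ℝ → ℝ} (hN : IntegrableOn N (Ioo 0 T))
    {η : ℝ → ℝ} (hη : IsTimeTest T η) :
    ∫ t in Ioo 0 T, N t * η t = - ∫ t in Ioo 0 T, (∫ r in (0 : ℝ)..t, N r) * deriv η t := by
  obtain ⟨a, b, ha, hb, hab⟩ := hη.support
  have hTT : T ∈ Icc 0 T := ⟨hT.le, le_rfl⟩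
  have h1 : AbsolutelyContinuousOnInterval η 0 T :=
    ContDiffOn.absolutelyContinuousOnInterval
      ((hη.smooth.of_le (by exact_mod_cast le_top)).contDiffOn)
  have h2 := h1.integral_mul_deriv_eq_deriv_mul (absolutelyContinuous_primitive hN 0 hTT)
  have e0 : η 0 = 0 := hab 0 fun h => absurd h.1 (by linarith)
  have eT : η T = 0 := hab T fun h => absurd h.2 (by linarith)
  rw [e0, eT, zero_mul, zero_mul, sub_zero, zero_sub] at h2
  rw [← integral_Ioc_eq_integral_Ioo, ← integral_Ioc_eq_integral_Ioo,
    ← intervalIntegral.integral_of_le hT.le, ← intervalIntegral.integral_of_le hT.le]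
  have e1 : ∫ t in (0 : ℝ)..T, N t * η t = ∫ t in (0 : ℝ)..T, η t *
      deriv (fun t => 0 + ∫ r in (0 : ℝ)..t, N r) t := by
    refine intervalIntegral.integral_congr_ae ?_
    filter_upwards [ae_deriv_primitive hN 0 hTT] with x hx hxt
    rw [hx hxt, mul_comm]
  rw [e1, h2]
  congr 1
  refine intervalIntegral.integral_congr fun t _ => ?_
  simp only [zero_add]; ring

theorem IsTimeTest.continuous_deriv {T : ℝ} {η : ℝ → ℝ} (hη : IsTimeTest T η) :
    Continuous (deriv η) := hη.smooth.continuous_deriv (by exact_mod_cast le_top)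

theorem integrableOn_mul_continuous {T : ℝ} {f φ : ℝ → ℝ} (hf : IntegrableOn f (Ioo 0 T))
    (hφ : Continuous φ) : IntegrableOn (fun t => f t * φ t) (Ioo 0 T) := by
  rw [← integrableOn_Icc_iff_integrableOn_Ioo] at hf ⊢
  exact hf.mul_continuousOn hφ.continuousOn isCompact_Icc

/-- The **du Bois-Reymond lemma**: a function on `(0,T)` whose distributional derivative is `N` is
almost everywhere a primitive of `N`. -/
theorem ae_eq_primitive {T : ℝ} (hT : 0 < T) {c N : ℝ → ℝ} (hc : IntegrableOn c (Ioo 0 T))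
    (hN : IntegrableOn N (Ioo 0 T))
    (h : ∀ η, IsTimeTest T η → ∫ t in Ioo 0 T, (c t * deriv η t + N t * η t) = 0) :
    ∃ C : ℝ, ∀ᵐ t ∂volume.restrict (Ioo 0 T), c t = C + ∫ r in (0 : ℝ)..t, N r := by
  set y : ℝ → ℝ := fun t => ∫ r in (0 : ℝ)..t, N r with hy
  have hyc : ContinuousOn y (Icc 0 T) := continuousOn_primitive_Icc hT hN
  have hyi : IntegrableOn y (Ioo 0 T) :=
    (hyc.integrableOn_Icc).mono_set Ioo_subset_Icc_self
  set w : ℝ → ℝ := fun t => c t - y t with hw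
  have hwi : IntegrableOn w (Ioo 0 T) := hc.sub hyi
  have hw0 : ∀ η, IsTimeTest T η → ∫ t in Ioo 0 T, w t * deriv η t = 0 := by
    intro η hη
    have h1 := h η hη
    rw [integral_add (integrableOn_mul_continuous hc hη.continuous_deriv)
      (integrableOn_mul_continuous hN hη.smooth.continuous), integral_timeTest_mul hT hN hη] at h1
    simp only [hw, sub_mul]
    rw [integral_sub (integrableOn_mul_continuous hc hη.continuous_deriv)
      (integrableOn_mul_continuous hyi hη.continuous_deriv)]
    linarith
  -- a bump function with integral one
  obtain ⟨χ, hχs, hχc, hχT, hχ1⟩ : ∃ χ : ℝ → ℝ, ContDiff ℝ ((⊤ : ℕ∞) : WithTop ℕ∞) χ ∧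
      HasCompactSupport χ ∧ tsupport χ ⊆ Ioo 0 T ∧ ∫ t, χ t = 1 := by
    let f : ContDiffBump (T / 2) := ⟨T / 8, T / 4, by positivity, by linarith⟩
    refine ⟨f.normed volume, f.contDiff_normed, f.hasCompactSupport_normed, ?_, f.integral_normed⟩
    rw [f.tsupport_normed_eq, Real.closedBall_eq_Icc]
    intro t ht
    have h1 : f.rOut = T / 4 := rfl
    rw [h1] at ht
    constructor <;> linarith [ht.1, ht.2]
  refine ⟨∫ t in Ioo 0 T, w t * χ t, ?_⟩
  set C := ∫ t in Ioo 0 T, w t * χ t with hC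
  have hwl : LocallyIntegrableOn (fun t => w t - C) (Ioo 0 T) := by
    refine IntegrableOn.locallyIntegrableOn ?_
    exact hwi.sub (integrableOn_const (by simp))
  have main := isOpen_Ioo.ae_eq_zero_of_integral_contDiff_smul_eq_zero hwl ?_
  · rw [ae_restrict_iff' measurableSet_Ioo]
    filter_upwards [main] with t ht htT
    have := ht htT
    simp only [hw] at this
    linarith
  intro ζ hζs hζc hζT
  -- `ζ - (∫ ζ) χ` has mean zero, hence is the derivative of a test function
  set I := ∫ t, ζ t with hI
  set θ : ℝ → ℝ := fun t => ζ t - I * χ t with hθ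
  have hθs : ContDiff ℝ ((⊤ : ℕ∞) : WithTop ℕ∞) θ := hζs.sub (contDiff_const.mul hχs)
  obtain ⟨a₁, b₁, ha₁, hb₁, h₁⟩ := exists_Icc_of_tsupport_subset hζc hζT
  obtain ⟨a₂, b₂, ha₂, hb₂, h₂⟩ := exists_Icc_of_tsupport_subset hχc hχT
  have hθ0 : ∀ t, t ∉ Icc (min a₁ a₂) (max b₁ b₂) → θ t = 0 := by
    intro t ht
    have e1 : ζ t = 0 :=
      h₁ t fun hh => ht ⟨(min_le_left _ _).trans hh.1, hh.2.trans (le_max_left _ _)⟩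
    have e2 : χ t = 0 :=
      h₂ t fun hh => ht ⟨(min_le_right _ _).trans hh.1, hh.2.trans (le_max_right _ _)⟩
    simp [hθ, e1, e2]
  have hζi : Integrable ζ := hζs.continuous.integrable_of_hasCompactSupport hζc
  have hχi : Integrable χ := hχs.continuous.integrable_of_hasCompactSupport hχc
  have hθI : ∫ t, θ t = 0 := by
    rw [hθ, integral_sub hζi (hχi.const_mul I), integral_const_mul, hχ1, hI]; ring
  have hset : ∀ f : ℝ → ℝ, (∀ t, t ∉ Icc (min a₁ a₂) (max b₁ b₂) → f t = 0) →
      ∫ t in Ioo 0 T, f t = ∫ t, f t := fun f hf => by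
    refine setIntegral_eq_integral_of_forall_compl_eq_zero fun t ht => hf t fun hh => ht ?_
    exact ⟨(lt_min ha₁ ha₂).trans_le hh.1, hh.2.trans_lt (max_lt hb₁ hb₂)⟩
  set η : ℝ → ℝ := fun t => ∫ r in (0 : ℝ)..t, θ r with hη
  have hηd : ∀ t, HasDerivAt η (θ t) t := fun t =>
    intervalIntegral.integral_hasDerivAt_right (hθs.continuous.intervalIntegrable _ _)
      (hθs.continuous.stronglyMeasurableAtFilter _ _) hθs.continuous.continuousAt
  have hηd' : deriv η = θ := funext fun t => (hηd t).deriv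
  have hηT : IsTimeTest T η := by
    refine ⟨?_, min a₁ a₂, max b₁ b₂, lt_min ha₁ ha₂, max_lt hb₁ hb₂, fun t ht => ?_⟩
    · rw [contDiff_infty_iff_deriv]
      exact ⟨fun t => (hηd t).differentiableAt, hηd' ▸ hθs⟩
    · rcases lt_or_ge t (min a₁ a₂) with hlt | hge
      · simp only [hη]
        rw [intervalIntegral.integral_congr (g := fun _ => (0 : ℝ)), intervalIntegral.integral_zero]
        intro r hr
        refine hθ0 r fun hh => ?_
        have : r ≤ max 0 t := hr.2
        exact absurd (hh.1.trans this) (not_le.mpr (max_lt (lt_min ha₁ ha₂) hlt))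
      · have hgt : max b₁ b₂ < t := by
          by_contra hcon
          exact ht ⟨hge, not_lt.mp hcon⟩
        have ht0 : 0 ≤ t := (lt_min ha₁ ha₂).le.trans hge
        simp only [hη]
        rw [intervalIntegral.integral_of_le ht0]
        refine Eq.trans ?_ hθI
        refine setIntegral_eq_integral_of_forall_compl_eq_zero fun r hr => hθ0 r fun hh => hr ?_
        exact ⟨(lt_min ha₁ ha₂).trans_le hh.1, hh.2.trans hgt.le⟩
  have h3 := hw0 η hηT
  rw [hηd'] at h3
  have h4 : ∫ t in Ioo 0 T, w t * θ t = (∫ t in Ioo 0 T, w t * ζ t) - I * C := by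
    simp only [hθ, mul_sub]
    rw [integral_sub (integrableOn_mul_continuous hwi hζs.continuous)]
    · congr 1
      rw [hC, ← integral_const_mul]
      exact integral_congr_ae (Eventually.of_forall fun t => by ring)
    · exact integrableOn_mul_continuous hwi (continuous_const.mul hχs.continuous)
  have hζ0 : ∀ t, t ∉ Ioo 0 T → ζ t = 0 := fun t ht =>
    image_eq_zero_of_notMem_tsupport fun hh => ht (hζT hh)
  have h5 : ∫ t, ζ t • (w t - C) = ∫ t in Ioo 0 T, (w t * ζ t - C * ζ t) := by
    rw [← setIntegral_eq_integral_of_forall_compl_eq_zero (s := Ioo 0 T)]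
    · exact integral_congr_ae (Eventually.of_forall fun t => by simp only [smul_eq_mul]; ring)
    · intro t ht; rw [hζ0 t ht, zero_smul]
  rw [h5, integral_sub (integrableOn_mul_continuous hwi hζs.continuous)
    (hζi.integrableOn.const_mul C), integral_const_mul,
    setIntegral_eq_integral_of_forall_compl_eq_zero hζ0]
  rw [h4] at h3
  linarith

/-- **Gronwall's inequality** in integral form with an integrable coefficient, for a bounded
measurable function which satisfies the inequality almost everywhere.  The constant depends only on
the coefficient. -/
theorem exists_gronwall {T : ℝ} (hT : 0 < T) {L : ℝ → ℝ} (hL0 : ∀ t, 0 ≤ L t)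
    (hL : IntegrableOn L (Ioo 0 T)) :
    ∃ C : ℝ, 0 ≤ C ∧ ∀ (g : ℝ → ℝ) (h K : ℝ), 0 ≤ h →
      AEStronglyMeasurable g (volume.restrict (Ioo 0 T)) →
      (∀ᵐ t ∂volume.restrict (Ioo 0 T), 0 ≤ g t ∧ g t ≤ K) →
      (∀ᵐ t ∂volume.restrict (Ioo 0 T), g t ≤ h + ∫ s in (0 : ℝ)..t, L s * g s) →
      ∀ t ∈ Icc 0 T, g t ≤ h + ∫ s in (0 : ℝ)..t, L s * g s → g t ≤ C * h := by
  -- split `L` into a bounded part and a part with small integral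
  obtain ⟨n, hn⟩ : ∃ n : ℕ, ∫ s in Ioo 0 T, (L s - min (L s) n) ≤ 1 / 4 := by
    have h1 : Tendsto (fun n : ℕ => ∫ s in Ioo 0 T, (L s - min (L s) n)) atTop
        (𝓝 (∫ s in Ioo 0 T, (0 : ℝ))) := by
      refine tendsto_integral_of_dominated_convergence L (fun n => ?_) hL
        (fun n => Eventually.of_forall fun s => ?_) (Eventually.of_forall fun s => ?_)
      · exact hL.aestronglyMeasurable.sub (hL.aestronglyMeasurable.inf aestronglyMeasurable_const)
      · have h2 : 0 ≤ min (L s) n := le_min (hL0 s) (Nat.cast_nonneg n)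
        rw [Real.norm_of_nonneg (sub_nonneg.mpr (min_le_left _ _))]
        linarith
      · obtain ⟨m, hm⟩ := exists_nat_ge (L s)
        refine tendsto_const_nhds.congr' ?_
        filter_upwards [eventually_ge_atTop m] with k hk
        rw [min_eq_left (hm.trans (Nat.cast_le.mpr hk)), sub_self]
    rw [integral_zero] at h1
    exact ((h1.eventually (gt_mem_nhds (by norm_num : (0 : ℝ) < 1 / 4))).exists).imp
      fun n hn => hn.le
  set R : ℝ → ℝ := fun s => L s - min (L s) n with hR
  have hR0 : ∀ s, 0 ≤ R s := fun s => sub_nonneg.mpr (min_le_left _ _)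
  have hRi : IntegrableOn R (Ioo 0 T) := by
    refine Integrable.mono' hL (hL.aestronglyMeasurable.sub
      (hL.aestronglyMeasurable.inf aestronglyMeasurable_const)) (Eventually.of_forall fun s => ?_)
    have h2 : 0 ≤ min (L s) n := le_min (hL0 s) (Nat.cast_nonneg n)
    rw [Real.norm_of_nonneg (hR0 s)]
    simp only [hR]; linarith
  set lam : ℝ := 4 * n + 1 with hlam
  have hlam0 : 0 < lam := by positivity
  have h0 : (0 : ℝ) ∈ Icc 0 T := ⟨le_rfl, hT.le⟩
  -- integration against `L` halves a bound by a multiple of `exp (lam * t)`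
  have step : ∀ (g : ℝ → ℝ) (S : ℝ), 0 ≤ S → AEStronglyMeasurable g (volume.restrict (Ioo 0 T)) →
      (∀ᵐ t ∂volume.restrict (Ioo 0 T), 0 ≤ g t ∧ g t ≤ S * Real.exp (lam * t)) →
      ∀ t ∈ Icc 0 T, ∫ s in (0 : ℝ)..t, L s * g s ≤ S / 2 * Real.exp (lam * t) := by
    intro g S hS hgm hg t ht
    have hexp : ∫ s in (0 : ℝ)..t, Real.exp (lam * s) = (Real.exp (lam * t) - 1) / lam := by
      rw [intervalIntegral.integral_comp_mul_left _ hlam0.ne', integral_exp]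
      simp [div_eq_inv_mul]
    have hgi : IntegrableOn (fun s => L s * g s) (Ioo 0 T) := by
      refine Integrable.mono' (hL.mul_const (S * Real.exp (lam * T)))
        (hL.aestronglyMeasurable.mul hgm) ?_
      filter_upwards [hg, ae_restrict_mem measurableSet_Ioo] with s hs hsT
      rw [Real.norm_of_nonneg (mul_nonneg (hL0 s) hs.1)]
      refine mul_le_mul_of_nonneg_left (hs.2.trans ?_) (hL0 s)
      have := hsT.2.le
      gcongr
    have hRt : ∫ s in (0 : ℝ)..t, R s ≤ 1 / 4 := by
      rw [intervalIntegral.integral_of_le ht.1, integral_Ioc_eq_integral_Ioo]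
      refine (setIntegral_mono_set hRi (Eventually.of_forall hR0) ?_).trans hn
      exact (Ioo_subset_Ioo_right ht.2).eventuallyLE
    have hei : IntervalIntegrable (fun s => n * S * Real.exp (lam * s)) volume 0 t :=
      Continuous.intervalIntegrable (by fun_prop) _ _
    have hRi' := (intervalIntegrable_of_Ioo hRi h0 ht).mul_const (S * Real.exp (lam * t))
    have hle : ∫ s in (0 : ℝ)..t, L s * g s ≤
        ∫ s in (0 : ℝ)..t, (n * S * Real.exp (lam * s) + R s * (S * Real.exp (lam * t))) := by
      refine intervalIntegral.integral_mono_ae_restrict ht.1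
        (intervalIntegrable_of_Ioo hgi h0 ht) (hei.add hRi') ?_
      filter_upwards [ae_restrict_Icc_of_Ioo hg ht, ae_restrict_mem measurableSet_Icc]
        with s hs hst
      have hmin : 0 ≤ min (L s) n := le_min (hL0 s) (Nat.cast_nonneg n)
      have e1 : Real.exp (lam * s) ≤ Real.exp (lam * t) := by
        have := hst.2
        gcongr
      calc L s * g s = min (L s) n * g s + R s * g s := by simp only [hR]; ring
        _ ≤ n * (S * Real.exp (lam * s)) + R s * (S * Real.exp (lam * t)) := by
          refine add_le_add (mul_le_mul (min_le_right _ _) hs.2 hs.1 (Nat.cast_nonneg n))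
            (mul_le_mul_of_nonneg_left (hs.2.trans ?_) (hR0 s))
          gcongr
        _ = _ := by ring
    refine hle.trans ?_
    rw [intervalIntegral.integral_add hei hRi', intervalIntegral.integral_const_mul,
      intervalIntegral.integral_mul_const, hexp]
    have e2 : n * S * ((Real.exp (lam * t) - 1) / lam) ≤ S / 4 * Real.exp (lam * t) := by
      have e3 : (Real.exp (lam * t) - 1) / lam * (4 * n) ≤ Real.exp (lam * t) := by
        rw [div_mul_eq_mul_div, div_le_iff₀ hlam0, hlam]
        have := Real.exp_pos ((4 * n + 1) * t)
        nlinarith [Nat.cast_nonneg (α := ℝ) n]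
      nlinarith
    have e4 := mul_le_mul_of_nonneg_right hRt (mul_nonneg hS (Real.exp_pos (lam * t)).le)
    linarith
  refine ⟨2 * Real.exp (lam * T), by positivity, fun g h K hh hgm hgK hg t ht hgt => ?_⟩
  -- the part of the bound that is due to `K` is halved by each iteration
  have hiter : ∀ m : ℕ, ∀ᵐ t ∂volume.restrict (Ioo 0 T),
      0 ≤ g t ∧ g t ≤ (2 * h + max K 0 / 2 ^ m) * Real.exp (lam * t) := by
    intro m
    induction m with
    | zero =>
      filter_upwards [hgK, ae_restrict_mem measurableSet_Ioo] with t ht htT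
      refine ⟨ht.1, ?_⟩
      have e1 : 1 ≤ Real.exp (lam * t) := Real.one_le_exp (mul_nonneg hlam0.le htT.1.le)
      have e2 : 0 ≤ max K 0 := le_max_right _ _
      have e3 : K ≤ max K 0 := le_max_left _ _
      rw [pow_zero, div_one]
      nlinarith [ht.2]
    | succ m ih =>
      have hS : 0 ≤ 2 * h + max K 0 / 2 ^ m := by positivity
      filter_upwards [ih, hg, ae_restrict_mem measurableSet_Ioo] with t ht hgt htT
      refine ⟨ht.1, hgt.trans ?_⟩
      have e1 := step g _ hS hgm ih t (Ioo_subset_Icc_self htT)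
      have e2 : 1 ≤ Real.exp (lam * t) := Real.one_le_exp (mul_nonneg hlam0.le htT.1.le)
      calc _ ≤ h * Real.exp (lam * t) + (2 * h + max K 0 / 2 ^ m) / 2 * Real.exp (lam * t) := by
            nlinarith
        _ = _ := by rw [pow_succ]; ring
  have hlim : ∀ᵐ t ∂volume.restrict (Ioo 0 T), 0 ≤ g t ∧ g t ≤ 2 * h * Real.exp (lam * t) := by
    filter_upwards [ae_all_iff.mpr hiter] with t ht
    refine ⟨(ht 0).1, ?_⟩
    have h1 : Tendsto (fun m : ℕ => (2 * h + max K 0 / 2 ^ m) * Real.exp (lam * t)) atTop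
        (𝓝 ((2 * h + 0) * Real.exp (lam * t))) := by
      refine Tendsto.mul_const _ (Tendsto.const_add _ ?_)
      refine Tendsto.const_div_atTop ?_ _
      exact tendsto_pow_atTop_atTop_of_one_lt one_lt_two
    rw [add_zero] at h1
    exact ge_of_tendsto' h1 fun m => (ht m).2
  have e1 := step g (2 * h) (by positivity) hgm hlim t ht
  have e2 : 1 ≤ Real.exp (lam * t) := Real.one_le_exp (mul_nonneg hlam0.le ht.1)
  have e3 : Real.exp (lam * t) ≤ Real.exp (lam * T) := by
    have := ht.2
    gcongr
  nlinarith

/-! ### Evolution of the energies along solutions -/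

/-- `w` is the value at time `t` of a solution of `∂ₜA + div G = 0`, `A|_{t=0} = A₀`, expressed
through Fourier coefficients. -/
def EvolvesTo {d : ℕ} (G : ℝ → Fin d → Fin d → ScalarL2 d) (A₀ w : Fin d → ScalarL2 d) (t : ℝ) :
    Prop :=
  ∀ i k, coeff (w i) k = coeff (A₀ i) k + ∫ r in (0 : ℝ)..t, rate (G r) i k

/-- `G` is a flux with Fourier coefficients measurable in time, and dominated by the function `γ`
which is integrable on `(0,T)`. -/
structure IsFlux {d : ℕ} (T : ℝ) (G : ℝ → Fin d → Fin d → ScalarL2 d) (γ : ℝ → ℝ) : Prop where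
  meas : ∀ i j k, AEStronglyMeasurable (fun s => coeff (G s i j) k) (volume.restrict (Ioo 0 T))
  bound : ∀ᵐ s ∂volume.restrict (Ioo 0 T), ∀ i j, ‖G s i j‖ ≤ γ s
  integrable : IntegrableOn γ (Ioo 0 T)

theorem restrict_Ioc_le {T t : ℝ} (ht : t ∈ Icc 0 T) :
    volume.restrict (Ioc 0 t) ≤ volume.restrict (Ioo 0 T) := by
  rw [Measure.restrict_congr_set (Ioo_ae_eq_Ioc (μ := volume) (a := (0 : ℝ)) (b := T))]
  exact Measure.restrict_mono (Ioc_subset_Ioc_right ht.2) le_rfl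

theorem ae_uIoc_of_Ioo {T t : ℝ} {p : ℝ → Prop} (ht : t ∈ Icc 0 T)
    (h : ∀ᵐ s ∂volume.restrict (Ioo 0 T), p s) : ∀ᵐ s, s ∈ uIoc 0 t → p s := by
  rw [uIoc_of_le ht.1, ← ae_restrict_iff' measurableSet_Ioc]
  exact ae_mono (restrict_Ioc_le ht) h

section

variable {d : ℕ} {T : ℝ} {G : ℝ → Fin d → Fin d → ScalarL2 d} {γ : ℝ → ℝ}

theorem norm_rate_le {G : Fin d → Fin d → ScalarL2 d} {c : ℝ} (hG : ∀ i j, ‖G i j‖ ≤ c)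
    (i : Fin d) (k : Fin d → ℤ) : ‖rate G i k‖ ≤ (∑ j, |freq k j|) * c := by
  rw [rate, Finset.sum_mul]
  refine norm_sum_le_of_le _ fun j _ => ?_
  rw [norm_mul, RCLike.norm_conj, norm_mul, Complex.norm_I, one_mul, Complex.norm_real,
    Real.norm_eq_abs]
  exact mul_le_mul_of_nonneg_left ((norm_coeff_le _ k).trans (hG i j)) (abs_nonneg _)

theorem IsFlux.aestronglyMeasurable_rate (hG : IsFlux T G γ) (i : Fin d) (k : Fin d → ℤ) :
    AEStronglyMeasurable (fun s => rate (G s) i k) (volume.restrict (Ioo 0 T)) := by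
  unfold rate
  exact Finset.aestronglyMeasurable_fun_sum _ fun j _ => (hG.meas i j k).const_mul _

theorem IsFlux.integrable_rate (hG : IsFlux T G γ) (i : Fin d) (k : Fin d → ℤ) :
    IntegrableOn (fun s => rate (G s) i k) (Ioo 0 T) := by
  refine Integrable.mono' (hG.integrable.const_mul (∑ j, |freq k j|))
    (hG.aestronglyMeasurable_rate i k) ?_
  filter_upwards [hG.bound] with s hs
  exact norm_rate_le hs i k

variable {W : ℝ → Fin d → ScalarL2 d} {W₀ : Fin d → ScalarL2 d} {K ε : ℝ}

theorem aestronglyMeasurable_coeff_of_evolves (hT : 0 < T) (hG : IsFlux T G γ)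
    (hW : ∀ᵐ s ∂volume.restrict (Ioo 0 T), EvolvesTo G W₀ (W s) s) (i : Fin d)
    (k : Fin d → ℤ) :
    AEStronglyMeasurable (fun s => coeff (W s i) k) (volume.restrict (Ioo 0 T)) := by
  have h1 : ContinuousOn (fun s => coeff (W₀ i) k + ∫ r in (0 : ℝ)..s, rate (G r) i k)
      (Ioo 0 T) :=
    ((continuousOn_primitive_Icc hT (hG.integrable_rate i k)).mono Ioo_subset_Icc_self).const_add _
  refine (h1.aestronglyMeasurable measurableSet_Ioo).congr ?_
  filter_upwards [hW] with s hs
  exact (hs i k).symm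

theorem aestronglyMeasurable_power (hε : 0 < ε)
    (hWm : ∀ i k, AEStronglyMeasurable (fun s => coeff (W s i) k) (volume.restrict (Ioo 0 T)))
    (hG : IsFlux T G γ) :
    AEStronglyMeasurable (fun s => power ε (W s) (G s)) (volume.restrict (Ioo 0 T)) := by
  unfold power
  refine Finset.aestronglyMeasurable_fun_sum _ fun i _ => ?_
  refine aestronglyMeasurable_of_tendsto_ae (atTop : Filter (Finset (Fin d → ℤ)))
    (f := fun S s => ∑ k ∈ S, 2 * (resSymbol ε k *
      ((starRingEnd ℂ) (coeff (W s i) k) * rate (G s) i k).re)) (fun S => ?_)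
    (Eventually.of_forall fun s => hasSum_power_term hε (W s) (G s) i)
  refine Finset.aestronglyMeasurable_fun_sum _ fun k _ => ?_
  refine AEStronglyMeasurable.const_mul (AEStronglyMeasurable.const_mul ?_ _) _
  exact Complex.continuous_re.comp_aestronglyMeasurable
    ((Complex.continuous_conj.comp_aestronglyMeasurable (hWm i k)).mul
      (hG.aestronglyMeasurable_rate i k))

theorem aestronglyMeasurable_energy (hε : 0 ≤ ε)
    (hWm : ∀ i k, AEStronglyMeasurable (fun s => coeff (W s i) k) (volume.restrict (Ioo 0 T))) :
    AEStronglyMeasurable (fun s => energy ε (W s)) (volume.restrict (Ioo 0 T)) := by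
  unfold energy
  refine Finset.aestronglyMeasurable_fun_sum _ fun i _ => ?_
  refine aestronglyMeasurable_of_tendsto_ae (atTop : Filter (Finset (Fin d → ℤ)))
    (f := fun S s => ∑ k ∈ S, resSymbol ε k * ‖coeff (W s i) k‖ ^ 2) (fun S => ?_)
    (Eventually.of_forall fun s => (summable_energy hε (W s i)).hasSum)
  refine Finset.aestronglyMeasurable_fun_sum _ fun k _ => ?_
  exact ((hWm i k).norm.pow 2).const_mul _

/-- Only the case `ε > 0` is regular enough for the series and the time integral to be
interchanged. -/
theorem lintegral_tsum_power_term_lt_top (hε : 0 < ε) (hG : IsFlux T G γ)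
    (hK : ∀ᵐ s ∂volume.restrict (Ioo 0 T), ∀ i, ‖W s i‖ ≤ K) (i : Fin d) :
    ∫⁻ s in Ioo 0 T, ∑' k, ‖2 * (resSymbol ε k *
      ((starRingEnd ℂ) (coeff (W s i) k) * rate (G s) i k).re)‖ₑ < ∞ := by
  set C := 1 + ε⁻¹ with hC
  have hβ : IntegrableOn (fun s => ∑ _j : Fin d, ((γ s + 1) * (C * K) ^ 2 + γ s)) (Ioo 0 T) := by
    refine integrable_finsetSum _ fun j _ => Integrable.add (Integrable.mul_const ?_ _)
      hG.integrable
    exact hG.integrable.add (integrableOn_const (by simp))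
  refine lt_of_le_of_lt (lintegral_mono_ae ?_) hβ.lintegral_lt_top
  filter_upwards [hG.bound, hK] with s hGs hKs
  rcases isEmpty_or_nonempty (Fin d) with hd | ⟨⟨j₀⟩⟩
  · exact isEmptyElim i
  have hγ : 0 ≤ γ s := (norm_nonneg _).trans (hGs j₀ j₀)
  have hsum : ∀ j, HasSum (fun k => (γ s + 1) * ‖coeff (derivResolventOp ε j (W s i)) k‖ ^ 2
      + (γ s + 1)⁻¹ * ‖coeff (G s i j) k‖ ^ 2)
      ((γ s + 1) * ‖derivResolventOp ε j (W s i)‖ ^ 2 + (γ s + 1)⁻¹ * ‖G s i j‖ ^ 2) := fun j =>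
    ((hasSum_sq_coeff _).mul_left _).add ((hasSum_sq_coeff _).mul_left _)
  have hsum' := hasSum_sum (s := Finset.univ) fun j _ => hsum j
  have hterm : ∀ k, ‖2 * (resSymbol ε k *
      ((starRingEnd ℂ) (coeff (W s i) k) * rate (G s) i k).re)‖ ≤
      ∑ j, ((γ s + 1) * ‖coeff (derivResolventOp ε j (W s i)) k‖ ^ 2
      + (γ s + 1)⁻¹ * ‖coeff (G s i j) k‖ ^ 2) := by
    intro k
    have e1 : 2 * (resSymbol ε k * ((starRingEnd ℂ) (coeff (W s i) k) * rate (G s) i k).re) =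
        ∑ j, 2 * ((starRingEnd ℂ) (coeff (derivResolventOp ε j (W s i)) k)
          * coeff (G s i j) k).re := by
      rw [← Finset.mul_sum, ← Complex.re_sum, ← Complex.re_ofReal_mul, rate, Finset.mul_sum,
        Finset.mul_sum]
      congr 2
      refine Finset.sum_congr rfl fun j _ => ?_
      rw [derivResolventOp, coeff_fourierMult (norm_derivSymbol_le hε j)]
      simp only [map_mul, Complex.conj_ofReal]
      ring
    rw [e1]
    refine norm_sum_le_of_le _ fun j _ => ?_
    set a := coeff (derivResolventOp ε j (W s i)) k
    set b := coeff (G s i j) k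
    have e2 : ‖2 * ((starRingEnd ℂ) a * b).re‖ ≤ 2 * (‖a‖ * ‖b‖) := by
      rw [norm_mul, Real.norm_two]
      refine mul_le_mul_of_nonneg_left ?_ two_pos.le
      have := Complex.abs_re_le_norm ((starRingEnd ℂ) a * b)
      rwa [norm_mul, RCLike.norm_conj] at this
    refine e2.trans ?_
    have hp : 0 < γ s + 1 := by linarith
    have e3 : (γ s + 1) * ‖a‖ ^ 2 + (γ s + 1)⁻¹ * ‖b‖ ^ 2 - 2 * (‖a‖ * ‖b‖) =
        (γ s + 1)⁻¹ * ((γ s + 1) * ‖a‖ - ‖b‖) ^ 2 := by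
      field_simp; ring
    have e4 : 0 ≤ (γ s + 1)⁻¹ * ((γ s + 1) * ‖a‖ - ‖b‖) ^ 2 := by positivity
    linarith
  calc _ ≤ ∑' k, ENNReal.ofReal (∑ j, ((γ s + 1) * ‖coeff (derivResolventOp ε j (W s i)) k‖ ^ 2
      + (γ s + 1)⁻¹ * ‖coeff (G s i j) k‖ ^ 2)) := by
        refine ENNReal.tsum_le_tsum fun k => ?_
        rw [← ofReal_norm]
        exact ENNReal.ofReal_le_ofReal (hterm k)
    _ = ENNReal.ofReal (∑ j, ((γ s + 1) * ‖derivResolventOp ε j (W s i)‖ ^ 2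
        + (γ s + 1)⁻¹ * ‖G s i j‖ ^ 2)) := by
        rw [← hsum'.tsum_eq, ENNReal.ofReal_tsum_of_nonneg (fun k =>
          (norm_nonneg _).trans (hterm k)) hsum'.summable]
    _ ≤ _ := by
        refine ENNReal.ofReal_le_ofReal (Finset.sum_le_sum fun j _ => add_le_add ?_ ?_)
        · have h1 := (norm_derivResolventOp_le hε j (W s i)).trans
            (mul_le_mul_of_nonneg_left (hKs i) (by positivity))
          gcongr
        · have hp : 0 < γ s + 1 := by linarith
          rw [inv_mul_le_iff₀ hp]
          nlinarith [hGs i j, norm_nonneg (G s i j)]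

/-- **Evolution of the resolvent energy** along a solution of `∂ₜW + div G = 0`. -/
theorem energy_evolution (hT : 0 < T) (hε : 0 < ε) (hG : IsFlux T G γ)
    (hK : ∀ᵐ s ∂volume.restrict (Ioo 0 T), ∀ i, ‖W s i‖ ≤ K)
    (hW : ∀ᵐ s ∂volume.restrict (Ioo 0 T), EvolvesTo G W₀ (W s) s)
    {t : ℝ} (ht : t ∈ Icc 0 T) {w : Fin d → ScalarL2 d} (hw : EvolvesTo G W₀ w t) :
    energy ε w = energy ε W₀ + ∫ s in (0 : ℝ)..t, power ε (W s) (G s) := by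
  have h0 : (0 : ℝ) ∈ Icc 0 T := ⟨le_rfl, hT.le⟩
  set F : Fin d → (Fin d → ℤ) → ℝ → ℝ := fun i k s => 2 * (resSymbol ε k *
      ((starRingEnd ℂ) (coeff (W s i) k) * rate (G s) i k).re) with hF
  have hWm := fun i k => aestronglyMeasurable_coeff_of_evolves hT hG hW i k
  have hFm : ∀ i k, AEStronglyMeasurable (F i k) (volume.restrict (Ioo 0 T)) := fun i k =>
    AEStronglyMeasurable.const_mul (AEStronglyMeasurable.const_mul
    (Complex.continuous_re.comp_aestronglyMeasurable
    ((Complex.continuous_conj.comp_aestronglyMeasurable (hWm i k)).mul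
      (hG.aestronglyMeasurable_rate i k))) _) _
  have hFfin : ∀ i, ∑' k, ∫⁻ s in Ioo 0 T, ‖F i k s‖ₑ < ∞ := fun i => by
    rw [← lintegral_tsum fun k => (hFm i k).enorm]
    exact lintegral_tsum_power_term_lt_top hε hG hK i
  have hFi : ∀ i k, IntegrableOn (F i k) (Ioo 0 T) := fun i k =>
    ⟨hFm i k, lt_of_le_of_lt (ENNReal.le_tsum k) (hFfin i)⟩
  -- on each mode this is the chain rule for the squared modulus; the modes are then summed
  have hmode : ∀ i k, resSymbol ε k * ‖coeff (w i) k‖ ^ 2 - resSymbol ε k * ‖coeff (W₀ i) k‖ ^ 2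
      = ∫ s in Ioc 0 t, F i k s := by
    intro i k
    rw [hw i k, normSq_primitive (hG.integrable_rate i k) _ ht,
      ← intervalIntegral.integral_of_le ht.1, mul_add, add_sub_cancel_left,
      ← intervalIntegral.integral_const_mul]
    refine intervalIntegral.integral_congr_ae ?_
    filter_upwards [ae_uIoc_of_Ioo ht hW] with s hs hst
    rw [← hs hst i k]
    simp only [hF]
    ring
  have hcomp : ∀ i, ∑' k, resSymbol ε k * ‖coeff (w i) k‖ ^ 2 -
      ∑' k, resSymbol ε k * ‖coeff (W₀ i) k‖ ^ 2 =
      ∫ s in Ioc 0 t, ∑ j, 2 * (inner ℂ (derivResolventOp ε j (W s i)) (G s i j)).re := by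
    intro i
    rw [← (summable_energy hε.le (w i)).tsum_sub (summable_energy hε.le (W₀ i))]
    simp only [hmode]
    rw [← integral_tsum (fun k => (hFm i k).mono_measure (restrict_Ioc_le ht))]
    · exact integral_congr_ae (Eventually.of_forall fun s =>
        (hasSum_power_term hε (W s) (G s) i).tsum_eq)
    · refine ne_top_of_le_ne_top (hFfin i).ne (ENNReal.tsum_le_tsum fun k => ?_)
      exact lintegral_mono' (restrict_Ioc_le ht) le_rfl
  have hint : ∀ i, IntegrableOn (fun s => ∑ j, 2 * (inner ℂ (derivResolventOp ε j (W s i))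
      (G s i j)).re) (Ioc 0 t) := by
    intro i
    have h1 : IntegrableOn (fun s => ∑' k, F i k s) (Ioo 0 T) := by
      refine ⟨?_, ?_⟩
      · refine aestronglyMeasurable_of_tendsto_ae (atTop : Filter (Finset (Fin d → ℤ)))
          (f := fun S s => ∑ k ∈ S, F i k s)
          (fun S => Finset.aestronglyMeasurable_fun_sum _ fun k _ => hFm i k)
          (Eventually.of_forall fun s => ?_)
        have := (hasSum_power_term hε (W s) (G s) i).summable.hasSum
        exact this
      · refine lt_of_le_of_lt (lintegral_mono fun s => ?_)
          (lintegral_tsum_power_term_lt_top hε hG hK i)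
        exact enorm_tsum_le_tsum_enorm
    have h2 := Integrable.mono_measure h1 (restrict_Ioc_le ht)
    exact h2.congr (Eventually.of_forall fun s => (hasSum_power_term hε (W s) (G s) i).tsum_eq)
  rw [← sub_eq_iff_eq_add', intervalIntegral.integral_of_le ht.1]
  unfold energy power
  rw [integral_finsetSum _ fun i _ => hint i, ← Finset.sum_sub_distrib]
  exact Finset.sum_congr rfl fun i _ => hcomp i

theorem fieldSq_le {A : Fin d → ScalarL2 d} {K : ℝ} (hA : ∀ i, ‖A i‖ ≤ K) :
    fieldSq A ≤ d * K ^ 2 := by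
  calc fieldSq A ≤ ∑ _i : Fin d, K ^ 2 := Finset.sum_le_sum fun i _ => by
        have := hA i
        gcongr
    _ = _ := by simp

/-- `g` is the gradient of the divergence-free velocity `v`, with `|∂ₖvʲ(s, ·)| ≤ L s` for almost
every time. -/
def IsLipFlow (T : ℝ) (v : ℝ → Fin d → ScalarLinf d) (g : ℝ → Fin d → Fin d → ScalarLinf d)
    (L : ℝ → ℝ) : Prop :=
  ∀ᵐ s ∂volume.restrict (Ioo 0 T), IsLipField (v s) (g s) ∧ ∀ k j, ‖g s k j‖ ≤ L s

variable {v : ℝ → Fin d → ScalarLinf d} {g : ℝ → Fin d → Fin d → ScalarLinf d} {L : ℝ → ℝ}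

theorem ae_tendsto_power (hv : IsLipFlow T v g L)
    (hsol : ∀ᵐ s ∂volume.restrict (Ioo 0 T), IsSolenoidal (W s)) :
    ∀ᵐ s ∂volume.restrict (Ioo 0 T), Tendsto (fun n => power (epsSeq n) (W s) (flux (v s) (W s)))
      atTop (𝓝 (gradForm (g s) (W s) (W s)).re) := by
  filter_upwards [hv, hsol] with s hs hss
  simp only [power_flux]
  exact (Complex.continuous_re.tendsto _).comp (tendsto_transportForm hs.1 hs.2 hss)

theorem aestronglyMeasurable_gradForm (hv : IsLipFlow T v g L)
    (hsol : ∀ᵐ s ∂volume.restrict (Ioo 0 T), IsSolenoidal (W s))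
    (hWm : ∀ i k, AEStronglyMeasurable (fun s => coeff (W s i) k) (volume.restrict (Ioo 0 T)))
    (hG : IsFlux T (fun s => flux (v s) (W s)) γ) :
    AEStronglyMeasurable (fun s => (gradForm (g s) (W s) (W s)).re)
      (volume.restrict (Ioo 0 T)) :=
  aestronglyMeasurable_of_tendsto_ae atTop
    (fun n => aestronglyMeasurable_power (epsSeq_pos n) hWm hG) (ae_tendsto_power hv hsol)

/-- The **energy identity** `‖W(t)‖² = ‖W₀‖² + ∫₀ᵗ ∫ (WʲWⁱ + WⁱWʲ) ∂ⱼvⁱ`.  It is the limit `ε → 0`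
of the identity for the resolvent energy. -/
theorem energy_identity (hT : 0 < T) (hv : IsLipFlow T v g L) (hL : IntegrableOn L (Ioo 0 T))
    (hsol : ∀ᵐ s ∂volume.restrict (Ioo 0 T), IsSolenoidal (W s))
    (hG : IsFlux T (fun s => flux (v s) (W s)) γ)
    (hK : ∀ᵐ s ∂volume.restrict (Ioo 0 T), ∀ i, ‖W s i‖ ≤ K)
    (hW : ∀ᵐ s ∂volume.restrict (Ioo 0 T), EvolvesTo (fun s => flux (v s) (W s)) W₀ (W s) s)
    {t : ℝ} (ht : t ∈ Icc 0 T) {w : Fin d → ScalarL2 d}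
    (hw : EvolvesTo (fun s => flux (v s) (W s)) W₀ w t) :
    fieldSq w = fieldSq W₀ + ∫ s in (0 : ℝ)..t, (gradForm (g s) (W s) (W s)).re := by
  have hWm := fun i k => aestronglyMeasurable_coeff_of_evolves hT hG hW i k
  have h0 : (0 : ℝ) ∈ Icc 0 T := ⟨le_rfl, hT.le⟩
  have h1 : Tendsto (fun n => ∫ s in (0 : ℝ)..t, power (epsSeq n) (W s) (flux (v s) (W s))) atTop
      (𝓝 (∫ s in (0 : ℝ)..t, (gradForm (g s) (W s) (W s)).re)) := by
    refine intervalIntegral.tendsto_integral_filter_of_dominated_convergence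
      (fun s => (2 * d ^ 2 + 6 * d ^ 3) * (L s * (d * K ^ 2))) (Eventually.of_forall fun n => ?_)
      (Eventually.of_forall fun n => ?_) ?_ (ae_uIoc_of_Ioo ht (ae_tendsto_power hv hsol))
    · rw [uIoc_of_le ht.1]
      exact (aestronglyMeasurable_power (epsSeq_pos n) hWm hG).mono_measure (restrict_Ioc_le ht)
    · refine ae_uIoc_of_Ioo ht ?_
      filter_upwards [hv, hsol, hK] with s hs hss hKs
      rw [power_flux, Real.norm_eq_abs]
      refine (Complex.abs_re_le_norm _).trans ?_
      refine (norm_transportForm_le (epsSeq_pos n) hs.1 hs.2 hss).trans ?_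
      rcases isEmpty_or_nonempty (Fin d) with hd | ⟨⟨j₀⟩⟩
      · have hd0 : d = 0 := by
          rcases Nat.eq_zero_or_pos d with h | h
          · exact h
          · exact (hd.false ⟨0, h⟩).elim
        subst hd0; simp
      · have hL0 : 0 ≤ L s := (norm_nonneg _).trans (hs.2 j₀ j₀)
        have := (energy_le_fieldSq (epsSeq_pos n).le (W s)).trans (fieldSq_le hKs)
        gcongr
    · exact (((intervalIntegrable_of_Ioo hL h0 ht).mul_const _).const_mul _)
  have h2 : Tendsto (fun n => energy (epsSeq n) w) atTop
      (𝓝 (fieldSq W₀ + ∫ s in (0 : ℝ)..t, (gradForm (g s) (W s) (W s)).re)) := by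
    refine ((tendsto_energy W₀).add h1).congr fun n => ?_
    exact (energy_evolution hT (epsSeq_pos n) hG hK hW ht hw).symm
  exact tendsto_nhds_unique (tendsto_energy w) h2

/-- **Stability in `H⁻¹`.**  The constant depends on the velocity only through the bound `L` of its
gradient. -/
theorem exists_energy_stability (d : ℕ) (hT : 0 < T) (hL0 : ∀ s, 0 ≤ L s)
    (hL : IntegrableOn L (Ioo 0 T)) :
    ∃ C : ℝ, 0 ≤ C ∧ ∀ (v : ℝ → Fin d → ScalarLinf d) (g : ℝ → Fin d → Fin d → ScalarLinf d)
      (W : ℝ → Fin d → ScalarL2 d) (W₀ : Fin d → ScalarL2 d)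
      (F : ℝ → Fin d → Fin d → ScalarL2 d) (f γ : ℝ → ℝ) (K : ℝ), 0 ≤ K →
      IsLipFlow T v g L → (∀ᵐ s ∂volume.restrict (Ioo 0 T), IsSolenoidal (W s)) →
      IsFlux T (fun s i j => flux (v s) (W s) i j + F s i j) γ →
      (∀ s, 0 ≤ f s) → IntegrableOn f (Ioo 0 T) →
      (∀ᵐ s ∂volume.restrict (Ioo 0 T), ∀ i j, ‖F s i j‖ ≤ f s) →
      (∀ᵐ s ∂volume.restrict (Ioo 0 T), ∀ i, ‖W s i‖ ≤ K) →
      (∀ᵐ s ∂volume.restrict (Ioo 0 T),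
        EvolvesTo (fun s i j => flux (v s) (W s) i j + F s i j) W₀ (W s) s) →
      ∀ t ∈ Icc 0 T, EvolvesTo (fun s i j => flux (v s) (W s) i j + F s i j) W₀ (W t) t →
        energy 1 (W t) ≤ C * (energy 1 W₀ + 4 * d ^ 2 * K * ∫ s in Ioo 0 T, f s) := by
  set C₀ : ℝ := 2 * d ^ 2 + 6 * d ^ 3 with hC₀
  have hC₀0 : 0 ≤ C₀ := by positivity
  obtain ⟨C, hC0, hC⟩ := exists_gronwall hT (L := fun s => C₀ * L s)
    (fun s => mul_nonneg hC₀0 (hL0 s)) (hL.const_mul C₀)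
  refine ⟨C, hC0, ?_⟩
  intro v g W W₀ F f γ K hK0 hv hsol hG hf0 hf hF hK hW t ht hWt
  have h0 : (0 : ℝ) ∈ Icc 0 T := ⟨le_rfl, hT.le⟩
  have hWm := fun i k => aestronglyMeasurable_coeff_of_evolves hT hG hW i k
  have hem := aestronglyMeasurable_energy zero_le_one hWm
  have hpm := aestronglyMeasurable_power one_pos hWm hG
  set h := energy 1 W₀ + 4 * d ^ 2 * K * ∫ s in Ioo 0 T, f s with hh
  have hh0 : 0 ≤ h := add_nonneg (energy_nonneg zero_le_one _)
    (mul_nonneg (by positivity) (integral_nonneg hf0))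
  have hbd : ∀ᵐ s ∂volume.restrict (Ioo 0 T),
      0 ≤ energy 1 (W s) ∧ energy 1 (W s) ≤ d * K ^ 2 := by
    filter_upwards [hK] with s hs
    exact ⟨energy_nonneg zero_le_one _, (energy_le_fieldSq zero_le_one _).trans (fieldSq_le hs)⟩
  have hLe : IntegrableOn (fun s => C₀ * L s * energy 1 (W s)) (Ioo 0 T) := by
    refine Integrable.mono' ((hL.const_mul C₀).mul_const (d * K ^ 2))
      ((hL.aestronglyMeasurable.const_mul C₀).mul hem) ?_
    filter_upwards [hbd] with s hs
    have := hL0 s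
    rw [Real.norm_of_nonneg (mul_nonneg (mul_nonneg hC₀0 this) hs.1)]
    exact mul_le_mul_of_nonneg_left hs.2 (mul_nonneg hC₀0 this)
  have hpow : ∀ᵐ s ∂volume.restrict (Ioo 0 T),
      |power 1 (W s) (fun i j => flux (v s) (W s) i j + F s i j)| ≤
        C₀ * L s * energy 1 (W s) + 4 * d ^ 2 * K * f s := by
    filter_upwards [hv, hsol, hF, hK] with s hs hss hFs hKs
    rw [power_add, power_flux]
    refine (abs_add_le _ _).trans (add_le_add ?_ ?_)
    · refine (Complex.abs_re_le_norm _).trans ?_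
      refine (norm_transportForm_le one_pos hs.1 hs.2 hss).trans_eq ?_
      ring
    · refine (abs_power_le one_pos hKs hFs).trans_eq ?_
      norm_num; ring
  have hineq : ∀ t ∈ Icc 0 T,
      EvolvesTo (fun s i j => flux (v s) (W s) i j + F s i j) W₀ (W t) t →
      energy 1 (W t) ≤ h + ∫ s in (0 : ℝ)..t, C₀ * L s * energy 1 (W s) := by
    intro t ht hWt
    rw [energy_evolution hT one_pos hG hK hW ht hWt, hh, add_assoc]
    refine add_le_add_right ?_ _
    have hi1 := intervalIntegrable_of_Ioo hLe h0 ht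
    have hi2 := (intervalIntegrable_of_Ioo hf h0 ht).const_mul (4 * d ^ 2 * K)
    calc ∫ s in (0 : ℝ)..t, power 1 (W s) (fun i j => flux (v s) (W s) i j + F s i j)
        ≤ ∫ s in (0 : ℝ)..t, (C₀ * L s * energy 1 (W s) + 4 * d ^ 2 * K * f s) := by
          refine intervalIntegral.integral_mono_ae_restrict ht.1 ?_ (hi1.add hi2) ?_
          · refine (hi1.add hi2).mono_fun ?_ ?_
            · rw [uIoc_of_le ht.1]
              exact hpm.mono_measure (restrict_Ioc_le ht)
            · rw [uIoc_of_le ht.1]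
              refine ae_mono (restrict_Ioc_le ht) ?_
              filter_upwards [hpow] with s hs
              exact hs.trans (le_abs_self _)
          · filter_upwards [ae_restrict_Icc_of_Ioo hpow ht] with s hs
            exact (le_abs_self _).trans hs
      _ = (∫ s in (0 : ℝ)..t, C₀ * L s * energy 1 (W s))
          + 4 * d ^ 2 * K * ∫ s in (0 : ℝ)..t, f s := by
          rw [intervalIntegral.integral_add hi1 hi2, intervalIntegral.integral_const_mul]
      _ ≤ 4 * d ^ 2 * K * (∫ s in Ioo 0 T, f s) +
          ∫ s in (0 : ℝ)..t, C₀ * L s * energy 1 (W s) := by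
          rw [add_comm]
          refine add_le_add_left (mul_le_mul_of_nonneg_left ?_ (by positivity)) _
          rw [intervalIntegral.integral_of_le ht.1]
          exact integral_mono_measure (restrict_Ioc_le ht) (Eventually.of_forall hf0) hf
  refine hC (fun s => energy 1 (W s)) h (d * K ^ 2) hh0 hem hbd ?_ t ht (hineq t ht hWt)
  filter_upwards [hW, ae_restrict_mem measurableSet_Ioo] with s hs hsT
  exact hineq s (Ioo_subset_Icc_self hsT) hs

end

/-! ### Bounded functions with bounded weak gradient -/

section

variable {d : ℕ}

/-- The `i`-th component of a field, as a complex-valued function. -/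
noncomputable def component (i : Fin d) : L2Field d →L[ℝ] ScalarL2 d :=
  (Complex.ofRealCLM.comp (EuclideanSpace.proj i : Vec d →L[ℝ] ℝ)).compLpL 2 volume

theorem coeFn_component (i : Fin d) (f : L2Field d) :
    component i f =ᵐ[volume] fun x => (f x i : ℂ) :=
  ContinuousLinearMap.coeFn_compLpL _ f

theorem coeff_component (i : Fin d) (f : L2Field d) (k : Fin d → ℤ) :
    coeff (component i f) k = ∫ x, UnitAddTorus.mFourier (-k) x * (f x i : ℂ) := by
  rw [coeff_eq_integral]
  refine integral_congr_ae ?_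
  filter_upwards [coeFn_component i f] with x hx
  rw [hx]

theorem continuous_coeff (k : Fin d → ℤ) : Continuous fun f : ScalarL2 d => coeff f k := by
  unfold coeff
  fun_prop

/-- The trigonometric polynomial with coefficients `a`. -/
noncomputable def trigPoly (a : (Fin d → ℤ) →₀ ℂ) : ScalarL2 d :=
  a.sum fun k z => z • expMode k

/-- The norm of the functional `φ ↦ ∑ₖ conj(φ̂ₖ) bₖ` on trigonometric polynomials with the `L¹`
norm.  When `b` is the family of Fourier coefficients of `h`, this is `‖h‖_∞`. -/
noncomputable def dualNorm (b : (Fin d → ℤ) → ℂ) : ℝ≥0∞ :=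
  ⨆ (a : (Fin d → ℤ) →₀ ℂ) (_ : ∫ x, ‖trigPoly a x‖ ≤ 1),
    ‖a.sum fun k z => (starRingEnd ℂ) z * b k‖ₑ

theorem trigPoly_smul (c : ℂ) (a : (Fin d → ℤ) →₀ ℂ) : trigPoly (c • a) = c • trigPoly a := by
  unfold trigPoly
  rw [Finsupp.sum_smul_index (by simp), Finsupp.smul_sum]
  simp only [smul_smul]

theorem coeFn_trigPoly (a : (Fin d → ℤ) →₀ ℂ) :
    trigPoly a =ᵐ[volume] fun x => a.sum fun k z => z * UnitAddTorus.mFourier k x := by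
  unfold trigPoly Finsupp.sum
  have h := Lp.coeFn_finsetSum a.support fun k => a k • (expMode k : ScalarL2 d)
  have h2 : ∀ᵐ x, ∀ k ∈ a.support, (a k • (expMode k : ScalarL2 d)) x =
      a k * UnitAddTorus.mFourier k x := by
    refine (ae_ball_iff a.support.countable_toSet).mpr fun k _ => ?_
    filter_upwards [Lp.coeFn_smul (a k) (expMode k : ScalarL2 d), coeFn_expMode k] with x h1 h2
    rw [h1, Pi.smul_apply, h2, smul_eq_mul]
  filter_upwards [h, h2] with x h1 h2
  rw [h1, Finset.sum_apply]
  exact Finset.sum_congr rfl h2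

theorem integrable_mFourier_mul {h : UnitAddTorus (Fin d) → ℂ} (hh : Integrable h)
    (k : Fin d → ℤ) : Integrable fun x => UnitAddTorus.mFourier k x * h x := by
  refine hh.bdd_mul (c := 1) (UnitAddTorus.mFourier k).continuous.aestronglyMeasurable
    (Eventually.of_forall fun x => ?_)
  exact ((UnitAddTorus.mFourier k).norm_coe_le_norm x).trans_eq UnitAddTorus.mFourier_norm

theorem sum_conj_mul_eq_integral {h : UnitAddTorus (Fin d) → ℂ} (hh : Integrable h)
    (a : (Fin d → ℤ) →₀ ℂ) :
    (a.sum fun k z => (starRingEnd ℂ) z * ∫ x, UnitAddTorus.mFourier (-k) x * h x) =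
      ∫ x, (starRingEnd ℂ) (trigPoly a x) * h x := by
  have h1 : ∫ x, (starRingEnd ℂ) (trigPoly a x) * h x =
      ∫ x, ∑ k ∈ a.support, (starRingEnd ℂ) (a k) * (UnitAddTorus.mFourier (-k) x * h x) := by
    refine integral_congr_ae ?_
    filter_upwards [coeFn_trigPoly a] with x hx
    rw [hx, Finsupp.sum, map_sum, Finset.sum_mul]
    refine Finset.sum_congr rfl fun k _ => ?_
    rw [map_mul, UnitAddTorus.mFourier_neg, mul_assoc]
  rw [h1, integral_finsetSum _ fun k _ => (integrable_mFourier_mul hh (-k)).const_mul _]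
  simp only [integral_const_mul]
  rfl

theorem integrable_of_L2 (f : ScalarL2 d) : Integrable f :=
  (Lp.memLp f).integrable one_le_two

theorem dualNorm_le_eLpNorm {h : UnitAddTorus (Fin d) → ℂ} (hh : Integrable h) :
    dualNorm (fun k => ∫ x, UnitAddTorus.mFourier (-k) x * h x) ≤ eLpNorm h ∞ volume := by
  refine iSup₂_le fun a ha => ?_
  rw [sum_conj_mul_eq_integral hh]
  refine (enorm_integral_le_lintegral_enorm _).trans ?_
  calc _ ≤ ∫⁻ x, eLpNorm h ∞ volume * ‖trigPoly a x‖ₑ := by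
        refine lintegral_mono_ae ?_
        filter_upwards [enorm_ae_le_eLpNormEssSup h volume] with x hx
        rw [enorm_mul, mul_comm, RCLike.enorm_conj, eLpNorm_exponent_top]
        gcongr
    _ = eLpNorm h ∞ volume * ∫⁻ x, ‖trigPoly a x‖ₑ :=
        lintegral_const_mul'' _ (Lp.aestronglyMeasurable _).enorm
    _ ≤ eLpNorm h ∞ volume * 1 := by
        gcongr
        rw [← ofReal_integral_norm_eq_lintegral_enorm (integrable_of_L2 _)]
        exact ENNReal.ofReal_le_one.mpr ha
    _ = _ := mul_one _

theorem integral_norm_le_norm (f : ScalarL2 d) : ∫ x, ‖f x‖ ≤ ‖f‖ := by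
  have h := eLpNorm_le_eLpNorm_of_exponent_le (μ := (volume : Measure (UnitAddTorus (Fin d))))
    (p := 1) (q := 2) one_le_two (Lp.aestronglyMeasurable f)
  rw [Lp.norm_def, integral_norm_eq_lintegral_enorm (Lp.aestronglyMeasurable f)]
  refine ENNReal.toReal_mono (Lp.eLpNorm_ne_top f) ?_
  rwa [eLpNorm_one_eq_lintegral_enorm] at h

theorem continuous_integral_norm : Continuous fun f : ScalarL2 d => ∫ x, ‖f x‖ := by
  refine LipschitzWith.continuous (K := 1) (LipschitzWith.of_le_add fun f g => ?_)
  have h1 : ∫ x, ‖f x‖ ≤ ∫ x, (‖g x‖ + ‖(f - g) x‖) := by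
    refine integral_mono_ae (integrable_of_L2 f).norm
      ((integrable_of_L2 g).norm.add (integrable_of_L2 (f - g)).norm) ?_
    filter_upwards [Lp.coeFn_sub f g] with x hx
    rw [hx, Pi.sub_apply]
    have := norm_add_le (g x) (f x - g x)
    rwa [add_sub_cancel] at this
  rw [integral_add (integrable_of_L2 g).norm (integrable_of_L2 (f - g)).norm] at h1
  rw [dist_eq_norm]
  linarith [integral_norm_le_norm (f - g)]

theorem norm_sum_le_dualNorm {b : (Fin d → ℤ) → ℂ} (hb : dualNorm b < ∞)
    (a : (Fin d → ℤ) →₀ ℂ) :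
    ‖a.sum fun k z => (starRingEnd ℂ) z * b k‖ ≤ (dualNorm b).toReal * ∫ x, ‖trigPoly a x‖ := by
  set r := ∫ x, ‖trigPoly a x‖ with hr
  have hr0 : 0 ≤ r := integral_nonneg fun _ => norm_nonneg _
  have key : ∀ δ > 0, ‖a.sum fun k z => (starRingEnd ℂ) z * b k‖ ≤
      (dualNorm b).toReal * (r + δ) := by
    intro δ hδ
    have hp : 0 < r + δ := by linarith
    set c : ℂ := (((r + δ)⁻¹ : ℝ) : ℂ) with hc
    have hcn : ‖c‖ = (r + δ)⁻¹ := by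
      rw [hc, Complex.norm_real, Real.norm_of_nonneg (inv_nonneg.mpr hp.le)]
    have h1 : ∫ x, ‖trigPoly (c • a) x‖ ≤ 1 := by
      have : ∫ x, ‖trigPoly (c • a) x‖ = ∫ x, (r + δ)⁻¹ * ‖trigPoly a x‖ := by
        refine integral_congr_ae ?_
        rw [trigPoly_smul]
        filter_upwards [Lp.coeFn_smul c (trigPoly a)] with x hx
        rw [hx, Pi.smul_apply, norm_smul, hcn]
      rw [this, integral_const_mul, inv_mul_le_iff₀ hp]
      linarith
    have h2 : ‖(c • a).sum fun k z => (starRingEnd ℂ) z * b k‖ₑ ≤ dualNorm b :=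
      le_iSup₂ (f := fun (a : (Fin d → ℤ) →₀ ℂ) (_ : ∫ x, ‖trigPoly a x‖ ≤ 1) =>
        ‖a.sum fun k z => (starRingEnd ℂ) z * b k‖ₑ) (c • a) h1
    have h3 : (c • a).sum (fun k z => (starRingEnd ℂ) z * b k) =
        (starRingEnd ℂ) c * a.sum fun k z => (starRingEnd ℂ) z * b k := by
      rw [Finsupp.sum_smul_index (by simp), Finsupp.mul_sum]
      simp only [map_mul, mul_assoc]
    have h4 := ENNReal.toReal_mono hb.ne h2
    rw [h3, toReal_enorm, norm_mul, RCLike.norm_conj, hcn, inv_mul_le_iff₀ hp] at h4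
    linarith
  refine le_of_forall_pos_le_add fun δ hδ => ?_
  have hD : 0 ≤ (dualNorm b).toReal := ENNReal.toReal_nonneg
  refine (key (δ / ((dualNorm b).toReal + 1)) (by positivity)).trans ?_
  rw [mul_add]
  refine add_le_add_right ?_ _
  rw [mul_div_assoc', div_le_iff₀ (by positivity)]
  nlinarith

theorem norm_trigPoly_sq (a : (Fin d → ℤ) →₀ ℂ) :
    ‖trigPoly a‖ ^ 2 = ∑ k ∈ a.support, ‖a k‖ ^ 2 := by
  have h := (orthonormal_expMode d).inner_sum a a a.support
  have h2 : (inner ℂ (trigPoly a) (trigPoly a) : ℂ) =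
      ∑ k ∈ a.support, (starRingEnd ℂ) (a k) * a k := h
  rw [inner_self_eq_norm_sq_to_K] at h2
  have h3 := congrArg Complex.re h2
  rw [Complex.re_sum] at h3
  simp only [Complex.conj_mul'] at h3
  norm_cast at h3

/-- A family with finite `dualNorm` is the family of Fourier coefficients of a bounded
function. -/
theorem exists_coeffLinf_eq {b : (Fin d → ℤ) → ℂ} (hb : dualNorm b < ∞) :
    ∃ h : ScalarLinf d, (∀ k, coeffLinf h k = b k) ∧ ‖h‖ ≤ 2 * (dualNorm b).toReal := by
  classical
  set c := (dualNorm b).toReal with hc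
  have hc0 : 0 ≤ c := ENNReal.toReal_nonneg
  -- `b` is square summable: test the functional with `∑ₖ bₖ e_k`
  have hsum : Summable fun k => ‖b k‖ ^ 2 := by
    refine summable_of_sum_le (c := c ^ 2) (fun k => sq_nonneg _) fun S => ?_
    set a : (Fin d → ℤ) →₀ ℂ := Finsupp.onFinset S (fun k => if k ∈ S then b k else 0)
      (fun k hk => by by_contra h; simp [h] at hk) with ha
    have hav : ∀ k ∈ S, a k = b k := fun k hk => by simp [ha, hk]
    have hsub : a.support ⊆ S := Finsupp.support_onFinset_subset
    have e1 : (a.sum fun k z => (starRingEnd ℂ) z * b k) = ((∑ k ∈ S, ‖b k‖ ^ 2 : ℝ) : ℂ) := by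
      rw [Finsupp.sum_of_support_subset a hsub _ (by simp)]
      push_cast
      refine Finset.sum_congr rfl fun k hk => ?_
      rw [hav k hk, Complex.conj_mul']
    have e2 : ‖trigPoly a‖ ^ 2 = ∑ k ∈ S, ‖b k‖ ^ 2 := by
      rw [norm_trigPoly_sq, Finset.sum_subset hsub fun k _ hk => by
        rw [Finsupp.notMem_support_iff.mp hk]; simp]
      exact Finset.sum_congr rfl fun k hk => by rw [hav k hk]
    have e3 := norm_sum_le_dualNorm hb a
    rw [e1, ← e2, Complex.norm_real, Real.norm_of_nonneg (sq_nonneg _)] at e3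
    rw [← e2]
    have e4 := integral_norm_le_norm (trigPoly a)
    have e5 : ‖trigPoly a‖ ≤ c := by
      by_contra hcon
      push Not at hcon
      nlinarith [norm_nonneg (trigPoly a)]
    gcongr
  obtain ⟨h, hh⟩ := exists_coeff_eq b hsum
  have hle : ∀ ψ : ScalarL2 d, ‖inner ℂ ψ h‖ ≤ c * ∫ x, ‖ψ x‖ := by
    have hcl : IsClosed {ψ : ScalarL2 d | ‖inner ℂ ψ h‖ ≤ c * ∫ x, ‖ψ x‖} :=
      isClosed_le (by fun_prop) (continuous_const.mul continuous_integral_norm)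
    have hd : Dense ((Submodule.span ℂ (range (expMode (d := d)))) : Set (ScalarL2 d)) :=
      Submodule.dense_iff_topologicalClosure_eq_top.mpr (span_expMode_closure d)
    intro ψ
    refine hcl.closure_subset_iff.mpr (fun φ hφ => ?_) (hd ψ)
    obtain ⟨a, rfl⟩ := (Finsupp.mem_span_range_iff_exists_finsupp).mp hφ
    have := norm_sum_le_dualNorm hb a
    change ‖inner ℂ (trigPoly a) h‖ ≤ c * ∫ x, ‖trigPoly a x‖
    refine (le_of_eq ?_).trans this
    congr 1
    unfold trigPoly Finsupp.sum
    rw [sum_inner]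
    refine Finset.sum_congr rfl fun k _ => ?_
    simp only [inner_smul_left, ← hh k, coeff]
  -- testing with indicator functions bounds the averages of `h`; the factor 2 in the result comes
  -- from bounding the real and the imaginary part separately
  have hset : ∀ S, MeasurableSet S → ‖∫ x in S, h x‖ ≤ c * volume.real S := by
    intro S hS
    have h1 := hle (indicatorConstLp 2 hS (measure_ne_top _ _) 1)
    rw [L2.inner_indicatorConstLp_one] at h1
    refine h1.trans_eq ?_
    congr 1
    have h2 : ∫ x, ‖(indicatorConstLp 2 hS (measure_ne_top volume S) (1 : ℂ) :
        ScalarL2 d) x‖ = ∫ x, S.indicator (fun _ => (1 : ℝ)) x := by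
      refine integral_congr_ae ?_
      filter_upwards [indicatorConstLp_coeFn (p := 2) (hs := hS) (hμs := measure_ne_top volume S)
        (c := (1 : ℂ))] with x hx
      rw [hx]
      by_cases hxS : x ∈ S <;> simp [hxS]
    rw [h2, integral_indicator hS]
    simp
  have hhi := integrable_of_L2 h
  have hpart : ∀ R : ℂ →L[ℝ] ℝ, (∀ z, |R z| ≤ ‖z‖) → ∀ᵐ x, R (h x) ≤ c := by
    intro R hR
    refine ae_le_of_forall_setIntegral_le (R.integrable_comp hhi) (integrable_const c)
      fun S hS _ => ?_
    rw [R.integral_comp_comm hhi.integrableOn, setIntegral_const, smul_eq_mul, mul_comm]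
    exact (le_abs_self _).trans ((hR _).trans (hset S hS))
  have hbound : ∀ᵐ x, ‖h x‖ ≤ 2 * c := by
    filter_upwards [hpart Complex.reCLM Complex.abs_re_le_norm,
      hpart (-Complex.reCLM) (fun z => by simpa using Complex.abs_re_le_norm z),
      hpart Complex.imCLM Complex.abs_im_le_norm,
      hpart (-Complex.imCLM) (fun z => by simpa using Complex.abs_im_le_norm z)] with x h1 h2 h3 h4
    simp only [Complex.reCLM_apply, Complex.imCLM_apply, neg_apply] at h1 h2 h3 h4
    refine (Complex.norm_le_abs_re_add_abs_im _).trans ?_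
    have := abs_le.mpr ⟨by linarith, h1⟩
    have := abs_le.mpr ⟨by linarith, h3⟩
    linarith
  have hmem : MemLp h ∞ volume := memLp_top_of_bound (Lp.aestronglyMeasurable h) _ hbound
  refine ⟨hmem.toLp, fun k => ?_, ?_⟩
  · rw [← hh k, coeff_eq_integral, coeffLinf]
    refine integral_congr_ae ?_
    filter_upwards [hmem.coeFn_toLp] with x hx
    rw [hx]
  · rw [Lp.norm_toLp]
    refine ENNReal.toReal_le_of_le_ofReal (by positivity) ?_
    exact eLpNormEssSup_le_of_ae_bound hbound

end

/-! ### Exponentials as test functions, and the velocity as a bounded flow -/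

section

variable {d : ℕ}

theorem mFourier_toTorus (m : Fin d → ℤ) (y : Fin d → ℝ) :
    UnitAddTorus.mFourier m (toTorus y) =
      Complex.exp (∑ j, Complex.I * ((freq m j * y j : ℝ) : ℂ)) := by
  rw [Complex.exp_sum]
  simp only [UnitAddTorus.mFourier, ContinuousMap.coe_mk, toTorus, fourier_coe_apply]
  refine Finset.prod_congr rfl fun j _ => ?_
  congr 1
  simp only [freq]
  push_cast
  ring

theorem contDiff_mFourier (m : Fin d → ℤ) :
    ContDiff ℝ ((⊤ : ℕ∞) : WithTop ℕ∞) fun y : Fin d → ℝ =>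
      UnitAddTorus.mFourier m (toTorus y) := by
  simp only [mFourier_toTorus]
  refine Complex.contDiff_exp.comp ?_ |>.of_le le_top
  refine ContDiff.sum fun j _ => contDiff_const.mul ?_
  exact Complex.ofRealCLM.contDiff.comp (contDiff_const.mul (contDiff_apply ℝ ℝ j))

theorem mFourier_add_single (m : Fin d → ℤ) (x : UnitAddTorus (Fin d)) (j : Fin d) (s : ℝ) :
    UnitAddTorus.mFourier m (x + Pi.single j (s : UnitAddCircle)) =
      UnitAddTorus.mFourier m x * Complex.exp (Complex.I * ((freq m j * s : ℝ) : ℂ)) := by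
  have h1 : UnitAddTorus.mFourier m (x + Pi.single j (s : UnitAddCircle)) =
      UnitAddTorus.mFourier m x * UnitAddTorus.mFourier m (Pi.single j (s : UnitAddCircle)) := by
    simp only [UnitAddTorus.mFourier, ContinuousMap.coe_mk, Pi.add_apply]
    rw [← Finset.prod_mul_distrib]
    refine Finset.prod_congr rfl fun i _ => ?_
    rw [fourier_apply, fourier_apply, fourier_apply, smul_add, AddCircle.toCircle_add,
      Circle.coe_mul]
  have h2 : (Pi.single j (s : UnitAddCircle) : UnitAddTorus (Fin d)) = toTorus (Pi.single j s) := by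
    ext i
    by_cases h : i = j
    · subst h; simp [toTorus]
    · simp [toTorus, h]
  rw [h1, h2, mFourier_toTorus]
  congr 2
  rw [Finset.sum_eq_single j]
  · simp
  · intro i _ hi; simp [hi]
  · simp

theorem hasDerivAt_mFourier (m : Fin d → ℤ) (x : UnitAddTorus (Fin d)) (j : Fin d) :
    HasDerivAt (fun s : ℝ => UnitAddTorus.mFourier m (x + Pi.single j (s : UnitAddCircle)))
      (Complex.I * freq m j * UnitAddTorus.mFourier m x) 0 := by
  rw [show (fun s : ℝ => UnitAddTorus.mFourier m (x + Pi.single j (s : UnitAddCircle))) = _ from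
    funext fun s => mFourier_add_single m x j s]
  have h1 : HasDerivAt (fun s : ℝ => Complex.I * ((freq m j * s : ℝ) : ℂ))
      (Complex.I * freq m j) 0 := by
    have := ((hasDerivAt_id (0 : ℝ)).const_mul (freq m j)).ofReal_comp.const_mul Complex.I
    simpa using this
  have h2 := (h1.cexp).const_mul (UnitAddTorus.mFourier m x)
  refine h2.congr_deriv ?_
  simp only [mul_zero, Complex.ofReal_zero, Complex.exp_zero]
  ring

theorem isSmooth_comp_mFourier (R : ℂ →L[ℝ] ℝ) (m : Fin d → ℤ) :
    IsSmooth fun x => R (UnitAddTorus.mFourier m x) :=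
  R.contDiff.comp (contDiff_mFourier m)

theorem partialDeriv_comp_mFourier (R : ℂ →L[ℝ] ℝ) (m : Fin d → ℤ) (j : Fin d)
    (x : UnitAddTorus (Fin d)) :
    partialDeriv j (fun x => R (UnitAddTorus.mFourier m x)) x =
      R (Complex.I * freq m j * UnitAddTorus.mFourier m x) :=
  (R.hasFDerivAt.comp_hasDerivAt (0 : ℝ) (hasDerivAt_mFourier m x j)).deriv

theorem integral_comp_mFourier_mul (R : ℂ →L[ℝ] ℝ) (m : Fin d → ℤ) (z : ℂ)
    {h : UnitAddTorus (Fin d) → ℝ} (hh : Integrable h) :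
    ∫ x, R (z * UnitAddTorus.mFourier m x) * h x =
      R (z * ∫ x, UnitAddTorus.mFourier m x * (h x : ℂ)) := by
  have hI : Integrable (fun x => (h x : ℂ)) := hh.ofReal
  have h1 := R.integral_comp_comm ((integrable_mFourier_mul hI m).const_mul z)
  rw [← integral_const_mul, ← h1]
  refine integral_congr_ae (Eventually.of_forall fun x => ?_)
  have : z * (UnitAddTorus.mFourier m x * (h x : ℂ)) = h x • (z * UnitAddTorus.mFourier m x) := by
    rw [Complex.real_smul]; ring
  simp only [this, map_smul, smul_eq_mul]
  ring

theorem eq_of_forall_clm {z w : ℂ} (h : ∀ R : ℂ →L[ℝ] ℝ, R z = R w) : z = w :=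
  Complex.ext (h Complex.reCLM) (h Complex.imCLM)

theorem freq_neg (k : Fin d → ℤ) (j : Fin d) : freq (-k) j = - freq k j := by
  simp [freq]

theorem HasWeakPartial.coeff_eq {j : Fin d} {f g : UnitAddTorus (Fin d) → Vec d}
    (h : HasWeakPartial j f g) (i : Fin d) (k : Fin d → ℤ) :
    ∫ x, UnitAddTorus.mFourier (-k) x * (g x i : ℂ) =
      Complex.I * freq k j * ∫ x, UnitAddTorus.mFourier (-k) x * (f x i : ℂ) := by
  set m := -k with hm
  have hfi : Integrable fun x => f x i :=
    (EuclideanSpace.proj i : Vec d →L[ℝ] ℝ).integrable_comp h.integrable_left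
  have hgi : Integrable fun x => g x i :=
    (EuclideanSpace.proj i : Vec d →L[ℝ] ℝ).integrable_comp h.integrable_right
  have hbdd : ∀ (φ : UnitAddTorus (Fin d) → ℝ), Continuous φ →
      ∀ F : UnitAddTorus (Fin d) → Vec d, Integrable F → Integrable fun x => φ x • F x := by
    intro φ hφ F hF
    obtain ⟨C, hC⟩ := isCompact_univ.exists_bound_of_continuousOn hφ.continuousOn
    exact hF.bdd_smul C hφ.aestronglyMeasurable (Eventually.of_forall fun x => hC x trivial)
  have key : ∀ ψ : UnitAddTorus (Fin d) → ℝ, IsSmooth ψ → Continuous ψ →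
      Continuous (partialDeriv j ψ) →
      ∫ x, partialDeriv j ψ x * f x i = - ∫ x, ψ x * g x i := by
    intro ψ hψ hc hc'
    have h1 := congrArg (EuclideanSpace.proj i : Vec d →L[ℝ] ℝ) (h.integral_eq ψ hψ)
    rw [map_neg, ← ContinuousLinearMap.integral_comp_comm _ (hbdd _ hc' _ h.integrable_left),
      ← ContinuousLinearMap.integral_comp_comm _ (hbdd _ hc _ h.integrable_right)] at h1
    simpa using h1
  have hcont := (UnitAddTorus.mFourier m).continuous
  have hR : ∀ R : ℂ →L[ℝ] ℝ,
      R (Complex.I * freq m j * ∫ x, UnitAddTorus.mFourier m x * (f x i : ℂ)) =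
        R (-∫ x, UnitAddTorus.mFourier m x * (g x i : ℂ)) := by
    intro R
    have h1 := key _ (isSmooth_comp_mFourier R m) (R.continuous.comp hcont) (by
      rw [funext (partialDeriv_comp_mFourier R m j)]; fun_prop)
    simp only [partialDeriv_comp_mFourier] at h1
    have h2 := integral_comp_mFourier_mul R m 1 hgi
    simp only [one_mul] at h2
    rw [integral_comp_mFourier_mul R m _ hfi, h2] at h1
    rw [h1, map_neg]
  have h3 := eq_of_forall_clm hR
  rw [hm, freq_neg] at h3
  rw [hm]
  push_cast at h3
  linear_combination h3

/-- A lower semicontinuous substitute for the norm of `W^{1,∞}`, bounded by `sobolevNorm ∞`.  It is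
a supremum of continuous functions of `f`, and is therefore measurable in time along a measurable
family of fields, which is not clear for `sobolevNorm ∞`. -/
noncomputable def lipNorm (f : L2Field d) : ℝ≥0∞ :=
  (⨆ i, dualNorm (coeff (component i f))) ⊔
    ⨆ i, ⨆ j, dualNorm fun k => Complex.I * freq k j * coeff (component i f) k

theorem lipNorm_le_sobolevNorm (f : L2Field d) : lipNorm f ≤ sobolevNorm ∞ f := by
  refine le_iInf₂ fun g hg => ?_
  have hcomp : ∀ (h : UnitAddTorus (Fin d) → Vec d) i, eLpNorm (fun x => (h x i : ℂ)) ∞ volume ≤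
      eLpNorm h ∞ volume := fun h i => by
    refine eLpNorm_mono fun x => ?_
    rw [Complex.norm_real]
    exact PiLp.norm_apply_le _ _
  have hint : ∀ (h : UnitAddTorus (Fin d) → Vec d) i, Integrable h →
      Integrable fun x => (h x i : ℂ) := fun h i hh =>
    ((EuclideanSpace.proj i : Vec d →L[ℝ] ℝ).integrable_comp hh).ofReal
  refine sup_le (iSup_le fun i => ?_) (iSup_le fun i => iSup_le fun j => ?_)
  · refine le_trans ?_ le_self_add
    have h1 : coeff (component i f) =
        fun k => ∫ x, UnitAddTorus.mFourier (-k) x * (f x i : ℂ) := funext (coeff_component i f)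
    rw [h1]
    refine (dualNorm_le_eLpNorm (hint f i ?_)).trans (hcomp _ i)
    exact (Lp.memLp f).integrable one_le_two
  · refine le_trans ?_ le_add_self
    refine le_trans ?_ (Finset.single_le_sum (f := fun j => eLpNorm (g j) ∞ volume)
      (fun _ _ => zero_le) (Finset.mem_univ j))
    have h1 : (fun k => Complex.I * freq k j * coeff (component i f) k) =
        fun k => ∫ x, UnitAddTorus.mFourier (-k) x * (g j x i : ℂ) := funext fun k => by
      rw [coeff_component, (hg j).coeff_eq]
    rw [h1]
    exact (dualNorm_le_eLpNorm (hint _ i (hg j).integrable_right)).trans (hcomp _ i)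

theorem lowerSemicontinuous_dualNorm {X : Type*} [TopologicalSpace X]
    {b : X → (Fin d → ℤ) → ℂ} (hb : ∀ k, Continuous fun x => b x k) :
    LowerSemicontinuous fun x => dualNorm (b x) := by
  refine lowerSemicontinuous_iSup fun a => lowerSemicontinuous_iSup fun _ => ?_
  refine Continuous.lowerSemicontinuous ?_
  refine continuous_enorm.comp ?_
  unfold Finsupp.sum
  exact continuous_finsetSum _ fun k _ => continuous_const.mul (hb k)

theorem continuous_coeff_component (i : Fin d) (k : Fin d → ℤ) :
    Continuous fun f : L2Field d => coeff (component i f) k :=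
  (continuous_coeff k).comp (component i).continuous

theorem lowerSemicontinuous_lipNorm : LowerSemicontinuous (lipNorm (d := d)) := by
  refine LowerSemicontinuous.sup (lowerSemicontinuous_iSup fun i => ?_)
    (lowerSemicontinuous_iSup fun i => lowerSemicontinuous_iSup fun j => ?_)
  · exact lowerSemicontinuous_dualNorm fun k => continuous_coeff_component i k
  · exact lowerSemicontinuous_dualNorm fun k =>
      continuous_const.mul (continuous_coeff_component i k)

theorem aemeasurable_lipNorm {T : ℝ} {u : ℝ → L2Field d}
    (hu : AEStronglyMeasurable u (volume.restrict (Ioo 0 T))) :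
    AEMeasurable (fun t => lipNorm (u t)) (volume.restrict (Ioo 0 T)) := by
  let _ : MeasurableSpace (L2Field d) := borel _
  have : BorelSpace (L2Field d) := ⟨rfl⟩
  exact lowerSemicontinuous_lipNorm.measurable.comp_aemeasurable hu.aemeasurable

theorem lintegral_lipNorm_le {T : ℝ} (u : ℝ → L2Field d) :
    ∫⁻ t in Ioo 0 T, lipNorm (u t) ≤ timeSobolevNorm T 1 ∞ u := by
  rw [timeSobolevNorm, eLpNorm_one_eq_lintegral_enorm]
  exact lintegral_mono fun t => lipNorm_le_sobolevNorm (u t)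

/-- The static content of `u ∈ W^{1,∞}` and `div u = 0`. -/
theorem exists_isLipField {f : L2Field d} (hf : lipNorm f < ∞)
    (hdiv : IsSolenoidal fun j => component j f) :
    ∃ (v : Fin d → ScalarLinf d) (g : Fin d → Fin d → ScalarLinf d), IsLipField v g ∧
      (∀ j, ‖v j‖ ≤ 2 * (lipNorm f).toReal) ∧ (∀ k j, ‖g k j‖ ≤ 2 * (lipNorm f).toReal) ∧
      ∀ j, v j =ᵐ[volume] component j f := by
  have h1 : ∀ i, dualNorm (coeff (component i f)) ≤ lipNorm f := fun i =>
    (le_iSup (fun i => dualNorm (coeff (component i f))) i).trans le_sup_left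
  have h2 : ∀ i j, dualNorm (fun k => Complex.I * freq k j * coeff (component i f) k) ≤
      lipNorm f := fun i j =>
    (le_iSup₂ (f := fun i j => dualNorm fun k => Complex.I * freq k j * coeff (component i f) k)
      i j).trans le_sup_right
  choose v hv hvn using fun i => exists_coeffLinf_eq ((h1 i).trans_lt hf)
  choose g hg hgn using fun i j => exists_coeffLinf_eq ((h2 i j).trans_lt hf)
  have hve : ∀ j, v j =ᵐ[volume] component j f := by
    intro j
    have hm : MemLp (v j) 2 volume := (Lp.memLp (v j)).mono_exponent le_top
    have : hm.toLp = component j f := by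
      refine ext_coeff fun k => ?_
      rw [← hv j k, coeff_eq_integral, coeffLinf]
      refine integral_congr_ae ?_
      filter_upwards [hm.coeFn_toLp] with x hx
      rw [hx]
    rw [← this]
    exact hm.coeFn_toLp.symm
  refine ⟨v, fun k j => g j k, ⟨fun j => ?_, fun k j l => ?_, fun l => ?_⟩, fun j => ?_,
    fun k j => ?_, hve⟩
  · filter_upwards [hve j, coeFn_component j f] with x hx hx'
    rw [hx, hx', Complex.conj_ofReal]
  · rw [hg, hv]
  · simp only [hv]; exact hdiv l
  · refine (hvn j).trans ?_
    have := ENNReal.toReal_mono hf.ne (h1 j)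
    linarith
  · refine (hgn j k).trans ?_
    have := ENNReal.toReal_mono hf.ne (h2 j k)
    linarith

end

/-! ### From distributional equations to Fourier coefficients -/

section

variable {d : ℕ} {T : ℝ}

/-- A time-dependent velocity in `L¹(0,T; W^{1,∞})` with gradient `g`, dominated by the integrable
function `L`. -/
structure IsVelocity (T : ℝ) (v : ℝ → Fin d → ScalarLinf d)
    (g : ℝ → Fin d → Fin d → ScalarLinf d) (L : ℝ → ℝ) : Prop where
  lip : IsLipFlow T v g L
  bound : ∀ᵐ s ∂volume.restrict (Ioo 0 T), ∀ j, ‖v s j‖ ≤ L s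
  meas : ∀ j k, AEStronglyMeasurable (fun s => coeffLinf (v s j) k) (volume.restrict (Ioo 0 T))
  nonneg : ∀ s, 0 ≤ L s
  integrable : IntegrableOn L (Ioo 0 T)

theorem coeffLinf_eq_inner (S : ScalarLinf d) (k : Fin d → ℤ) :
    coeffLinf S k = inner ℂ (expMode k) (mulOp S (expMode 0)) := by
  rw [inner_expMode_mulOp, sub_zero]

theorem coeffLinf_add (S S' : ScalarLinf d) (k : Fin d → ℤ) :
    coeffLinf (S + S') k = coeffLinf S k + coeffLinf S' k := by
  simp only [coeffLinf_eq_inner, mulOp_add, add_apply, inner_add_right]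

theorem IsLipField.add {v z : Fin d → ScalarLinf d} {g h : Fin d → Fin d → ScalarLinf d}
    (hv : IsLipField v g) (hz : IsLipField z h) :
    IsLipField (fun j => v j + z j) (fun k j => g k j + h k j) where
  real j := by
    filter_upwards [hv.real j, hz.real j, Lp.coeFn_add (v j) (z j)] with x h1 h2 h3
    rw [h3, Pi.add_apply, map_add, h1, h2]
  grad k j l := by simp only [coeffLinf_add, hv.grad, hz.grad, mul_add]
  div l := by
    simp only [coeffLinf_add, mul_add, Finset.sum_add_distrib, hv.div, hz.div, add_zero]

theorem IsVelocity.add {v z : ℝ → Fin d → ScalarLinf d} {g h : ℝ → Fin d → Fin d → ScalarLinf d}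
    {L R : ℝ → ℝ} (hv : IsVelocity T v g L) (hz : IsVelocity T z h R) :
    IsVelocity T (fun s j => v s j + z s j) (fun s k j => g s k j + h s k j)
      (fun s => L s + R s) where
  lip := by
    filter_upwards [hv.lip, hz.lip] with s h1 h2
    exact ⟨h1.1.add h2.1, fun k j => (norm_add_le _ _).trans (add_le_add (h1.2 k j) (h2.2 k j))⟩
  bound := by
    filter_upwards [hv.bound, hz.bound] with s h1 h2 j
    exact (norm_add_le _ _).trans (add_le_add (h1 j) (h2 j))
  meas j k := by
    simp only [coeffLinf_add]
    exact (hv.meas j k).add (hz.meas j k)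
  nonneg s := add_nonneg (hv.nonneg s) (hz.nonneg s)
  integrable := hv.integrable.add hz.integrable

theorem coeff_mulOp_expMode (S : ScalarLinf d) (k l : Fin d → ℤ) :
    coeff (mulOp S (expMode k)) l = coeffLinf S (l - k) := inner_expMode_mulOp S l k

theorem hasSum_coeff_mulOp {S : ScalarLinf d} (hS : ∀ᵐ x, (starRingEnd ℂ) (S x) = S x)
    (f : ScalarL2 d) (k : Fin d → ℤ) :
    HasSum (fun l => (starRingEnd ℂ) (coeffLinf S (l - k)) * coeff f l)
      (coeff (mulOp S f) k) := by
  rw [coeff, ← inner_mulOp_left hS]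
  simpa only [coeff_mulOp_expMode] using hasSum_conj_coeff_mul (mulOp S (expMode k)) f

theorem norm_flux_le {v : Fin d → ScalarLinf d} {A : Fin d → ScalarL2 d} {L K : ℝ}
    (hv : ∀ j, ‖v j‖ ≤ L) (hA : ∀ i, ‖A i‖ ≤ K) (i j : Fin d) : ‖flux v A i j‖ ≤ 2 * K * L := by
  have h : ∀ i j, ‖mulOp (v j) (A i)‖ ≤ L * K := fun i j =>
    (norm_mulOp_le _ _).trans (mul_le_mul (hv j) (hA i) (norm_nonneg _)
      ((norm_nonneg _).trans (hv j)))
  refine (norm_sub_le _ _).trans ?_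
  linarith [h i j, h j i]

theorem IsVelocity.isFlux {v : ℝ → Fin d → ScalarLinf d} {g : ℝ → Fin d → Fin d → ScalarLinf d}
    {L : ℝ → ℝ} (hv : IsVelocity T v g L) {W : ℝ → Fin d → ScalarL2 d} {K : ℝ}
    (hWm : ∀ i k, AEStronglyMeasurable (fun s => coeff (W s i) k) (volume.restrict (Ioo 0 T)))
    (hK : ∀ᵐ s ∂volume.restrict (Ioo 0 T), ∀ i, ‖W s i‖ ≤ K) :
    IsFlux T (fun s => flux (v s) (W s)) (fun s => 2 * K * L s) where
  meas i j k := by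
    have h : ∀ i j, AEStronglyMeasurable (fun s => coeff (mulOp (v s j) (W s i)) k)
        (volume.restrict (Ioo 0 T)) := fun i j => by
      refine aestronglyMeasurable_of_tendsto_ae (atTop : Filter (Finset (Fin d → ℤ)))
        (f := fun S s => ∑ l ∈ S, (starRingEnd ℂ) (coeffLinf (v s j) (l - k)) * coeff (W s i) l)
        (fun S => Finset.aestronglyMeasurable_fun_sum _ fun l _ => ?_) ?_
      · exact (Complex.continuous_conj.comp_aestronglyMeasurable (hv.meas j (l - k))).mul (hWm i l)
      · filter_upwards [hv.lip] with s hs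
        exact hasSum_coeff_mulOp (hs.1.real j) (W s i) k
    simp only [flux, coeff_sub]
    exact (h i j).sub (h j i)
  bound := by
    filter_upwards [hv.bound, hK] with s hs hKs i j
    exact norm_flux_le hs hKs i j
  integrable := hv.integrable.const_mul _

theorem flux_sub (v : Fin d → ScalarLinf d) (A B : Fin d → ScalarL2 d) (i j : Fin d) :
    flux v (fun i => A i - B i) i j = flux v A i j - flux v B i j := by
  simp only [flux, map_sub]; abel

theorem flux_add_velocity (v z : Fin d → ScalarLinf d) (A : Fin d → ScalarL2 d) (i j : Fin d) :
    flux (fun j => v j + z j) A i j = flux v A i j + flux z A i j := by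
  simp only [flux, mulOp_add, add_apply]; abel

theorem ae_eq_zero_of_timeTest {h : ℝ → ℝ} (hh : IntegrableOn h (Ioo 0 T))
    (h0 : ∀ η, IsTimeTest T η → ∫ t in Ioo 0 T, η t * h t = 0) :
    ∀ᵐ t ∂volume.restrict (Ioo 0 T), h t = 0 := by
  have := isOpen_Ioo.ae_eq_zero_of_integral_contDiff_smul_eq_zero hh.locallyIntegrableOn ?_
  · rwa [ae_restrict_iff' measurableSet_Ioo]
  intro η hs hc hsub
  have h1 := h0 η ⟨hs, exists_Icc_of_tsupport_subset hc hsub⟩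
  rw [← setIntegral_eq_integral_of_forall_compl_eq_zero (s := Ioo 0 T)]
  · exact h1
  · intro t ht
    rw [image_eq_zero_of_notMem_tsupport fun hh => ht (hsub hh), zero_smul]

/-- The product of a test function of time and the real part, or another real functional, of an
exponential. -/
theorem isTestFunction_mul {η : ℝ → ℝ} (hη : IsTimeTest T η) (R : ℂ →L[ℝ] ℝ) (m : Fin d → ℤ) :
    IsTestFunction T fun t x => η t * R (UnitAddTorus.mFourier m x) where
  smooth := (hη.smooth.comp contDiff_fst).mul
    ((isSmooth_comp_mFourier R m).comp contDiff_snd)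
  support := by
    obtain ⟨a, b, ha, hb, hab⟩ := hη.support
    exact ⟨a, b, ha, hb, fun t ht x => by rw [hab t ht, zero_mul]⟩

theorem partialDeriv_const_mul (c : ℝ) (R : ℂ →L[ℝ] ℝ) (m : Fin d → ℤ) (j : Fin d)
    (x : UnitAddTorus (Fin d)) :
    partialDeriv j (fun x => c * R (UnitAddTorus.mFourier m x)) x =
      c * R (Complex.I * freq m j * UnitAddTorus.mFourier m x) :=
  ((R.hasFDerivAt.comp_hasDerivAt (0 : ℝ) (hasDerivAt_mFourier m x j)).const_mul c).deriv

theorem memLp_apply (f : L2Field d) (i : Fin d) : MemLp (fun x => f x i) 2 volume :=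
  (EuclideanSpace.proj i : Vec d →L[ℝ] ℝ).comp_memLp' (Lp.memLp f)

theorem integrable_apply (f : L2Field d) (i : Fin d) : Integrable fun x => f x i :=
  (memLp_apply f i).integrable one_le_two

theorem integrable_apply_mul (f u : L2Field d) (i j : Fin d) :
    Integrable fun x => f x i * u x j :=
  (memLp_apply f i).integrable_mul (memLp_apply u j)

theorem integrable_mul_clm {h : UnitAddTorus (Fin d) → ℝ} (hh : Integrable h) (R : ℂ →L[ℝ] ℝ)
    (z : ℂ) (m : Fin d → ℤ) : Integrable fun x => R (z * UnitAddTorus.mFourier m x) * h x := by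
  have hI : Integrable (fun x => (h x : ℂ)) := hh.ofReal
  have h1 := R.integrable_comp ((integrable_mFourier_mul hI m).const_mul z)
  refine h1.congr (Eventually.of_forall fun x => ?_)
  have : z * (UnitAddTorus.mFourier m x * (h x : ℂ)) = h x • (z * UnitAddTorus.mFourier m x) := by
    rw [Complex.real_smul]; ring
  simp only [this, map_smul, smul_eq_mul]
  ring

theorem integrableOn_coeff_component {u : ℝ → L2Field d} {s : Set ℝ} (hu : IntegrableOn u s)
    (i : Fin d) (k : Fin d → ℤ) : IntegrableOn (fun t => coeff (component i (u t)) k) s := by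
  refine (((component i : L2Field d →L[ℝ] ScalarL2 d)).integrable_comp hu).mono
    ((continuous_coeff_component i k).comp_aestronglyMeasurable hu.aestronglyMeasurable)
    (Eventually.of_forall fun t => norm_coeff_le _ _)

/-- A distributionally divergence-free field is solenoidal at almost every time. -/
theorem IsDivFree.ae_isSolenoidal {u : ℝ → L2Field d} (hu : IsDivFree T u)
    (hi : IntegrableOn u (Ioo 0 T)) :
    ∀ᵐ t ∂volume.restrict (Ioo 0 T), IsSolenoidal fun j => component j (u t) := by
  refine ae_all_iff.mpr fun k => ?_
  set z : ℝ → ℂ := fun t => ∑ j, Complex.I * freq (-k) j * coeff (component j (u t)) k with hz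
  have hzi : IntegrableOn z (Ioo 0 T) := by
    refine integrable_finsetSum _ fun j _ => Integrable.const_mul ?_ _
    exact integrableOn_coeff_component hi j k
  have hR : ∀ R : ℂ →L[ℝ] ℝ, ∀ᵐ t ∂volume.restrict (Ioo 0 T), R (z t) = 0 := by
    intro R
    refine ae_eq_zero_of_timeTest (ContinuousLinearMap.integrable_comp R hzi) fun η hη => ?_
    have h1 := hu _ (isTestFunction_mul hη R (-k))
    refine Eq.trans ?_ h1
    refine integral_congr_ae (Eventually.of_forall fun t => ?_)
    simp only [partialDeriv_const_mul]
    have hint : ∀ j, Integrable fun x => u t x j * (η t * R (Complex.I * freq (-k) j *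
        UnitAddTorus.mFourier (-k) x)) := fun j =>
      ((integrable_mul_clm (integrable_apply (u t) j) R (Complex.I * freq (-k) j) (-k)).const_mul
        (η t)).congr (Eventually.of_forall fun x => by ring)
    rw [integral_finsetSum _ fun j _ => hint j]
    simp only [hz, map_sum, Finset.mul_sum]
    refine Finset.sum_congr rfl fun j _ => ?_
    rw [coeff_component, ← integral_comp_mFourier_mul R (-k) _ (integrable_apply (u t) j),
      ← integral_const_mul]
    exact integral_congr_ae (Eventually.of_forall fun x => by ring)
  filter_upwards [hR Complex.reCLM, hR Complex.imCLM] with t h1 h2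
  have h3 : z t = 0 := Complex.ext h1 h2
  have h4 : z t = -Complex.I * ∑ j, (freq k j : ℂ) * coeff (component j (u t)) k := by
    simp only [hz, Finset.mul_sum, freq_neg]
    refine Finset.sum_congr rfl fun j _ => ?_
    push_cast; ring
  rw [h4] at h3
  simpa using h3

/-- The spatial integral in the equation, for a test function which is a multiple of an
exponential. -/
theorem integral_equation_mode (f u : L2Field d) {v : Fin d → ScalarLinf d}
    (hv : ∀ j, v j =ᵐ[volume] component j u) (i : Fin d) (k : Fin d → ℤ) (R : ℂ →L[ℝ] ℝ)
    (a b : ℝ) :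
    ∫ x, (f x i * (a * R (UnitAddTorus.mFourier (-k) x))
      + ∑ j, (f x i * u x j) * (b * R (Complex.I * freq (-k) j * UnitAddTorus.mFourier (-k) x))
      - ∑ j, (u x i * f x j) * (b * R (Complex.I * freq (-k) j * UnitAddTorus.mFourier (-k) x))) =
    R (coeff (component i f) k) * a
      + R (rate (flux v fun i => component i f) i k) * b := by
  have hmul : ∀ i j, coeff (mulOp (v j) (component i f)) k =
      ∫ x, UnitAddTorus.mFourier (-k) x * ((f x i * u x j : ℝ) : ℂ) := fun i j => by
    rw [coeff_eq_integral]
    refine integral_congr_ae ?_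
    filter_upwards [coeFn_mulOp (v j) (component i f), hv j, coeFn_component j u,
      coeFn_component i f] with x h1 h2 h3 h4
    rw [h1, h2, h3, h4]
    push_cast; ring
  have hint : ∀ i j l, Integrable fun x => (f x i * u x j) * (b * R (Complex.I * freq (-k) l *
      UnitAddTorus.mFourier (-k) x)) := fun i j l =>
    ((integrable_mul_clm (integrable_apply_mul f u i j) R (Complex.I * freq (-k) l) (-k)).const_mul
      b).congr (Eventually.of_forall fun x => by ring)
  have hval : ∀ i j l, ∫ x, (f x i * u x j) * (b * R (Complex.I * freq (-k) l *
      UnitAddTorus.mFourier (-k) x)) =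
      R (Complex.I * freq (-k) l * coeff (mulOp (v j) (component i f)) k) * b := fun i j l => by
    rw [hmul, ← integral_comp_mFourier_mul R (-k) _ (integrable_apply_mul f u i j),
      ← integral_mul_const]
    exact integral_congr_ae (Eventually.of_forall fun x => by ring)
  have hint0 : Integrable fun x => f x i * (a * R (UnitAddTorus.mFourier (-k) x)) := by
    have := integrable_mul_clm (integrable_apply f i) R 1 (-k)
    simp only [one_mul] at this
    exact (this.const_mul a).congr (Eventually.of_forall fun x => by ring)
  have hval0 : ∫ x, f x i * (a * R (UnitAddTorus.mFourier (-k) x)) =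
      R (coeff (component i f) k) * a := by
    have := integral_comp_mFourier_mul R (-k) 1 (integrable_apply f i)
    simp only [one_mul] at this
    rw [coeff_component, ← this, ← integral_mul_const]
    exact integral_congr_ae (Eventually.of_forall fun x => by ring)
  have hcomm : ∀ x, (∑ j, (u x i * f x j) * (b * R (Complex.I * freq (-k) j *
      UnitAddTorus.mFourier (-k) x))) = ∑ j, (f x j * u x i) * (b * R (Complex.I * freq (-k) j *
      UnitAddTorus.mFourier (-k) x)) := fun x =>
    Finset.sum_congr rfl fun j _ => by rw [mul_comm (u x i)]
  simp only [hcomm]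
  have hI : Integrable fun x => f x i * (a * R (UnitAddTorus.mFourier (-k) x))
      + ∑ j, (f x i * u x j) * (b * R (Complex.I * freq (-k) j * UnitAddTorus.mFourier (-k) x)) :=
    hint0.add (integrable_finsetSum _ fun j _ => hint i j j)
  rw [integral_sub hI (integrable_finsetSum _ fun j _ => hint j i j),
    integral_add hint0 (integrable_finsetSum _ fun j _ => hint i j j),
    integral_finsetSum _ fun j _ => hint i j j, integral_finsetSum _ fun j _ => hint j i j, hval0]
  simp only [hval]
  rw [add_sub_assoc, ← Finset.sum_sub_distrib, rate, map_sum, Finset.sum_mul]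
  congr 1
  refine Finset.sum_congr rfl fun j _ => ?_
  rw [← sub_mul, ← map_sub, ← mul_sub, ← coeff_sub]
  congr 3
  simp [freq_neg]

/-- A distributional solution satisfies, mode by mode, the equation integrated in time, up to the
value of its initial datum. -/
theorem IsSolution.exists_coeff_eq {A u : ℝ → L2Field d} (hs : IsSolution T A u) (hT : 0 < T)
    (hA : IntegrableOn A (Ioo 0 T)) {v : ℝ → Fin d → ScalarLinf d}
    (hv : ∀ᵐ t ∂volume.restrict (Ioo 0 T), ∀ j, v t j =ᵐ[volume] component j (u t))
    {γ : ℝ → ℝ} (hG : IsFlux T (fun t => flux (v t) fun i => component i (A t)) γ)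
    (i : Fin d) (k : Fin d → ℤ) :
    ∃ C : ℂ, ∀ᵐ t ∂volume.restrict (Ioo 0 T), coeff (component i (A t)) k =
      C + ∫ r in (0 : ℝ)..t, rate (flux (v r) fun i => component i (A r)) i k := by
  have hci : IntegrableOn (fun t => coeff (component i (A t)) k) (Ioo 0 T) :=
    integrableOn_coeff_component hA i k
  have hri := hG.integrable_rate i k
  have hR : ∀ R : ℂ →L[ℝ] ℝ, ∃ C : ℝ, ∀ᵐ t ∂volume.restrict (Ioo 0 T),
      R (coeff (component i (A t)) k) = C + ∫ r in (0 : ℝ)..t,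
        R (rate (flux (v r) fun i => component i (A r)) i k) := by
    intro R
    refine ae_eq_primitive hT (ContinuousLinearMap.integrable_comp R hci)
      (ContinuousLinearMap.integrable_comp R hri) fun η hη => ?_
    refine Eq.trans ?_ (hs.equation i _ (isTestFunction_mul hη R (-k)))
    refine integral_congr_ae ?_
    filter_upwards [hv] with t ht
    rw [← integral_equation_mode (A t) (u t) ht i k R]
    have hd : ∀ x, deriv (fun s => η s * R (UnitAddTorus.mFourier (-k) x)) t =
        deriv η t * R (UnitAddTorus.mFourier (-k) x) := fun x =>
      deriv_mul_const ((hη.smooth.differentiable (by simp)) t) _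
    simp only [hd, partialDeriv_const_mul]
  obtain ⟨C₁, h₁⟩ := hR Complex.reCLM
  obtain ⟨C₂, h₂⟩ := hR Complex.imCLM
  refine ⟨⟨C₁, C₂⟩, ?_⟩
  have h0 : (0 : ℝ) ∈ Icc 0 T := ⟨le_rfl, hT.le⟩
  filter_upwards [h₁, h₂, ae_restrict_mem measurableSet_Ioo] with t e₁ e₂ htT
  have hii := intervalIntegrable_of_Ioo hri h0 (Ioo_subset_Icc_self htT)
  refine Complex.ext ?_ ?_
  · rw [Complex.add_re, intervalIntegral_re hii]; exact e₁
  · rw [Complex.add_im, intervalIntegral_im hii]; exact e₂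

theorem norm_le_sobolevNorm (f : L2Field d) : ‖f‖ₑ ≤ sobolevNorm ∞ f := by
  refine le_iInf₂ fun g _ => ?_
  rw [Lp.enorm_def]
  exact (eLpNorm_le_eLpNorm_of_exponent_le le_top (Lp.aestronglyMeasurable f)).trans le_self_add

theorem MemTimeSobolev.integrableOn {u : ℝ → L2Field d} (hu : MemTimeSobolev T 1 ∞ u) :
    IntegrableOn u (Ioo 0 T) := by
  refine ⟨hu.1, lt_of_le_of_lt (lintegral_mono fun t => norm_le_sobolevNorm (u t)) ?_⟩
  have := hu.2
  rwa [timeSobolevNorm, eLpNorm_one_eq_lintegral_enorm] at this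

theorem MemTimeSobolev.exists_isVelocity {u : ℝ → L2Field d} (hu : MemTimeSobolev T 1 ∞ u)
    (hdiv : ∀ᵐ t ∂volume.restrict (Ioo 0 T), IsSolenoidal fun j => component j (u t)) :
    ∃ (v : ℝ → Fin d → ScalarLinf d) (g : ℝ → Fin d → Fin d → ScalarLinf d) (L : ℝ → ℝ),
      IsVelocity T v g L ∧
      (∀ᵐ t ∂volume.restrict (Ioo 0 T), ∀ j, v t j =ᵐ[volume] component j (u t)) ∧
      ∫ t in Ioo 0 T, L t ≤ 2 * (timeSobolevNorm T 1 ∞ u).toReal := by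
  have hm := aemeasurable_lipNorm hu.1
  have hlt : ∫⁻ t in Ioo 0 T, lipNorm (u t) < ∞ := (lintegral_lipNorm_le u).trans_lt hu.2
  have hfin : ∀ᵐ t ∂volume.restrict (Ioo 0 T), lipNorm (u t) < ∞ :=
    ae_lt_top' hm hlt.ne
  have hex : ∀ t, ∃ (v : Fin d → ScalarLinf d) (g : Fin d → Fin d → ScalarLinf d),
      lipNorm (u t) < ∞ → (IsSolenoidal fun j => component j (u t)) → IsLipField v g ∧
      (∀ j, ‖v j‖ ≤ 2 * (lipNorm (u t)).toReal) ∧ (∀ k j, ‖g k j‖ ≤ 2 * (lipNorm (u t)).toReal) ∧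
      ∀ j, v j =ᵐ[volume] component j (u t) := by
    intro t
    by_cases h : lipNorm (u t) < ∞ ∧ IsSolenoidal fun j => component j (u t)
    · obtain ⟨v, g, hvg⟩ := exists_isLipField h.1 h.2
      exact ⟨v, g, fun _ _ => hvg⟩
    · exact ⟨0, 0, fun h1 h2 => (h ⟨h1, h2⟩).elim⟩
  choose v g hvg using hex
  have hLi : IntegrableOn (fun t => (lipNorm (u t)).toReal) (Ioo 0 T) :=
    integrable_toReal_of_lintegral_ne_top hm hlt.ne
  have hcoef : ∀ᵐ t ∂volume.restrict (Ioo 0 T), ∀ j, v t j =ᵐ[volume] component j (u t) := by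
    filter_upwards [hfin, hdiv] with t h1 h2
    exact (hvg t h1 h2).2.2.2
  refine ⟨v, g, fun t => 2 * (lipNorm (u t)).toReal, ⟨?_, ?_, fun j k => ?_, fun s => by positivity,
    hLi.const_mul 2⟩, hcoef, ?_⟩
  · filter_upwards [hfin, hdiv] with t h1 h2
    exact ⟨(hvg t h1 h2).1, (hvg t h1 h2).2.2.1⟩
  · filter_upwards [hfin, hdiv] with t h1 h2
    exact (hvg t h1 h2).2.1
  · have h1 : AEStronglyMeasurable (fun t => coeff (component j (u t)) k)
        (volume.restrict (Ioo 0 T)) :=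
      (continuous_coeff_component j k).comp_aestronglyMeasurable hu.1
    refine h1.congr ?_
    filter_upwards [hcoef] with t ht
    rw [coeff_eq_integral, coeffLinf]
    refine integral_congr_ae ?_
    filter_upwards [ht j] with x hx
    rw [hx]
  · rw [integral_const_mul]
    refine mul_le_mul_of_nonneg_left ?_ two_pos.le
    rw [integral_toReal hm hfin]
    exact ENNReal.toReal_mono hu.2.ne (lintegral_lipNorm_le u)

end

/-! ### Stability in `H⁻¹` and the weak limit -/

section

variable {d : ℕ} {T : ℝ}

theorem rate_sub (G H : Fin d → Fin d → ScalarL2 d) (i : Fin d) (k : Fin d → ℤ) :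
    rate (fun i j => G i j - H i j) i k = rate G i k - rate H i k := by
  simp only [rate, coeff_sub, mul_sub, Finset.sum_sub_distrib]

theorem rate_add (G H : Fin d → Fin d → ScalarL2 d) (i : Fin d) (k : Fin d → ℤ) :
    rate (fun i j => G i j + H i j) i k = rate G i k + rate H i k := by
  simp only [rate, coeff_add, mul_add, Finset.sum_add_distrib]

theorem IsFlux.sub {G H : ℝ → Fin d → Fin d → ScalarL2 d} {γ η : ℝ → ℝ} (hG : IsFlux T G γ)
    (hH : IsFlux T H η) : IsFlux T (fun s i j => G s i j - H s i j) (fun s => γ s + η s) where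
  meas i j k := by
    simp only [coeff_sub]
    exact (hG.meas i j k).sub (hH.meas i j k)
  bound := by
    filter_upwards [hG.bound, hH.bound] with s h1 h2 i j
    exact (norm_sub_le _ _).trans (add_le_add (h1 i j) (h2 i j))
  integrable := hG.integrable.add hH.integrable

theorem EvolvesTo.sub {G H : ℝ → Fin d → Fin d → ScalarL2 d} {γ η : ℝ → ℝ} (hG : IsFlux T G γ)
    (hH : IsFlux T H η) {A₀ B₀ a b : Fin d → ScalarL2 d} {t : ℝ} (ht : t ∈ Icc 0 T)
    (ha : EvolvesTo G A₀ a t) (hb : EvolvesTo H B₀ b t) :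
    EvolvesTo (fun s i j => G s i j - H s i j) (fun i => A₀ i - B₀ i) (fun i => a i - b i) t := by
  intro i k
  have h0 : (0 : ℝ) ∈ Icc 0 T := ⟨le_rfl, ht.1.trans ht.2⟩
  simp only [rate_sub, coeff_sub]
  rw [intervalIntegral.integral_sub (intervalIntegrable_of_Ioo (hG.integrable_rate i k) h0 ht)
    (intervalIntegrable_of_Ioo (hH.integrable_rate i k) h0 ht), ha i k, hb i k]
  ring

theorem IsSolenoidal.sub {A B : Fin d → ScalarL2 d} (hA : IsSolenoidal A) (hB : IsSolenoidal B) :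
    IsSolenoidal fun i => A i - B i := fun k => by
  simp only [coeff_sub, mul_sub, Finset.sum_sub_distrib, hA k, hB k, sub_zero]

/-- A bounded sequence whose Fourier coefficients converge is weakly convergent. -/
theorem tendsto_clm_of_tendsto_coeff {f : ℕ → ScalarL2 d} {f₀ : ScalarL2 d} {K : ℝ}
    (hK : ∀ n, ‖f n‖ ≤ K) (h : ∀ k, Tendsto (fun n => coeff (f n) k) atTop (𝓝 (coeff f₀ k)))
    (ℓ : ScalarL2 d →L[ℂ] ℂ) : Tendsto (fun n => ℓ (f n)) atTop (𝓝 (ℓ f₀)) := by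
  set x := (InnerProductSpace.toDual ℂ (ScalarL2 d)).symm ℓ with hx
  have hℓ : ∀ y, ℓ y = inner ℂ x y := fun y => by
    rw [hx, InnerProductSpace.toDual_symm_apply]
  simp only [hℓ]
  have hx := hasSum_coeff_smul x
  have hK0 : 0 ≤ K := (norm_nonneg _).trans (hK 0)
  refine TendstoUniformly.tendsto_of_eventually_tendsto
    (F := fun (S : Finset (Fin d → ℤ)) n => inner ℂ (∑ k ∈ S, coeff x k • (expMode k)) (f n))
    (p := (atTop : Filter (Finset (Fin d → ℤ))))
    (L := fun S => inner ℂ (∑ k ∈ S, coeff x k • (expMode k)) f₀) ?_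
    (Eventually.of_forall fun S => ?_) ?_
  · rw [Metric.tendstoUniformly_iff]
    intro ε hε
    have h1 : Tendsto (fun S : Finset (Fin d → ℤ) => ∑ k ∈ S, coeff x k • (expMode k : ScalarL2 d))
      atTop (𝓝 x) := hx
    filter_upwards [Metric.tendsto_nhds.mp h1 (ε / (K + 1)) (by positivity)] with S h2 n
    rw [dist_eq_norm, norm_sub_rev] at h2
    rw [dist_eq_norm, ← inner_sub_left]
    calc _ ≤ ‖x - ∑ k ∈ S, coeff x k • (expMode k : ScalarL2 d)‖ * ‖f n‖ := norm_inner_le_norm _ _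
      _ ≤ ε / (K + 1) * K := mul_le_mul h2.le (hK n) (norm_nonneg _) (by positivity)
      _ < ε := by
        rw [div_mul_eq_mul_div, div_lt_iff₀ (by positivity)]
        nlinarith
  · simp only [sum_inner, inner_smul_left]
    exact tendsto_finsetSum _ fun k _ => (h k).const_mul _
  · have h1 : Tendsto (fun S : Finset (Fin d → ℤ) => ∑ k ∈ S, coeff x k • (expMode k : ScalarL2 d))
      atTop (𝓝 x) := hx
    exact h1.inner tendsto_const_nhds

/-- Solutions `W n` with velocities `v + z n`, where `z n → 0` in `L¹(0,T; W^{1,∞})`, which are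
bounded in `L²` and whose initial data converge to `w₀`. -/
structure IsApproximation (T K : ℝ) (v : ℝ → Fin d → ScalarLinf d)
    (g : ℝ → Fin d → Fin d → ScalarLinf d) (L : ℝ → ℝ) (z : ℕ → ℝ → Fin d → ScalarLinf d)
    (h : ℕ → ℝ → Fin d → Fin d → ScalarLinf d) (R : ℕ → ℝ → ℝ)
    (W : ℕ → ℝ → Fin d → ScalarL2 d) (w₀ : Fin d → ScalarL2 d) : Prop where
  velocity : IsVelocity T v g L
  perturbation : ∀ n, IsVelocity T (z n) (h n) (R n)
  tendsto_integral : Tendsto (fun n => ∫ s in Ioo 0 T, R n s) atTop (𝓝 0)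
  nonneg : 0 ≤ K
  bound : ∀ n, ∀ t ∈ Icc 0 T, ∀ i, ‖W n t i‖ ≤ K
  continuousOn : ∀ n i, ContinuousOn (fun t => W n t i) (Icc 0 T)
  solenoidal : ∀ n, ∀ᵐ s ∂volume.restrict (Ioo 0 T), IsSolenoidal (W n s)
  evolves : ∀ n, ∀ t ∈ Icc 0 T,
    EvolvesTo (fun s => flux (fun j => v s j + z n s j) (W n s)) (W n 0) (W n t) t
  tendsto_initial : ∀ i, Tendsto (fun n => W n 0 i) atTop (𝓝 (w₀ i))

namespace IsApproximation

variable {K : ℝ} {v : ℝ → Fin d → ScalarLinf d} {g : ℝ → Fin d → Fin d → ScalarLinf d}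
  {L : ℝ → ℝ} {z : ℕ → ℝ → Fin d → ScalarLinf d} {h : ℕ → ℝ → Fin d → Fin d → ScalarLinf d}
  {R : ℕ → ℝ → ℝ} {W : ℕ → ℝ → Fin d → ScalarL2 d} {w₀ : Fin d → ScalarL2 d}
  (H : IsApproximation T K v g L z h R W w₀)

include H

theorem continuousOn_coeff (n : ℕ) (i : Fin d) (k : Fin d → ℤ) :
    ContinuousOn (fun t => coeff (W n t i) k) (Icc 0 T) :=
  (continuous_coeff k).comp_continuousOn (H.continuousOn n i)

theorem aestronglyMeasurable_coeff (n : ℕ) (i : Fin d) (k : Fin d → ℤ) :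
    AEStronglyMeasurable (fun t => coeff (W n t i) k) (volume.restrict (Ioo 0 T)) :=
  ((H.continuousOn_coeff n i k).mono Ioo_subset_Icc_self).aestronglyMeasurable measurableSet_Ioo

theorem ae_bound (n : ℕ) : ∀ᵐ s ∂volume.restrict (Ioo 0 T), ∀ i, ‖W n s i‖ ≤ K := by
  filter_upwards [ae_restrict_mem measurableSet_Ioo] with s hs
  exact H.bound n s (Ioo_subset_Icc_self hs)

theorem isFlux (n : ℕ) : IsFlux T (fun s => flux (fun j => v s j + z n s j) (W n s))
    (fun s => 2 * K * (L s + R n s)) :=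
  (H.velocity.add (H.perturbation n)).isFlux (H.aestronglyMeasurable_coeff n) (H.ae_bound n)

theorem isFlux_perturbation (n : ℕ) : IsFlux T (fun s => flux (z n s) (W n s))
    (fun s => 2 * K * R n s) :=
  (H.perturbation n).isFlux (H.aestronglyMeasurable_coeff n) (H.ae_bound n)

theorem isFlux_velocity (n : ℕ) : IsFlux T (fun s => flux (v s) (W n s))
    (fun s => 2 * K * L s) :=
  H.velocity.isFlux (H.aestronglyMeasurable_coeff n) (H.ae_bound n)

/-- The sequence is Cauchy in `C([0,T]; H⁻¹)`. -/
theorem energy_sub_le (hT : 0 < T) {ε : ℝ} (hε : 0 < ε) :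
    ∃ N, ∀ n ≥ N, ∀ m ≥ N, ∀ t ∈ Icc 0 T, energy 1 (fun i => W n t i - W m t i) ≤ ε := by
  have hK := H.nonneg
  obtain ⟨C, hC, hstab⟩ := exists_energy_stability d hT H.velocity.nonneg H.velocity.integrable
  have key : ∀ n m, ∀ t ∈ Icc 0 T, energy 1 (fun i => W n t i - W m t i) ≤
      C * (fieldSq (fun i => W n 0 i - W m 0 i) + 4 * d ^ 2 * (2 * K) *
        (2 * K * ((∫ s in Ioo 0 T, R n s) + ∫ s in Ioo 0 T, R m s))) := by
    intro n m t ht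
    set F : ℝ → Fin d → Fin d → ScalarL2 d := fun s i j =>
      flux (z n s) (W n s) i j - flux (z m s) (W m s) i j with hF
    have e : (fun s i j => flux (v s) (fun i => W n s i - W m s i) i j + F s i j) =
        fun s i j => flux (fun j => v s j + z n s j) (W n s) i j
          - flux (fun j => v s j + z m s j) (W m s) i j := by
      funext s i j
      simp only [hF, flux_sub, flux_add_velocity]
      abel
    have hev : ∀ t ∈ Icc 0 T, EvolvesTo
        (fun s i j => flux (v s) (fun i => W n s i - W m s i) i j + F s i j)
        (fun i => W n 0 i - W m 0 i) (fun i => W n t i - W m t i) t := fun t ht => by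
      rw [e]
      exact (H.evolves n t ht).sub (H.isFlux n) (H.isFlux m) ht (H.evolves m t ht)
    have hs := hstab v g (fun s i => W n s i - W m s i) (fun i => W n 0 i - W m 0 i) F
      (fun s => 2 * K * (R n s + R m s)) _ (2 * K) (by positivity) H.velocity.lip (by
        filter_upwards [H.solenoidal n, H.solenoidal m] with s h1 h2
        exact h1.sub h2) (by rw [e]; exact (H.isFlux n).sub (H.isFlux m))
      (fun s => mul_nonneg (by positivity)
        (add_nonneg ((H.perturbation n).nonneg s) ((H.perturbation m).nonneg s)))
      (((H.perturbation n).integrable.add (H.perturbation m).integrable).const_mul _) (by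
        filter_upwards [(H.isFlux_perturbation n).bound, (H.isFlux_perturbation m).bound]
          with s h1 h2 i j
        rw [mul_add]
        exact (norm_sub_le _ _).trans (add_le_add (h1 i j) (h2 i j))) (by
        filter_upwards [H.ae_bound n, H.ae_bound m] with s h1 h2 i
        exact (norm_sub_le _ _).trans (by linarith [h1 i, h2 i])) (by
        filter_upwards [ae_restrict_mem measurableSet_Ioo] with s hs
        exact hev s (Ioo_subset_Icc_self hs)) t ht (hev t ht)
    refine hs.trans (mul_le_mul_of_nonneg_left (add_le_add (energy_le_fieldSq one_pos.le _) ?_) hC)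
    rw [integral_const_mul, integral_add (H.perturbation n).integrable
      (H.perturbation m).integrable]
  -- the right-hand side tends to zero as `n, m → ∞`
  have hl : Tendsto (fun p : ℕ × ℕ => C * (fieldSq (fun i => W p.1 0 i - W p.2 0 i)
      + 4 * d ^ 2 * (2 * K) * (2 * K * ((∫ s in Ioo 0 T, R p.1 s) + ∫ s in Ioo 0 T, R p.2 s))))
      (atTop ×ˢ atTop) (𝓝 (C * ((∑ i, ‖w₀ i - w₀ i‖ ^ 2)
        + 4 * d ^ 2 * (2 * K) * (2 * K * (0 + 0))))) := by
    refine Tendsto.const_mul _ (Tendsto.add ?_ (Tendsto.const_mul _ (Tendsto.const_mul _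
      (Tendsto.add ?_ ?_))))
    · exact tendsto_finsetSum _ fun i _ => ((((H.tendsto_initial i).comp tendsto_fst).sub
        ((H.tendsto_initial i).comp tendsto_snd)).norm).pow 2
    · exact H.tendsto_integral.comp tendsto_fst
    · exact H.tendsto_integral.comp tendsto_snd
  have hl0 : C * ((∑ i, ‖w₀ i - w₀ i‖ ^ 2) + 4 * d ^ 2 * (2 * K) * (2 * K * (0 + 0))) = 0 := by
    simp
  rw [hl0, prod_atTop_atTop_eq] at hl
  obtain ⟨⟨N₁, N₂⟩, hN⟩ := eventually_atTop.mp (hl.eventually (ge_mem_nhds hε))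
  refine ⟨max N₁ N₂, fun n hn m hm t ht => (key n m t ht).trans (hN (n, m) ⟨?_, ?_⟩)⟩
  · exact (le_max_left _ _).trans hn
  · exact (le_max_right _ _).trans hm

theorem uniformCauchySeqOn_coeff (hT : 0 < T) (i : Fin d) (k : Fin d → ℤ) :
    UniformCauchySeqOn (fun n t => coeff (W n t i) k) atTop (Icc 0 T) := by
  rw [Metric.uniformCauchySeqOn_iff]
  intro ε hε
  have hr := resSymbol_pos one_pos.le k
  obtain ⟨N, hN⟩ := H.energy_sub_le hT (ε := resSymbol 1 k * (ε / 2) ^ 2) (by positivity)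
  refine ⟨N, fun m hm n hn t ht => ?_⟩
  have h1 := (resSymbol_mul_sq_coeff_le one_pos.le (fun i => W m t i - W n t i) i k).trans
    (hN m hm n hn t ht)
  have h2 := le_of_mul_le_mul_left h1 hr
  rw [dist_eq_norm, ← coeff_sub]
  have h3 := (pow_le_pow_iff_left₀ (norm_nonneg _) (by positivity) two_ne_zero).mp h2
  linarith

/-- The weak limit, uniform in time. -/
theorem exists_weak_limit (hT : 0 < T) : ∃ w : ℝ → Fin d → ScalarL2 d,
    (∀ i k, TendstoUniformlyOn (fun n t => coeff (W n t i) k) (fun t => coeff (w t i) k) atTop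
      (Icc 0 T)) ∧ ∀ t ∈ Icc 0 T, ∀ i, ‖w t i‖ ≤ K := by
  have hex : ∀ t i, ∃ f : ScalarL2 d, t ∈ Icc 0 T →
      (∀ k, Tendsto (fun n => coeff (W n t i) k) atTop (𝓝 (coeff f k))) ∧ ‖f‖ ≤ K := by
    intro t i
    by_cases ht : t ∈ Icc 0 T
    · have h1 : ∀ k, ∃ b, Tendsto (fun n => coeff (W n t i) k) atTop (𝓝 b) := fun k =>
        cauchySeq_tendsto_of_complete ((H.uniformCauchySeqOn_coeff hT i k).cauchySeq ht)
      choose b hb using h1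
      have h2 : ∀ S : Finset (Fin d → ℤ), ∑ k ∈ S, ‖b k‖ ^ 2 ≤ K ^ 2 := fun S => by
        refine le_of_tendsto (tendsto_finsetSum S fun k _ => (hb k).norm.pow 2)
          (Eventually.of_forall fun n => ?_)
        refine (sum_le_hasSum S (fun k _ => sq_nonneg _) (hasSum_sq_coeff (W n t i))).trans ?_
        exact pow_le_pow_left₀ (norm_nonneg _) (H.bound n t ht i) 2
      obtain ⟨f, hf⟩ := exists_coeff_eq b (summable_of_sum_le (fun k => sq_nonneg _) h2)
      refine ⟨f, fun _ => ⟨fun k => by rw [hf]; exact hb k, ?_⟩⟩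
      have h3 : ‖f‖ ^ 2 ≤ K ^ 2 := by
        have := hasSum_sq_coeff f
        simp only [hf] at this
        exact hasSum_le_of_sum_le this h2
      exact (pow_le_pow_iff_left₀ (norm_nonneg _) H.nonneg two_ne_zero).mp h3
    · exact ⟨0, fun h => (ht h).elim⟩
  choose w hw using hex
  exact ⟨w, fun i k => (H.uniformCauchySeqOn_coeff hT i k).tendstoUniformlyOn_of_tendsto
    fun t ht => (hw t i ht).1 k, fun t ht i => (hw t i ht).2⟩

variable {w : ℝ → Fin d → ScalarL2 d}
  (hw : ∀ i k, TendstoUniformlyOn (fun n t => coeff (W n t i) k) (fun t => coeff (w t i) k) atTop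
      (Icc 0 T)) (hwK : ∀ t ∈ Icc 0 T, ∀ i, ‖w t i‖ ≤ K)

include hw

theorem tendsto_clm {t : ℝ} (ht : t ∈ Icc 0 T) (i : Fin d) (ℓ : ScalarL2 d →L[ℂ] ℂ) :
    Tendsto (fun n => ℓ (W n t i)) atTop (𝓝 (ℓ (w t i))) :=
  tendsto_clm_of_tendsto_coeff (fun n => H.bound n t ht i) (fun k => (hw i k).tendsto_at ht) ℓ

theorem continuousOn_coeff_limit (i : Fin d) (k : Fin d → ℤ) :
    ContinuousOn (fun t => coeff (w t i) k) (Icc 0 T) :=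
  (hw i k).continuousOn (Eventually.of_forall fun n => H.continuousOn_coeff n i k).frequently

theorem aestronglyMeasurable_coeff_limit (i : Fin d) (k : Fin d → ℤ) :
    AEStronglyMeasurable (fun t => coeff (w t i) k) (volume.restrict (Ioo 0 T)) :=
  ((H.continuousOn_coeff_limit hw i k).mono Ioo_subset_Icc_self).aestronglyMeasurable
    measurableSet_Ioo

theorem ae_isSolenoidal_limit : ∀ᵐ s ∂volume.restrict (Ioo 0 T), IsSolenoidal (w s) := by
  filter_upwards [ae_all_iff.mpr H.solenoidal, ae_restrict_mem measurableSet_Ioo] with s hs hsT k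
  have h1 : Tendsto (fun n => ∑ j, (freq k j : ℂ) * coeff (W n s j) k) atTop
      (𝓝 (∑ j, (freq k j : ℂ) * coeff (w s j) k)) :=
    tendsto_finsetSum _ fun j _ => ((hw j k).tendsto_at (Ioo_subset_Icc_self hsT)).const_mul _
  refine tendsto_nhds_unique h1 ?_
  simp only [hs _ k]
  exact tendsto_const_nhds

theorem ae_tendsto_rate (i : Fin d) (k : Fin d → ℤ) :
    ∀ᵐ s ∂volume.restrict (Ioo 0 T), Tendsto (fun n => rate (flux (v s) (W n s)) i k) atTop
      (𝓝 (rate (flux (v s) (w s)) i k)) := by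
  filter_upwards [ae_restrict_mem measurableSet_Ioo] with s hs
  have hs' := Ioo_subset_Icc_self hs
  have h1 : ∀ i j, Tendsto (fun n => coeff (mulOp (v s j) (W n s i)) k) atTop
      (𝓝 (coeff (mulOp (v s j) (w s i)) k)) := fun i j =>
    H.tendsto_clm hw hs' i ((innerSL ℂ (expMode k : ScalarL2 d)).comp (mulOp (v s j)))
  unfold rate
  refine tendsto_finsetSum _ fun j _ => Tendsto.const_mul _ ?_
  simp only [flux, coeff_sub]
  exact (h1 i j).sub (h1 j i)

include hwK

omit H hw in
theorem ae_bound_limit : ∀ᵐ s ∂volume.restrict (Ioo 0 T), ∀ i, ‖w s i‖ ≤ K := by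
  filter_upwards [ae_restrict_mem measurableSet_Ioo] with s hs
  exact hwK s (Ioo_subset_Icc_self hs)

theorem isFlux_limit : IsFlux T (fun s => flux (v s) (w s)) (fun s => 2 * K * L s) :=
  H.velocity.isFlux (H.aestronglyMeasurable_coeff_limit hw) (ae_bound_limit hwK)

omit hwK in
/-- The weak limit solves the limit problem. -/
theorem evolvesTo_limit (hT : 0 < T) {t : ℝ} (ht : t ∈ Icc 0 T) :
    EvolvesTo (fun s => flux (v s) (w s)) w₀ (w t) t := by
  intro i k
  have h0 : (0 : ℝ) ∈ Icc 0 T := ⟨le_rfl, hT.le⟩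
  have hsplit : ∀ n, coeff (W n t i) k = coeff (W n 0 i) k
      + (∫ s in (0 : ℝ)..t, rate (flux (v s) (W n s)) i k)
      + ∫ s in (0 : ℝ)..t, rate (flux (z n s) (W n s)) i k := fun n => by
    rw [H.evolves n t ht i k, add_assoc, ← intervalIntegral.integral_add
      (intervalIntegrable_of_Ioo ((H.isFlux_velocity n).integrable_rate i k) h0 ht)
      (intervalIntegrable_of_Ioo ((H.isFlux_perturbation n).integrable_rate i k) h0 ht)]
    congr 2
    funext s
    rw [← rate_add]
    congr 1
    funext i j
    exact flux_add_velocity _ _ _ i j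
  have h1 : Tendsto (fun n => ∫ s in (0 : ℝ)..t, rate (flux (v s) (W n s)) i k) atTop
      (𝓝 (∫ s in (0 : ℝ)..t, rate (flux (v s) (w s)) i k)) := by
    refine intervalIntegral.tendsto_integral_filter_of_dominated_convergence
      (fun s => (∑ j, |freq k j|) * (2 * K * L s)) (Eventually.of_forall fun n => ?_)
      (Eventually.of_forall fun n => ?_) ?_ (ae_uIoc_of_Ioo ht (H.ae_tendsto_rate hw i k))
    · rw [uIoc_of_le ht.1]
      exact ((H.isFlux_velocity n).aestronglyMeasurable_rate i k).mono_measure (restrict_Ioc_le ht)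
    · refine ae_uIoc_of_Ioo ht ?_
      filter_upwards [(H.isFlux_velocity n).bound] with s hs
      exact norm_rate_le hs i k
    · exact intervalIntegrable_of_Ioo
        ((H.velocity.integrable.const_mul (2 * K)).const_mul _) h0 ht
  have h2 : Tendsto (fun n => ∫ s in (0 : ℝ)..t, rate (flux (z n s) (W n s)) i k) atTop (𝓝 0) := by
    have hb : ∀ n, ‖∫ s in (0 : ℝ)..t, rate (flux (z n s) (W n s)) i k‖ ≤
        (∑ j, |freq k j|) * (2 * K * ∫ s in Ioo 0 T, R n s) := fun n => by
      have hI : IntegrableOn (fun s => (∑ j, |freq k j|) * (2 * K * R n s)) (Ioo 0 T) :=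
        ((H.perturbation n).integrable.const_mul (2 * K)).const_mul _
      rw [intervalIntegral.integral_of_le ht.1, ← integral_const_mul, ← integral_const_mul]
      have hle := restrict_Ioc_le ht
      refine (norm_integral_le_of_norm_le (Integrable.mono_measure hI hle)
        (ae_mono hle ?_)).trans ?_
      · filter_upwards [(H.isFlux_perturbation n).bound] with s hs
        exact norm_rate_le hs i k
      · refine integral_mono_measure hle (Eventually.of_forall fun s => ?_) hI
        have := (H.perturbation n).nonneg s
        have := H.nonneg
        have : 0 ≤ ∑ j, |freq k j| := Finset.sum_nonneg fun _ _ => abs_nonneg _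
        simp only [Pi.zero_apply]
        positivity
    refine squeeze_zero_norm hb ?_
    simpa using (H.tendsto_integral.const_mul (2 * K)).const_mul (∑ j, |freq k j|)
  have h3 : Tendsto (fun n => coeff (W n 0 i) k) atTop (𝓝 (coeff (w₀ i) k)) :=
    ((continuous_coeff k).tendsto _).comp (H.tendsto_initial i)
  have h4 := (h3.add h1).add h2
  simp only [← hsplit, add_zero] at h4
  exact tendsto_nhds_unique ((hw i k).tendsto_at ht) h4

theorem fieldSq_limit (hT : 0 < T) {t : ℝ} (ht : t ∈ Icc 0 T) :
    fieldSq (w t) = fieldSq w₀ + ∫ s in (0 : ℝ)..t, (gradForm (g s) (w s) (w s)).re :=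
  energy_identity hT H.velocity.lip H.velocity.integrable (H.ae_isSolenoidal_limit hw)
    (H.isFlux_limit hw hwK) (ae_bound_limit hwK) (by
      filter_upwards [ae_restrict_mem measurableSet_Ioo] with s hs
      exact H.evolvesTo_limit hw hT (Ioo_subset_Icc_self hs)) ht
    (H.evolvesTo_limit hw hT ht)

omit hw hwK in
theorem fieldSq_eq (hT : 0 < T) (n : ℕ) {t : ℝ} (ht : t ∈ Icc 0 T) :
    fieldSq (W n t) = fieldSq (W n 0) + ∫ s in (0 : ℝ)..t,
      (gradForm (fun k j => g s k j + h n s k j) (W n s) (W n s)).re :=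
  energy_identity hT (H.velocity.add (H.perturbation n)).lip
    (H.velocity.add (H.perturbation n)).integrable (H.solenoidal n) (H.isFlux n) (H.ae_bound n) (by
      filter_upwards [ae_restrict_mem measurableSet_Ioo] with s hs
      exact H.evolves n s (Ioo_subset_Icc_self hs)) ht (H.evolves n t ht)

end IsApproximation

end

/-! ### Strong convergence -/

section

variable {d : ℕ} {T : ℝ}

/-- The part of `‖f‖²` carried by the Fourier modes outside `S`. -/
noncomputable def tailSq (S : Finset (Fin d → ℤ)) (f : ScalarL2 d) : ℝ :=
  ‖f‖ ^ 2 - ∑ k ∈ S, ‖coeff f k‖ ^ 2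

theorem tailSq_nonneg (S : Finset (Fin d → ℤ)) (f : ScalarL2 d) : 0 ≤ tailSq S f :=
  sub_nonneg.mpr (sum_le_hasSum S (fun _ _ => sq_nonneg _) (hasSum_sq_coeff f))

theorem norm_sub_sum_sq (S : Finset (Fin d → ℤ)) (f : ScalarL2 d) :
    ‖f - ∑ k ∈ S, coeff f k • (expMode k)‖ ^ 2 = tailSq S f := by
  classical
  have h1 := (hasSum_sq_coeff f).sub (hasSum_sum_of_ne_finset_zero
    (f := fun k => if k ∈ S then ‖coeff f k‖ ^ 2 else 0) (s := S) fun k hk => if_neg hk)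
  refine (HasSum.unique ?_ (hasSum_sq_coeff _)).symm
  have h3 : (fun k => ‖coeff (f - ∑ k ∈ S, coeff f k • (expMode k)) k‖ ^ 2) =
      fun k => ‖coeff f k‖ ^ 2 - if k ∈ S then ‖coeff f k‖ ^ 2 else 0 := by
    funext k
    have h2 : coeff (f - ∑ k ∈ S, coeff f k • (expMode k)) k =
        coeff f k - if k ∈ S then coeff f k else 0 := by
      rw [coeff_sub]
      congr 1
      rw [coeff, inner_sum]
      have h4 : ∀ l, inner ℂ (expMode k) (expMode l : ScalarL2 d) = if k = l then 1 else 0 :=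
        fun l => coeff_expMode l k
      simp only [inner_smul_right, h4, mul_ite, mul_one, mul_zero]
      simp
    rw [h2]
    split_ifs <;> simp
  rw [h3, tailSq, ← Finset.sum_congr rfl fun k hk => if_pos hk]
  exact h1

theorem norm_inner_le_tail (S : Finset (Fin d → ℤ)) (f x : ScalarL2 d) :
    ‖inner ℂ f x‖ ≤ ∑ k ∈ S, ‖f‖ * ‖coeff x k‖ + √(tailSq S f) * ‖x‖ := by
  have e : inner ℂ f x = ∑ k ∈ S, (starRingEnd ℂ) (coeff f k) * coeff x k
      + inner ℂ (f - ∑ k ∈ S, coeff f k • (expMode k)) x := by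
    rw [inner_sub_left, sum_inner]
    simp only [inner_smul_left, coeff]
    ring
  rw [e]
  refine (norm_add_le _ _).trans (add_le_add (norm_sum_le_of_le _ fun k _ => ?_) ?_)
  · rw [norm_mul, RCLike.norm_conj]
    exact mul_le_mul_of_nonneg_right (norm_coeff_le _ _) (norm_nonneg _)
  · refine (norm_inner_le_norm _ _).trans (mul_le_mul_of_nonneg_right ?_ (norm_nonneg _))
    rw [← norm_sub_sum_sq]
    exact Real.le_sqrt_of_sq_le le_rfl

theorem gradForm_add_left (g h : Fin d → Fin d → ScalarLinf d) (A B : Fin d → ScalarL2 d) :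
    gradForm (fun k j => g k j + h k j) A B = gradForm g A B + gradForm h A B := by
  simp only [gradForm, mulOp_add, add_apply, inner_add_right, ← Finset.sum_add_distrib]
  refine Finset.sum_congr rfl fun i _ => Finset.sum_congr rfl fun j _ => ?_
  ring

theorem fieldSq_sub (A B : Fin d → ScalarL2 d) :
    fieldSq (fun i => A i - B i) = fieldSq A - fieldSq B
      - 2 * ∑ i, (inner ℂ (B i) (A i - B i)).re := by
  simp only [fieldSq, Finset.mul_sum, ← Finset.sum_sub_distrib]
  refine Finset.sum_congr rfl fun i _ => ?_
  have h := norm_sub_sq (𝕜 := ℂ) (A i) (B i)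
  have h2 : (inner ℂ (B i) (A i - B i)).re = RCLike.re (inner ℂ (A i) (B i)) - ‖B i‖ ^ 2 := by
    rw [inner_sub_right, Complex.sub_re, ← inner_conj_symm, Complex.conj_re,
      ← inner_self_eq_norm_sq (𝕜 := ℂ)]
    rfl
  rw [h, h2]; ring

/-- The defect of additivity of a quadratic form along a weakly convergent sequence. -/
theorem tendsto_gradForm_defect (g : Fin d → Fin d → ScalarLinf d) {f : ℕ → Fin d → ScalarL2 d}
    {f₀ : Fin d → ScalarL2 d}
    (h : ∀ i (ℓ : ScalarL2 d →L[ℂ] ℂ), Tendsto (fun n => ℓ (f n i)) atTop (𝓝 (ℓ (f₀ i)))) :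
    Tendsto (fun n => gradForm g (f n) (f n) - gradForm g f₀ f₀
      - gradForm g (fun i => f n i - f₀ i) (fun i => f n i - f₀ i)) atTop (𝓝 0) := by
  have h1 : ∀ i (x : ScalarL2 d), Tendsto (fun n => inner ℂ x (f n i - f₀ i)) atTop (𝓝 0) :=
    fun i x => by
      have := (h i (innerSL ℂ x)).sub_const (inner ℂ x (f₀ i))
      simpa [inner_sub_right] using this
  have h2 : ∀ i (x : ScalarL2 d), Tendsto (fun n => inner ℂ (f n i - f₀ i) x) atTop (𝓝 0) :=
    fun i x => by
      have := (Complex.continuous_conj.tendsto _).comp (h1 i x)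
      simpa [Function.comp_def, inner_conj_symm] using this
  have h3 : ∀ i j k l, Tendsto (fun n => inner ℂ (f₀ j) (mulOp (g k l) (f n i - f₀ i))) atTop
      (𝓝 0) := fun i j k l => by
    have := (h i ((innerSL ℂ (f₀ j)).comp (mulOp (g k l)))).sub_const
      (inner ℂ (f₀ j) (mulOp (g k l) (f₀ i)))
    simpa [inner_sub_right] using this
  have e : ∀ n, gradForm g (f n) (f n) - gradForm g f₀ f₀
      - gradForm g (fun i => f n i - f₀ i) (fun i => f n i - f₀ i) =
      ∑ i, ∑ j, ((inner ℂ (f n j - f₀ j) (mulOp (g j i) (f₀ i))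
        + inner ℂ (f₀ j) (mulOp (g j i) (f n i - f₀ i)))
        + (inner ℂ (f n i - f₀ i) (mulOp (g j i) (f₀ j))
        + inner ℂ (f₀ i) (mulOp (g j i) (f n j - f₀ j)))) := fun n => by
    simp only [gradForm, ← Finset.sum_sub_distrib]
    refine Finset.sum_congr rfl fun i _ => Finset.sum_congr rfl fun j _ => ?_
    simp only [map_sub, inner_sub_left, inner_sub_right]
    ring
  simp only [e]
  have h4 : Tendsto (fun n => ∑ i, ∑ j, ((inner ℂ (f n j - f₀ j) (mulOp (g j i) (f₀ i))
        + inner ℂ (f₀ j) (mulOp (g j i) (f n i - f₀ i)))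
        + (inner ℂ (f n i - f₀ i) (mulOp (g j i) (f₀ j))
        + inner ℂ (f₀ i) (mulOp (g j i) (f n j - f₀ j))))) atTop
      (𝓝 (∑ _i : Fin d, ∑ _j : Fin d, ((0 + 0 : ℂ) + (0 + 0)))) :=
    tendsto_finsetSum _ fun i _ => tendsto_finsetSum _ fun j _ =>
      ((h2 j _).add (h3 i j j i)).add ((h2 i _).add (h3 j i j i))
  simpa using h4

namespace IsApproximation

variable {K : ℝ} {v : ℝ → Fin d → ScalarLinf d} {g : ℝ → Fin d → Fin d → ScalarLinf d}
  {L : ℝ → ℝ} {z : ℕ → ℝ → Fin d → ScalarLinf d} {h : ℕ → ℝ → Fin d → Fin d → ScalarLinf d}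
  {R : ℕ → ℝ → ℝ} {W : ℕ → ℝ → Fin d → ScalarL2 d} {w₀ : Fin d → ScalarL2 d}
  (H : IsApproximation T K v g L z h R W w₀) {w : ℝ → Fin d → ScalarL2 d}
  (hw : ∀ i k, TendstoUniformlyOn (fun n t => coeff (W n t i) k) (fun t => coeff (w t i) k) atTop
      (Icc 0 T)) (hwK : ∀ t ∈ Icc 0 T, ∀ i, ‖w t i‖ ≤ K)

include H hw hwK

/-- The high frequencies of the limit are uniformly small, by Dini's theorem: the energy identity
makes `‖w(t)‖²` continuous in time. -/
theorem tendstoUniformlyOn_tail (hT : 0 < T) :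
    TendstoUniformlyOn (fun S t => ∑ i, tailSq S (w t i)) (fun _ => 0)
      (atTop : Filter (Finset (Fin d → ℤ))) (Icc 0 T) := by
  have hgi : IntegrableOn (fun s => (gradForm (g s) (w s) (w s)).re) (Ioo 0 T) := by
    refine Integrable.mono' ((H.velocity.integrable.mul_const (K * K)).const_mul (2 * d ^ 2))
      (aestronglyMeasurable_gradForm H.velocity.lip (H.ae_isSolenoidal_limit hw)
        (H.aestronglyMeasurable_coeff_limit hw) (H.isFlux_limit hw hwK)) ?_
    filter_upwards [H.velocity.lip, ae_bound_limit hwK] with s h1 h2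
    exact (Complex.abs_re_le_norm _).trans (norm_gradForm_le h1.2 h2 h2)
  have hc : ContinuousOn (fun t => fieldSq (w t)) (Icc 0 T) :=
    ((continuousOn_primitive_Icc hT hgi).const_add (fieldSq w₀)).congr
      fun t ht => H.fieldSq_limit hw hwK hT ht
  have e : ∀ S t, ∑ i, tailSq S (w t i) =
      fieldSq (w t) - ∑ i, ∑ k ∈ S, ‖coeff (w t i) k‖ ^ 2 := fun S t => by
    simp only [tailSq, fieldSq, Finset.sum_sub_distrib]
  refine Antitone.tendstoUniformlyOn_of_forall_tendsto isCompact_Icc (fun S => ?_)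
    (fun t _ S S' hS => ?_) continuousOn_const fun t _ => ?_
  · simp only [e]
    exact hc.sub (continuousOn_finsetSum _ fun i _ => continuousOn_finsetSum _ fun k _ =>
      (H.continuousOn_coeff_limit hw i k).norm.pow 2)
  · refine Finset.sum_le_sum fun i _ => sub_le_sub_left ?_ _
    exact Finset.sum_le_sum_of_subset_of_nonneg hS fun _ _ _ => sq_nonneg _
  · have h1 : Tendsto (fun S => ∑ i, tailSq S (w t i)) (atTop : Filter (Finset (Fin d → ℤ)))
        (𝓝 (∑ i, (‖w t i‖ ^ 2 - ‖w t i‖ ^ 2))) :=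
      tendsto_finsetSum _ fun i _ => (hasSum_sq_coeff (w t i)).const_sub _
    simpa using h1

/-- The convergence is weak uniformly in time, even when tested with the limit itself. -/
theorem norm_inner_limit_le (hT : 0 < T) {ε : ℝ} (hε : 0 < ε) :
    ∀ᶠ n in atTop, ∀ t ∈ Icc 0 T, |∑ i, (inner ℂ (w t i) (W n t i - w t i)).re| ≤ ε := by
  have hK := H.nonneg
  set δ : ℝ := ε / (2 * d + 1) with hδ
  have hδ0 : 0 < δ := by positivity
  obtain ⟨S, hS⟩ := (Metric.tendstoUniformlyOn_iff.mp (H.tendstoUniformlyOn_tail hw hwK hT)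
    ((δ / (2 * K + 1)) ^ 2) (by positivity)).exists
  have hfin : ∀ᶠ n in atTop, ∀ i, ∀ k ∈ S, ∀ t ∈ Icc 0 T,
      ‖coeff (W n t i) k - coeff (w t i) k‖ ≤ δ / ((S.card + 1) * (K + 1)) := by
    refine eventually_all.mpr fun i => (Filter.eventually_all_finset S).mpr fun k _ => ?_
    filter_upwards [Metric.tendstoUniformlyOn_iff.mp (hw i k) (δ / ((S.card + 1) * (K + 1)))
      (by positivity)] with n hn t ht
    have := hn t ht
    rw [dist_comm, dist_eq_norm] at this
    exact this.le
  filter_upwards [hfin] with n hn t ht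
  have hterm : ∀ i, |(inner ℂ (w t i) (W n t i - w t i)).re| ≤ 2 * δ := by
    intro i
    refine (Complex.abs_re_le_norm _).trans ((norm_inner_le_tail S _ _).trans ?_)
    have h1 : ∑ k ∈ S, ‖w t i‖ * ‖coeff (W n t i - w t i) k‖ ≤ δ := by
      calc _ ≤ ∑ _k ∈ S, K * (δ / ((S.card + 1) * (K + 1))) := by
            refine Finset.sum_le_sum fun k hk => mul_le_mul (hwK t ht i) ?_ (norm_nonneg _) hK
            rw [coeff_sub]
            exact hn i k hk t ht
        _ = δ * ((S.card / (S.card + 1)) * (K / (K + 1))) := by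
            rw [Finset.sum_const, nsmul_eq_mul]; field_simp
        _ ≤ δ * (1 * 1) := by
            gcongr
            · exact (div_le_one (by positivity)).mpr (by linarith)
            · exact (div_le_one (by positivity)).mpr (by linarith)
        _ = δ := by ring
    have h2 : √(tailSq S (w t i)) ≤ δ / (2 * K + 1) := by
      refine Real.sqrt_le_iff.mpr ⟨by positivity, ?_⟩
      have h3 := hS t ht
      rw [dist_comm, Real.dist_eq, sub_zero] at h3
      have h4 := Finset.single_le_sum (f := fun i => tailSq S (w t i))
        (fun i _ => tailSq_nonneg S _) (Finset.mem_univ i)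
      exact h4.trans ((le_abs_self _).trans h3.le)
    have h5 : ‖W n t i - w t i‖ ≤ 2 * K + 1 :=
      (norm_sub_le _ _).trans (by linarith [H.bound n t ht i, hwK t ht i])
    have h6 : √(tailSq S (w t i)) * ‖W n t i - w t i‖ ≤ δ / (2 * K + 1) * (2 * K + 1) :=
      mul_le_mul h2 h5 (norm_nonneg _) (by positivity)
    rw [div_mul_cancel₀ _ (by positivity)] at h6
    linarith
  calc _ ≤ ∑ _i : Fin d, 2 * δ := (Finset.abs_sum_le_sum_abs _ _).trans
        (Finset.sum_le_sum fun i _ => hterm i)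
    _ = ε * (2 * d / (2 * d + 1)) := by
        rw [Finset.sum_const, nsmul_eq_mul, Finset.card_univ, Fintype.card_fin, hδ]; ring
    _ ≤ ε * 1 := by
        gcongr
        exact (div_le_one (by positivity)).mpr (by linarith)
    _ = ε := mul_one ε

/-- The weak limit is a strong one: the energy identities and the Grönwall inequality give a
bound for `‖W n - w‖²` in which only weakly continuous quantities are left. -/
theorem tendstoUniformlyOn_fieldSq (hT : 0 < T) :
    TendstoUniformlyOn (fun n t => fieldSq fun i => W n t i - w t i) (fun _ => 0) atTop
      (Icc 0 T) := by
  have hK := H.nonneg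
  have h0 : (0 : ℝ) ∈ Icc 0 T := ⟨le_rfl, hT.le⟩
  set Λ : ℝ → ℝ := fun s => 2 * d ^ 2 * L s with hΛ
  have hΛi : IntegrableOn Λ (Ioo 0 T) := H.velocity.integrable.const_mul _
  have hΛ0 : ∀ s, 0 ≤ Λ s := fun s => mul_nonneg (by positivity) (H.velocity.nonneg s)
  obtain ⟨C, hC, hgron⟩ := exists_gronwall hT hΛ0 hΛi
  set q : (Fin d → Fin d → ScalarLinf d) → (Fin d → ScalarL2 d) → ℝ :=
    fun g A => (gradForm g A A).re with hq
  set X : ℕ → ℝ → Fin d → ScalarL2 d := fun n s i => W n s i - w s i with hX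
  have hXm : ∀ n i k, AEStronglyMeasurable (fun s => coeff (X n s i) k)
      (volume.restrict (Ioo 0 T)) := fun n i k => by
    simp only [hX, coeff_sub]
    exact (H.aestronglyMeasurable_coeff n i k).sub (H.aestronglyMeasurable_coeff_limit hw i k)
  have hXK : ∀ n, ∀ t ∈ Icc 0 T, ∀ i, ‖X n t i‖ ≤ 2 * K := fun n t ht i =>
    (norm_sub_le _ _).trans (by linarith [H.bound n t ht i, hwK t ht i])
  have hXKae : ∀ n, ∀ᵐ s ∂volume.restrict (Ioo 0 T), ∀ i, ‖X n s i‖ ≤ 2 * K := fun n => by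
    filter_upwards [ae_restrict_mem measurableSet_Ioo] with s hs
    exact hXK n s (Ioo_subset_Icc_self hs)
  have hXsol : ∀ n, ∀ᵐ s ∂volume.restrict (Ioo 0 T), IsSolenoidal (X n s) := fun n => by
    filter_upwards [H.solenoidal n, H.ae_isSolenoidal_limit hw] with s h1 h2
    exact h1.sub h2
  -- measurability and integrability of the quadratic terms
  have hqi : ∀ {A : ℝ → Fin d → ScalarL2 d} {κ : ℝ},
      (∀ᵐ s ∂volume.restrict (Ioo 0 T), IsSolenoidal (A s)) →
      (∀ i k, AEStronglyMeasurable (fun s => coeff (A s i) k) (volume.restrict (Ioo 0 T))) →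
      (∀ᵐ s ∂volume.restrict (Ioo 0 T), ∀ i, ‖A s i‖ ≤ κ) →
      IntegrableOn (fun s => q (g s) (A s)) (Ioo 0 T) := by
    intro A κ hs hm hb
    refine Integrable.mono' ((H.velocity.integrable.mul_const (κ * κ)).const_mul (2 * d ^ 2))
      (aestronglyMeasurable_gradForm H.velocity.lip hs hm (H.velocity.isFlux hm hb)) ?_
    filter_upwards [H.velocity.lip, hb] with s h1 h2
    exact (Complex.abs_re_le_norm _).trans (norm_gradForm_le h1.2 h2 h2)
  have hqW := fun n => hqi (H.solenoidal n) (H.aestronglyMeasurable_coeff n) (H.ae_bound n)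
  have hqw := hqi (H.ae_isSolenoidal_limit hw) (H.aestronglyMeasurable_coeff_limit hw)
    (ae_bound_limit hwK)
  have hqX := fun n => hqi (hXsol n) (hXm n) (hXKae n)
  set ρ : ℕ → ℝ → ℝ := fun n s => q (g s) (W n s) - q (g s) (w s) - q (g s) (X n s) with hρ
  have hρi : ∀ n, IntegrableOn (ρ n) (Ioo 0 T) := fun n => ((hqW n).sub hqw).sub (hqX n)
  have hρ0 : Tendsto (fun n => ∫ s in Ioo 0 T, |ρ n s|) atTop (𝓝 0) := by
    have h1 : Tendsto (fun n => ∫ s in Ioo 0 T, |ρ n s|) atTop (𝓝 (∫ s in Ioo 0 T, (0 : ℝ))) := by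
      refine tendsto_integral_of_dominated_convergence
        (fun s => 2 * d ^ 2 * (L s * (6 * (K * K)))) (fun n => (hρi n).abs.aestronglyMeasurable)
        ((H.velocity.integrable.mul_const _).const_mul _) (fun n => ?_) ?_
      · filter_upwards [H.velocity.lip, H.ae_bound n, ae_bound_limit hwK, hXKae n]
          with s h1 h2 h3 h4
        have e1 := (Complex.abs_re_le_norm _).trans (norm_gradForm_le h1.2 h2 h2)
        have e2 := (Complex.abs_re_le_norm _).trans (norm_gradForm_le h1.2 h3 h3)
        have e3 := (Complex.abs_re_le_norm _).trans (norm_gradForm_le h1.2 h4 h4)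
        rw [Real.norm_eq_abs, abs_abs]
        refine (abs_sub _ _).trans ((add_le_add (abs_sub _ _) le_rfl).trans ?_)
        refine (add_le_add (add_le_add e1 e2) e3).trans_eq ?_
        ring
      · filter_upwards [ae_restrict_mem measurableSet_Ioo] with s hs
        have h1 := tendsto_gradForm_defect (g s) fun i ℓ =>
          H.tendsto_clm hw (Ioo_subset_Icc_self hs) i ℓ
        have h2 := ((Complex.continuous_re.tendsto _).comp h1).abs
        simpa [Function.comp_def] using h2
    simpa using h1
  set I : ℕ → ℝ := fun n => |fieldSq (W n 0) - fieldSq w₀| with hI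
  have hI0 : Tendsto I atTop (𝓝 0) := by
    have h1 : Tendsto (fun n => fieldSq (W n 0)) atTop (𝓝 (fieldSq w₀)) :=
      tendsto_finsetSum _ fun i _ => ((H.tendsto_initial i).norm).pow 2
    have h2 := (h1.sub_const (fieldSq w₀)).abs
    simpa using h2
  set η : ℕ → ℝ := fun n => I n + 2 * d ^ 2 * (K * K) * (∫ s in Ioo 0 T, R n s)
    + ∫ s in Ioo 0 T, |ρ n s| with hη
  have hη0 : Tendsto η atTop (𝓝 0) := by
    have := (hI0.add (H.tendsto_integral.const_mul (2 * d ^ 2 * (K * K)))).add hρ0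
    simpa using this
  have hηn : ∀ n, 0 ≤ η n := fun n => add_nonneg (add_nonneg (abs_nonneg _) (mul_nonneg
    (by positivity) (integral_nonneg (H.perturbation n).nonneg)))
    (integral_nonneg fun _ => abs_nonneg _)
  have hmain : ∀ n, ∀ t ∈ Icc 0 T, fieldSq (X n t) ≤ η n
      + 2 * |∑ i, (inner ℂ (w t i) (X n t i)).re| + ∫ s in (0 : ℝ)..t, Λ s * fieldSq (X n s) := by
    intro n t ht
    have hle := restrict_Ioc_le ht
    have hqh : IntegrableOn (fun s => q (h n s) (W n s)) (Ioo 0 T) := by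
      have h1 := (H.perturbation n)
      refine Integrable.mono' ((h1.integrable.mul_const (K * K)).const_mul (2 * d ^ 2))
        (aestronglyMeasurable_gradForm h1.lip (H.solenoidal n) (H.aestronglyMeasurable_coeff n)
          (H.isFlux_perturbation n)) ?_
      filter_upwards [h1.lip, H.ae_bound n] with s h1 h2
      exact (Complex.abs_re_le_norm _).trans (norm_gradForm_le h1.2 h2 h2)
    have ii : ∀ {f : ℝ → ℝ}, IntegrableOn f (Ioo 0 T) → IntervalIntegrable f volume 0 t :=
      fun hf => intervalIntegrable_of_Ioo hf h0 ht
    have e1 : fieldSq (W n t) - fieldSq (w t) = fieldSq (W n 0) - fieldSq w₀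
        + (∫ s in (0 : ℝ)..t, q (h n s) (W n s)) + (∫ s in (0 : ℝ)..t, ρ n s)
        + ∫ s in (0 : ℝ)..t, q (g s) (X n s) := by
      rw [H.fieldSq_eq hT n ht, H.fieldSq_limit hw hwK hT ht]
      have e2 : ∫ s in (0 : ℝ)..t,
          (gradForm (fun k j => g s k j + h n s k j) (W n s) (W n s)).re =
          (∫ s in (0 : ℝ)..t, q (h n s) (W n s)) + ∫ s in (0 : ℝ)..t, q (g s) (W n s) := by
        rw [← intervalIntegral.integral_add (ii hqh) (ii (hqW n))]
        congr 1; funext s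
        rw [gradForm_add_left, Complex.add_re, add_comm]
      have e3 : ∫ s in (0 : ℝ)..t, ρ n s = (∫ s in (0 : ℝ)..t, q (g s) (W n s))
          - (∫ s in (0 : ℝ)..t, q (g s) (w s)) - ∫ s in (0 : ℝ)..t, q (g s) (X n s) := by
        rw [← intervalIntegral.integral_sub (ii (hqW n)) (ii hqw),
          ← intervalIntegral.integral_sub ((ii (hqW n)).sub (ii hqw)) (ii (hqX n))]
      rw [e2, e3]; ring
    have b1 : ∫ s in (0 : ℝ)..t, q (h n s) (W n s) ≤
        2 * d ^ 2 * (K * K) * ∫ s in Ioo 0 T, R n s := by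
      have hR : IntegrableOn (fun s => 2 * d ^ 2 * (K * K) * R n s) (Ioo 0 T) :=
        (H.perturbation n).integrable.const_mul _
      rw [intervalIntegral.integral_of_le ht.1, ← integral_const_mul]
      refine (integral_mono_ae (Integrable.mono_measure hqh hle) (Integrable.mono_measure hR hle)
        (ae_mono hle ?_)).trans (integral_mono_measure hle (Eventually.of_forall fun s => ?_) hR)
      · filter_upwards [(H.perturbation n).lip, H.ae_bound n] with s h1 h2
        refine ((Complex.re_le_norm _).trans (norm_gradForm_le h1.2 h2 h2)).trans_eq ?_
        ring
      · exact mul_nonneg (by positivity) ((H.perturbation n).nonneg s)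
    have b2 : ∫ s in (0 : ℝ)..t, ρ n s ≤ ∫ s in Ioo 0 T, |ρ n s| := by
      rw [intervalIntegral.integral_of_le ht.1]
      exact (integral_mono (Integrable.mono_measure (hρi n) hle)
        (Integrable.mono_measure (hρi n).abs hle) fun s => le_abs_self _).trans
        (integral_mono_measure hle (Eventually.of_forall fun s => abs_nonneg _) (hρi n).abs)
    have hfm : AEStronglyMeasurable (fun s => fieldSq (X n s)) (volume.restrict (Ioo 0 T)) :=
      aestronglyMeasurable_of_tendsto_ae atTop
        (fun m => aestronglyMeasurable_energy (epsSeq_pos m).le (hXm n))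
        (Eventually.of_forall fun s => tendsto_energy (X n s))
    have hfi : IntegrableOn (fun s => Λ s * fieldSq (X n s)) (Ioo 0 T) := by
      refine Integrable.mono' (hΛi.mul_const (d * (2 * K) ^ 2))
        (hΛi.aestronglyMeasurable.mul hfm) ?_
      filter_upwards [hXKae n] with s hs
      rw [Real.norm_of_nonneg (mul_nonneg (hΛ0 s) (fieldSq_nonneg _))]
      exact mul_le_mul_of_nonneg_left (fieldSq_le hs) (hΛ0 s)
    have b3 : ∫ s in (0 : ℝ)..t, q (g s) (X n s) ≤ ∫ s in (0 : ℝ)..t, Λ s * fieldSq (X n s) := by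
      rw [intervalIntegral.integral_of_le ht.1, intervalIntegral.integral_of_le ht.1]
      refine integral_mono_ae (Integrable.mono_measure (hqX n) hle)
        (Integrable.mono_measure hfi hle) (ae_mono hle ?_)
      filter_upwards [H.velocity.lip] with s h1
      refine ((Complex.re_le_norm _).trans (norm_gradForm_self_le h1.2 _)).trans_eq ?_
      simp only [hΛ]; ring
    have e4 : fieldSq (X n t) = fieldSq (W n t) - fieldSq (w t)
        - 2 * ∑ i, (inner ℂ (w t i) (X n t i)).re := fieldSq_sub (W n t) (w t)
    have b4 := neg_abs_le (∑ i, (inner ℂ (w t i) (X n t i)).re)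
    have b5 := le_abs_self (fieldSq (W n 0) - fieldSq w₀)
    simp only [hη, hI]
    rw [e4, e1]
    linarith
  rw [Metric.tendstoUniformlyOn_iff]
  intro ε hε
  set δ : ℝ := ε / (3 * (C + 1)) with hδ
  have hδ0 : 0 < δ := by positivity
  filter_upwards [H.norm_inner_limit_le hw hwK hT (half_pos hδ0),
    hη0.eventually (gt_mem_nhds hδ0)] with n h1 h2 t ht
  have hb : ∀ t ∈ Icc 0 T, fieldSq (X n t) ≤ 2 * δ + ∫ s in (0 : ℝ)..t, Λ s * fieldSq (X n s) :=
    fun t ht => by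
      have := hmain n t ht
      have := h1 t ht
      linarith
  have hfm : AEStronglyMeasurable (fun s => fieldSq (X n s)) (volume.restrict (Ioo 0 T)) :=
    aestronglyMeasurable_of_tendsto_ae atTop
      (fun m => aestronglyMeasurable_energy (epsSeq_pos m).le (hXm n))
      (Eventually.of_forall fun s => tendsto_energy (X n s))
  have := hgron (fun s => fieldSq (X n s)) (2 * δ) (d * (2 * K) ^ 2) (by positivity) hfm (by
    filter_upwards [hXKae n] with s hs
    exact ⟨fieldSq_nonneg _, fieldSq_le hs⟩) (by
    filter_upwards [ae_restrict_mem measurableSet_Ioo] with s hs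
    exact hb s (Ioo_subset_Icc_self hs)) t ht (hb t ht)
  rw [dist_comm, Real.dist_eq, sub_zero, abs_of_nonneg (fieldSq_nonneg _)]
  refine this.trans_lt ?_
  have h3 : C * (2 * δ) ≤ (C + 1) * (2 * δ) := by nlinarith
  refine h3.trans_lt ?_
  rw [hδ, show (C + 1) * (2 * (ε / (3 * (C + 1)))) = 2 / 3 * ε by field_simp]
  linarith

/-- Strong convergence in `C([0,T]; L²)`. -/
theorem tendstoUniformlyOn (hT : 0 < T) (i : Fin d) :
    TendstoUniformlyOn (fun n t => W n t i) (fun t => w t i) atTop (Icc 0 T) := by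
  rw [Metric.tendstoUniformlyOn_iff]
  intro ε hε
  filter_upwards [Metric.tendstoUniformlyOn_iff.mp (H.tendstoUniformlyOn_fieldSq hw hwK hT)
    (ε ^ 2) (by positivity)] with n hn t ht
  have h1 := hn t ht
  rw [dist_comm, Real.dist_eq, sub_zero, abs_of_nonneg (fieldSq_nonneg _)] at h1
  have h2 := (norm_sq_le_fieldSq (fun i => W n t i - w t i) i).trans_lt h1
  rw [dist_comm, dist_eq_norm]
  exact (pow_lt_pow_iff_left₀ (norm_nonneg _) hε.le two_ne_zero).mp h2

end IsApproximation

end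

/-! ### Limits of distributional solutions -/

section

variable {d : ℕ} {T : ℝ}

theorem isOpenQuotientMap_toTorus : IsOpenQuotientMap (toTorus : (Fin d → ℝ) → _) :=
  IsOpenQuotientMap.piMap fun _ => QuotientAddGroup.isOpenQuotientMap_mk

theorem toTorus_add_single (y : Fin d → ℝ) (j : Fin d) (s : ℝ) :
    toTorus y + Pi.single j (s : UnitAddCircle) = toTorus (y + s • Pi.single j 1) := by
  ext i
  by_cases h : i = j
  · subst h; simp [toTorus]
  · simp [toTorus, h]

theorem IsTestFunction.continuous_partialDeriv {φ : ℝ → UnitAddTorus (Fin d) → ℝ}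
    (hφ : IsTestFunction T φ) (j : Fin d) :
    Continuous fun p : ℝ × UnitAddTorus (Fin d) => partialDeriv j (φ p.1) p.2 := by
  rw [← (IsOpenQuotientMap.id.prodMap isOpenQuotientMap_toTorus).continuous_comp_iff]
  set Φ : ℝ × (Fin d → ℝ) → ℝ := fun p => φ p.1 (toTorus p.2) with hΦ
  have e : (fun p : ℝ × UnitAddTorus (Fin d) => partialDeriv j (φ p.1) p.2) ∘
      Prod.map id toTorus = fun p => fderiv ℝ Φ p (0, Pi.single j 1) := by
    funext p
    simp only [Function.comp_apply, Prod.map_fst, Prod.map_snd, id_eq, partialDeriv,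
      toTorus_add_single]
    have h1 : HasDerivAt (fun s : ℝ => (p.1, p.2 + s • (Pi.single j 1 : Fin d → ℝ)))
        (0, Pi.single j 1) 0 := by
      refine (hasDerivAt_const _ _).prodMk ?_
      simpa using ((hasDerivAt_id (0 : ℝ)).smul_const (Pi.single j 1 : Fin d → ℝ)).const_add p.2
    have h2 : HasFDerivAt Φ (fderiv ℝ Φ p) (p.1, p.2 + (0 : ℝ) • (Pi.single j 1 : Fin d → ℝ)) := by
      rw [zero_smul, add_zero]
      exact (hφ.smooth.differentiable (by simp) p).hasFDerivAt
    exact (h2.comp_hasDerivAt (0 : ℝ) h1).deriv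
  rw [e]
  exact (hφ.smooth.continuous_fderiv (by simp)).clm_apply continuous_const

theorem IsTestFunction.continuous_deriv {φ : ℝ → UnitAddTorus (Fin d) → ℝ}
    (hφ : IsTestFunction T φ) :
    Continuous fun p : ℝ × UnitAddTorus (Fin d) => deriv (fun s => φ s p.2) p.1 := by
  rw [← (IsOpenQuotientMap.id.prodMap isOpenQuotientMap_toTorus).continuous_comp_iff]
  set Φ : ℝ × (Fin d → ℝ) → ℝ := fun p => φ p.1 (toTorus p.2) with hΦ
  have e : (fun p : ℝ × UnitAddTorus (Fin d) => deriv (fun s => φ s p.2) p.1) ∘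
      Prod.map id toTorus = fun p => fderiv ℝ Φ p (1, 0) := by
    funext p
    have h1 : HasDerivAt (fun s : ℝ => (s, p.2)) (1, 0) p.1 :=
      (hasDerivAt_id p.1).prodMk (hasDerivAt_const _ _)
    exact ((hφ.smooth.differentiable (by simp) p).hasFDerivAt.comp_hasDerivAt p.1 h1).deriv
  rw [e]
  exact (hφ.smooth.continuous_fderiv (by simp)).clm_apply continuous_const

/-- A continuous function on the torus, as an element of `L^∞(𝕋^d; ℂ)`. -/
noncomputable def toLinf (ψ : C(UnitAddTorus (Fin d), ℝ)) : ScalarLinf d :=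
  ContinuousMap.toLp ∞ volume ℂ ((⟨_, Complex.continuous_ofReal⟩ : C(ℝ, ℂ)).comp ψ)

theorem coeFn_toLinf (ψ : C(UnitAddTorus (Fin d), ℝ)) :
    toLinf ψ =ᵐ[volume] fun x => (ψ x : ℂ) :=
  ContinuousMap.coeFn_toLp (𝕜 := ℂ) volume _

theorem continuous_toLinf : Continuous (toLinf (d := d)) :=
  (ContinuousMap.toLp ∞ volume ℂ).continuous.comp
    (ContinuousMap.continuous_postcomp (⟨_, Complex.continuous_ofReal⟩ : C(ℝ, ℂ)))

theorem continuous_mulOp_apply :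
    Continuous fun p : ScalarLinf d × ScalarL2 d => mulOp p.1 p.2 :=
  (((ContinuousLinearMap.mul ℂ ℂ).holderL volume ∞ 2 2).continuous.comp continuous_fst).clm_apply
    continuous_snd

/-- A continuous function of time and space with compact support in time is a bounded continuous
function of time with values in `L^∞(𝕋^d)`. -/
theorem exists_multiplier {ψ : ℝ → UnitAddTorus (Fin d) → ℝ}
    (hψ : Continuous fun p : ℝ × UnitAddTorus (Fin d) => ψ p.1 p.2) {a b : ℝ}
    (h0 : ∀ t, t ∉ Icc a b → ∀ x, ψ t x = 0) :
    ∃ m : ℝ → C(UnitAddTorus (Fin d), ℝ), (∀ t x, m t x = ψ t x) ∧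
      Continuous (fun t => toLinf (m t)) ∧ ∃ C, ∀ t, ‖toLinf (m t)‖ ≤ C := by
  set m := ContinuousMap.curry ⟨_, hψ⟩ with hm
  have hc : Continuous fun t => toLinf (m t) := continuous_toLinf.comp m.continuous
  refine ⟨m, fun _ _ => rfl, hc, hc.bounded_above_of_compact_support ?_⟩
  refine HasCompactSupport.intro (isCompact_Icc (a := a) (b := b)) fun t ht => ?_
  have : m t = 0 := ContinuousMap.ext fun x => h0 t ht x
  rw [this, toLinf]
  have h1 : (⟨_, Complex.continuous_ofReal⟩ : C(ℝ, ℂ)).comp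
      (0 : C(UnitAddTorus (Fin d), ℝ)) = 0 := by
    ext x; simp
  rw [h1, map_zero]

theorem IsTestFunction.exists_partialDeriv_multiplier {φ : ℝ → UnitAddTorus (Fin d) → ℝ}
    (hφ : IsTestFunction T φ) (j : Fin d) :
    ∃ m : ℝ → C(UnitAddTorus (Fin d), ℝ), (∀ t x, m t x = partialDeriv j (φ t) x) ∧
      Continuous (fun t => toLinf (m t)) ∧ ∃ C, ∀ t, ‖toLinf (m t)‖ ≤ C := by
  obtain ⟨a, b, -, -, hab⟩ := hφ.support
  refine exists_multiplier (hφ.continuous_partialDeriv j) (a := a) (b := b) fun t ht x => ?_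
  simp [partialDeriv, hab t ht]

theorem IsTestFunction.exists_deriv_multiplier {φ : ℝ → UnitAddTorus (Fin d) → ℝ}
    (hφ : IsTestFunction T φ) :
    ∃ m : ℝ → C(UnitAddTorus (Fin d), ℝ), (∀ t x, m t x = deriv (fun s => φ s x) t) ∧
      Continuous (fun t => toLinf (m t)) ∧ ∃ C, ∀ t, ‖toLinf (m t)‖ ≤ C := by
  obtain ⟨a, b, -, -, hab⟩ := hφ.support
  refine exists_multiplier hφ.continuous_deriv (a := a) (b := b) fun t ht x => ?_
  have h1 : (fun s => φ s x) =ᶠ[𝓝 t] fun _ => 0 := by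
    filter_upwards [isClosed_Icc.isOpen_compl.mem_nhds ht] with s hs
    exact hab s hs x
  rw [h1.deriv_eq, deriv_const]

theorem integrable_mul_continuous {h : UnitAddTorus (Fin d) → ℝ} (hh : Integrable h)
    (ψ : C(UnitAddTorus (Fin d), ℝ)) : Integrable fun x => h x * ψ x :=
  hh.mul_bdd (c := ‖ψ‖) ψ.continuous.aestronglyMeasurable (Eventually.of_forall ψ.norm_coe_le_norm)

theorem integral_apply_mul_apply_mul (f u : L2Field d) (i j : Fin d)
    (ψ : C(UnitAddTorus (Fin d), ℝ)) :
    ∫ x, (f x i * u x j) * ψ x =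
      (inner ℂ (component i f) (mulOp (toLinf ψ) (component j u))).re := by
  have h1 : (inner ℂ (component i f) (mulOp (toLinf ψ) (component j u)) : ℂ) =
      ∫ x, (((f x i * u x j) * ψ x : ℝ) : ℂ) := by
    rw [MeasureTheory.L2.inner_def]
    refine integral_congr_ae ?_
    filter_upwards [coeFn_component i f, coeFn_component j u, coeFn_toLinf ψ,
      coeFn_mulOp (toLinf ψ) (component j u)] with x h1 h2 h3 h4
    rw [h4, h1, h2, h3, RCLike.inner_apply, Complex.conj_ofReal]
    push_cast; ring
  rw [h1, integral_complex_ofReal, Complex.ofReal_re]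

theorem integral_apply_mul (f : L2Field d) (i : Fin d) (ψ : C(UnitAddTorus (Fin d), ℝ)) :
    ∫ x, f x i * ψ x = (inner ℂ (component i f) (mulOp (toLinf ψ) (expMode 0))).re := by
  have h1 : (inner ℂ (component i f) (mulOp (toLinf ψ) (expMode 0)) : ℂ) =
      ∫ x, ((f x i * ψ x : ℝ) : ℂ) := by
    rw [MeasureTheory.L2.inner_def]
    refine integral_congr_ae ?_
    filter_upwards [coeFn_component i f, coeFn_expMode (d := d) 0, coeFn_toLinf ψ,
      coeFn_mulOp (toLinf ψ) (expMode 0)] with x h1 h2 h3 h4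
    rw [h4, h1, h2, h3, RCLike.inner_apply, Complex.conj_ofReal, UnitAddTorus.mFourier_zero]
    simp [mul_comm]
  rw [h1, integral_complex_ofReal, Complex.ofReal_re]

section

variable {P : ℝ → ScalarLinf d} {C : ℝ}

theorem integrableOn_inner_mulOp (hP : Continuous P) (hC : ∀ t, ‖P t‖ ≤ C) {f u : ℝ → ScalarL2 d}
    {K : ℝ} (hf : AEStronglyMeasurable f (volume.restrict (Ioo 0 T)))
    (hK : ∀ t ∈ Icc 0 T, ‖f t‖ ≤ K) (hu : IntegrableOn u (Ioo 0 T)) :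
    IntegrableOn (fun t => (inner ℂ (f t) (mulOp (P t) (u t))).re) (Ioo 0 T) := by
  have hm : AEStronglyMeasurable (fun t => inner ℂ (f t) (mulOp (P t) (u t)))
      (volume.restrict (Ioo 0 T)) := by
    have h2 : AEStronglyMeasurable (fun t => mulOp (P t) (u t)) (volume.restrict (Ioo 0 T)) :=
      Continuous.comp_aestronglyMeasurable₂
        (g := fun (S : ScalarLinf d) (f : ScalarL2 d) => mulOp S f)
        continuous_mulOp_apply hP.aestronglyMeasurable hu.aestronglyMeasurable
    exact hf.inner h2
  refine Integrable.mono' (hu.norm.const_mul (C * K))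
    (Complex.continuous_re.comp_aestronglyMeasurable hm) ?_
  filter_upwards [ae_restrict_mem measurableSet_Ioo] with t ht
  refine (Complex.abs_re_le_norm _).trans ((norm_inner_mulOp_le (hC t) _ _).trans ?_)
  rw [mul_assoc]
  have := hK t (Ioo_subset_Icc_self ht)
  have : 0 ≤ C := (norm_nonneg _).trans (hC t)
  gcongr

theorem tendsto_integral_inner_mulOp (hP : Continuous P) (hC : ∀ t, ‖P t‖ ≤ C)
    {f : ℕ → ℝ → ScalarL2 d} {f₀ : ℝ → ScalarL2 d} {K : ℝ}
    (hfm : ∀ n, AEStronglyMeasurable (f n) (volume.restrict (Ioo 0 T)))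
    (hK : ∀ n, ∀ t ∈ Icc 0 T, ‖f n t‖ ≤ K)
    (hf : TendstoUniformlyOn f f₀ atTop (Icc 0 T)) {u : ℕ → ℝ → ScalarL2 d} {u₀ : ℝ → ScalarL2 d}
    (hu : ∀ n, IntegrableOn (u n) (Ioo 0 T)) (hu₀ : IntegrableOn u₀ (Ioo 0 T))
    (huL : Tendsto (fun n => ∫ t in Ioo 0 T, ‖u n t - u₀ t‖) atTop (𝓝 0)) :
    Tendsto (fun n => ∫ t in Ioo 0 T, (inner ℂ (f n t) (mulOp (P t) (u n t))).re) atTop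
      (𝓝 (∫ t in Ioo 0 T, (inner ℂ (f₀ t) (mulOp (P t) (u₀ t))).re)) := by
  have hC0 : 0 ≤ C := (norm_nonneg _).trans (hC 0)
  -- change first the velocity, then the field
  have h1 : Tendsto (fun n => ∫ t in Ioo 0 T, (inner ℂ (f n t) (mulOp (P t) (u n t - u₀ t))).re)
      atTop (𝓝 0) := by
    have hi := fun n => (hu n).sub hu₀
    have hb : ∀ n, ‖∫ t in Ioo 0 T, (inner ℂ (f n t) (mulOp (P t) (u n t - u₀ t))).re‖ ≤
        C * (K * ∫ t in Ioo 0 T, ‖u n t - u₀ t‖) := fun n => by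
      rw [← integral_const_mul, ← integral_const_mul]
      refine norm_integral_le_of_norm_le (((hi n).norm.const_mul K).const_mul C) ?_
      filter_upwards [ae_restrict_mem measurableSet_Ioo] with t ht
      refine (Complex.abs_re_le_norm _).trans ((norm_inner_mulOp_le (hC t) _ _).trans ?_)
      have := hK n t (Ioo_subset_Icc_self ht)
      gcongr
    refine squeeze_zero_norm hb ?_
    simpa using (huL.const_mul K).const_mul C
  have h2 : Tendsto (fun n => ∫ t in Ioo 0 T, (inner ℂ (f n t) (mulOp (P t) (u₀ t))).re) atTop
      (𝓝 (∫ t in Ioo 0 T, (inner ℂ (f₀ t) (mulOp (P t) (u₀ t))).re)) := by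
    refine tendsto_integral_of_dominated_convergence (fun t => C * (K * ‖u₀ t‖))
      (fun n => (integrableOn_inner_mulOp hP hC (hfm n) (hK n) hu₀).aestronglyMeasurable)
      ((hu₀.norm.const_mul K).const_mul C) (fun n => ?_) ?_
    · filter_upwards [ae_restrict_mem measurableSet_Ioo] with t ht
      refine (Complex.abs_re_le_norm _).trans ((norm_inner_mulOp_le (hC t) _ _).trans ?_)
      have := hK n t (Ioo_subset_Icc_self ht)
      gcongr
    · filter_upwards [ae_restrict_mem measurableSet_Ioo] with t ht
      exact (Complex.continuous_re.tendsto _).comp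
        ((hf.tendsto_at (Ioo_subset_Icc_self ht)).inner tendsto_const_nhds)
  have h3 := h1.add h2
  rw [zero_add] at h3
  refine h3.congr fun n => ?_
  have hi : IntegrableOn (fun t => u n t - u₀ t) (Ioo 0 T) := (hu n).sub hu₀
  rw [← integral_add (integrableOn_inner_mulOp hP hC (hfm n) (hK n) hi)
    (integrableOn_inner_mulOp hP hC (hfm n) (hK n) hu₀)]
  refine integral_congr_ae (Eventually.of_forall fun t => ?_)
  simp only [map_sub, inner_sub_right, Complex.sub_re, sub_add_cancel]

end

theorem norm_component_le (i : Fin d) (f : L2Field d) : ‖component i f‖ ≤ ‖f‖ := by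
  refine Lp.norm_le_norm_of_ae_le ?_
  filter_upwards [coeFn_component i f] with x hx
  rw [hx, Complex.norm_real]
  exact PiLp.norm_apply_le _ _

theorem integrableOn_component {u : ℝ → L2Field d} {s : Set ℝ} (hu : IntegrableOn u s)
    (i : Fin d) : IntegrableOn (fun t => component i (u t)) s :=
  ContinuousLinearMap.integrable_comp (component i : L2Field d →L[ℝ] ScalarL2 d) hu

theorem tendsto_integral_component_sub {u : ℕ → ℝ → L2Field d} {u₀ : ℝ → L2Field d}
    (hu : ∀ n, IntegrableOn (u n) (Ioo 0 T)) (hu₀ : IntegrableOn u₀ (Ioo 0 T))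
    (huL : Tendsto (fun n => ∫ t in Ioo 0 T, ‖u n t - u₀ t‖) atTop (𝓝 0)) (j : Fin d) :
    Tendsto (fun n => ∫ t in Ioo 0 T, ‖component j (u n t) - component j (u₀ t)‖) atTop (𝓝 0) := by
  refine squeeze_zero (fun n => integral_nonneg fun t => norm_nonneg _) (fun n => ?_) huL
  simp only [← map_sub]
  exact integral_mono (integrableOn_component ((hu n).sub hu₀) j).norm ((hu n).sub hu₀).norm
    fun t => norm_component_le j _

/-- The spatial integral in the divergence constraint. -/
theorem integral_div_eq (u : L2Field d) (m : Fin d → C(UnitAddTorus (Fin d), ℝ)) :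
    ∫ x, ∑ j, u x j * m j x =
      ∑ j, (inner ℂ (expMode 0) (mulOp (toLinf (m j)) (component j u))).re := by
  rw [integral_finsetSum _ fun j _ => integrable_mul_continuous (integrable_apply u j) (m j)]
  refine Finset.sum_congr rfl fun j _ => ?_
  rw [integral_apply_mul]
  have hr : ∀ᵐ x, (starRingEnd ℂ) (toLinf (m j) x) = toLinf (m j) x := by
    filter_upwards [coeFn_toLinf (m j)] with x hx
    rw [hx, Complex.conj_ofReal]
  rw [← inner_conj_symm, Complex.conj_re, inner_mulOp_left hr]

/-- The spatial integral in the equation. -/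
theorem integral_equation_eq (f u : L2Field d) (i : Fin d) (m₀ : C(UnitAddTorus (Fin d), ℝ))
    (m : Fin d → C(UnitAddTorus (Fin d), ℝ)) :
    ∫ x, (f x i * m₀ x + ∑ j, (f x i * u x j) * m j x - ∑ j, (u x i * f x j) * m j x) =
      (inner ℂ (component i f) (mulOp (toLinf m₀) (expMode 0))).re
      + ∑ j, (inner ℂ (component i f) (mulOp (toLinf (m j)) (component j u))).re
      - ∑ j, (inner ℂ (component j f) (mulOp (toLinf (m j)) (component i u))).re := by
  have h0 := integrable_mul_continuous (integrable_apply f i) m₀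
  have h1 : ∀ i j l, Integrable fun x => (f x i * u x j) * m l x := fun i j l =>
    integrable_mul_continuous (integrable_apply_mul f u i j) (m l)
  have h2 : Integrable fun x => f x i * m₀ x + ∑ j, (f x i * u x j) * m j x :=
    h0.add (integrable_finsetSum _ fun j _ => h1 i j j)
  simp only [mul_comm (u _ i)]
  rw [integral_sub h2 (integrable_finsetSum _ fun j _ => h1 j i j),
    integral_add h0 (integrable_finsetSum _ fun j _ => h1 i j j),
    integral_finsetSum _ fun j _ => h1 i j j, integral_finsetSum _ fun j _ => h1 j i j,
    integral_apply_mul]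
  simp only [integral_apply_mul_apply_mul]

theorem IsDivFree.of_tendsto {u : ℕ → ℝ → L2Field d} {u₀ : ℝ → L2Field d}
    (hdiv : ∀ n, IsDivFree T (u n))
    (hu : ∀ n, IntegrableOn (u n) (Ioo 0 T)) (hu₀ : IntegrableOn u₀ (Ioo 0 T))
    (huL : Tendsto (fun n => ∫ t in Ioo 0 T, ‖u n t - u₀ t‖) atTop (𝓝 0)) : IsDivFree T u₀ := by
  intro φ hφ
  choose m hm hmc C hC using fun j => hφ.exists_partialDeriv_multiplier j
  have hone : ∀ t ∈ Icc 0 T, ‖(expMode 0 : ScalarL2 d)‖ ≤ 1 := fun _ _ => (norm_expMode 0).le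
  have e : ∀ w : ℝ → L2Field d, IntegrableOn w (Ioo 0 T) →
      ∫ t in Ioo 0 T, ∫ x, ∑ j, w t x j * partialDeriv j (φ t) x =
      ∑ j, ∫ t in Ioo 0 T,
        (inner ℂ (expMode 0) (mulOp (toLinf (m j t)) (component j (w t)))).re := fun w hw => by
    rw [← integral_finsetSum _ fun j _ => integrableOn_inner_mulOp (hmc j) (hC j)
      aestronglyMeasurable_const hone (integrableOn_component hw j)]
    simp only [← integral_div_eq, hm]
  have h1 : Tendsto (fun n => ∑ j, ∫ t in Ioo 0 T,
      (inner ℂ (expMode 0) (mulOp (toLinf (m j t)) (component j (u n t)))).re) atTop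
      (𝓝 (∑ j, ∫ t in Ioo 0 T,
      (inner ℂ (expMode 0) (mulOp (toLinf (m j t)) (component j (u₀ t)))).re)) :=
    tendsto_finsetSum _ fun j _ => tendsto_integral_inner_mulOp (hmc j) (hC j)
      (fun _ => aestronglyMeasurable_const) (fun _ => hone)
      (fun s hs => Eventually.of_forall fun n t _ => refl_mem_uniformity hs)
      (fun n => integrableOn_component (hu n) j) (integrableOn_component hu₀ j)
      (tendsto_integral_component_sub hu hu₀ huL j)
  rw [e u₀ hu₀]
  refine tendsto_nhds_unique h1 ?_
  simp only [← e _ (hu _), hdiv _ φ hφ]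
  exact tendsto_const_nhds

/-- Solutions are stable under uniform convergence of the field and convergence in `L¹(0,T; L²)`
of the velocity. -/
theorem IsSolution.of_tendsto {A u : ℕ → ℝ → L2Field d} {A₀ u₀ : ℝ → L2Field d} {K : ℝ}
    (hsol : ∀ n, IsSolution T (A n) (u n))
    (hAc : ∀ n, ContinuousOn (A n) (Icc 0 T)) (hAc₀ : ContinuousOn A₀ (Icc 0 T))
    (hK : ∀ n, ∀ t ∈ Icc 0 T, ‖A n t‖ ≤ K) (hK₀ : ∀ t ∈ Icc 0 T, ‖A₀ t‖ ≤ K)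
    (hA : TendstoUniformlyOn A A₀ atTop (Icc 0 T))
    (hu : ∀ n, IntegrableOn (u n) (Ioo 0 T)) (hu₀ : IntegrableOn u₀ (Ioo 0 T))
    (huL : Tendsto (fun n => ∫ t in Ioo 0 T, ‖u n t - u₀ t‖) atTop (𝓝 0)) :
    IsSolution T A₀ u₀ := by
  have hm : ∀ {w : ℝ → L2Field d}, ContinuousOn w (Icc 0 T) → ∀ i,
      AEStronglyMeasurable (fun t => component i (w t)) (volume.restrict (Ioo 0 T)) :=
    fun hw i => (((component i : L2Field d →L[ℝ] ScalarL2 d).continuous.comp_continuousOn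
      (hw.mono Ioo_subset_Icc_self))).aestronglyMeasurable measurableSet_Ioo
  have hb : ∀ {w : ℝ → L2Field d}, (∀ t ∈ Icc 0 T, ‖w t‖ ≤ K) → ∀ i, ∀ t ∈ Icc 0 T,
      ‖component i (w t)‖ ≤ K := fun hw i t ht => (norm_component_le i _).trans (hw t ht)
  have hAi : ∀ {w : ℝ → L2Field d}, ContinuousOn w (Icc 0 T) → IntegrableOn w (Ioo 0 T) :=
    fun hw => hw.integrableOn_Icc.mono_set Ioo_subset_Icc_self
  have hAu : ∀ i, TendstoUniformlyOn (fun n t => component i (A n t))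
      (fun t => component i (A₀ t)) atTop (Icc 0 T) := fun i =>
    (component i : L2Field d →L[ℝ] ScalarL2 d).uniformContinuous.comp_tendstoUniformlyOn hA
  have hexp : IntegrableOn (fun _ : ℝ => (expMode 0 : ScalarL2 d)) (Ioo 0 T) :=
    integrableOn_const (by simp)
  refine ⟨fun i φ hφ => ?_, ?_, IsDivFree.of_tendsto (fun n => (hsol n).div_right) hu hu₀ huL⟩
  · choose m hm' hmc C hC using fun j => hφ.exists_partialDeriv_multiplier j
    obtain ⟨m₀, hm₀, hmc₀, C₀, hC₀⟩ := hφ.exists_deriv_multiplier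
    have e : ∀ w z : ℝ → L2Field d, ContinuousOn w (Icc 0 T) → (∀ t ∈ Icc 0 T, ‖w t‖ ≤ K) →
        IntegrableOn z (Ioo 0 T) →
        ∫ t in Ioo 0 T, ∫ x, (w t x i * deriv (fun s => φ s x) t
          + ∑ j, (w t x i * z t x j) * partialDeriv j (φ t) x
          - ∑ j, (z t x i * w t x j) * partialDeriv j (φ t) x) =
        (∫ t in Ioo 0 T, (inner ℂ (component i (w t)) (mulOp (toLinf (m₀ t)) (expMode 0))).re)
        + (∑ j, ∫ t in Ioo 0 T,
          (inner ℂ (component i (w t)) (mulOp (toLinf (m j t)) (component j (z t)))).re)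
        - ∑ j, ∫ t in Ioo 0 T,
          (inner ℂ (component j (w t)) (mulOp (toLinf (m j t)) (component i (z t)))).re := by
      intro w z hwc hwK hz
      have h0 := integrableOn_inner_mulOp hmc₀ hC₀ (hm hwc i) (hb hwK i) hexp
      have h1 : ∀ i j l, IntegrableOn (fun t => (inner ℂ (component i (w t))
          (mulOp (toLinf (m l t)) (component j (z t)))).re) (Ioo 0 T) := fun i j l =>
        integrableOn_inner_mulOp (hmc l) (hC l) (hm hwc i) (hb hwK i) (integrableOn_component hz j)
      have h2 : IntegrableOn (fun t =>
          (inner ℂ (component i (w t)) (mulOp (toLinf (m₀ t)) (expMode 0))).re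
          + ∑ j, (inner ℂ (component i (w t)) (mulOp (toLinf (m j t)) (component j (z t)))).re)
          (Ioo 0 T) := h0.add (integrable_finsetSum _ fun j _ => h1 i j j)
      rw [← integral_finsetSum _ fun j _ => h1 i j j, ← integral_finsetSum _ fun j _ => h1 j i j,
        ← integral_add h0 (integrable_finsetSum _ fun j _ => h1 i j j),
        ← integral_sub h2 (integrable_finsetSum _ fun j _ => h1 j i j)]
      simp only [← integral_equation_eq, hm', hm₀]
    have h1 : Tendsto (fun n =>
        (∫ t in Ioo 0 T, (inner ℂ (component i (A n t)) (mulOp (toLinf (m₀ t)) (expMode 0))).re)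
        + (∑ j, ∫ t in Ioo 0 T,
          (inner ℂ (component i (A n t)) (mulOp (toLinf (m j t)) (component j (u n t)))).re)
        - ∑ j, ∫ t in Ioo 0 T,
          (inner ℂ (component j (A n t)) (mulOp (toLinf (m j t)) (component i (u n t)))).re) atTop
        (𝓝 ((∫ t in Ioo 0 T, (inner ℂ (component i (A₀ t)) (mulOp (toLinf (m₀ t)) (expMode 0))).re)
        + (∑ j, ∫ t in Ioo 0 T,
          (inner ℂ (component i (A₀ t)) (mulOp (toLinf (m j t)) (component j (u₀ t)))).re)
        - ∑ j, ∫ t in Ioo 0 T,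
          (inner ℂ (component j (A₀ t)) (mulOp (toLinf (m j t)) (component i (u₀ t)))).re)) := by
      have h2 : ∀ i j l, Tendsto (fun n => ∫ t in Ioo 0 T, (inner ℂ (component i (A n t))
          (mulOp (toLinf (m l t)) (component j (u n t)))).re) atTop (𝓝 (∫ t in Ioo 0 T,
          (inner ℂ (component i (A₀ t)) (mulOp (toLinf (m l t)) (component j (u₀ t)))).re)) :=
        fun i j l => tendsto_integral_inner_mulOp (hmc l) (hC l) (fun n => hm (hAc n) i)
          (fun n => hb (hK n) i) (hAu i)
          (fun n => integrableOn_component (hu n) j) (integrableOn_component hu₀ j)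
          (tendsto_integral_component_sub hu hu₀ huL j)
      refine Tendsto.sub (Tendsto.add ?_ (tendsto_finsetSum _ fun j _ => h2 i j j))
        (tendsto_finsetSum _ fun j _ => h2 j i j)
      exact tendsto_integral_inner_mulOp hmc₀ hC₀ (fun n => hm (hAc n) i)
          (fun n => hb (hK n) i) (hAu i) (fun _ => hexp) hexp (by simp)
    rw [e A₀ u₀ hAc₀ hK₀ hu₀]
    refine tendsto_nhds_unique h1 ?_
    simp only [← e (A _) (u _) (hAc _) (hK _) (hu _), (hsol _).equation i φ hφ]
    exact tendsto_const_nhds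
  · refine IsDivFree.of_tendsto (fun n => (hsol n).div_left) (fun n => hAi (hAc n)) (hAi hAc₀) ?_
    have hi := fun n => ((hAi (hAc n)).sub (hAi hAc₀)).norm
    have h1 : Tendsto (fun n => ∫ t in Ioo 0 T, ‖A n t - A₀ t‖) atTop
        (𝓝 (∫ t in Ioo 0 T, (0 : ℝ))) := by
      refine tendsto_integral_of_dominated_convergence (fun _ => K + K)
        (fun n => (hi n).aestronglyMeasurable) (integrableOn_const (by simp)) (fun n => ?_) ?_
      · filter_upwards [ae_restrict_mem measurableSet_Ioo] with t ht
        have ht' := Ioo_subset_Icc_self ht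
        rw [norm_norm]
        exact (norm_sub_le _ _).trans (add_le_add (hK n t ht') (hK₀ t ht'))
      · filter_upwards [ae_restrict_mem measurableSet_Ioo] with t ht
        exact tendsto_iff_norm_sub_tendsto_zero.mp (hA.tendsto_at (Ioo_subset_Icc_self ht))
    simpa using h1

end

/-! ### Solutions in `C([0,T]; L²)` and in `L^∞(0,T; L²)` -/

section

variable {d : ℕ} {T : ℝ}

theorem norm_le_sum_component (f : L2Field d) : ‖f‖ ≤ ∑ i, ‖component i f‖ := by
  have hE : ∀ y : Vec d, ‖y‖ ≤ ∑ i, ‖y i‖ := fun y => by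
    rw [EuclideanSpace.norm_eq]
    refine Real.sqrt_le_iff.mpr ⟨Finset.sum_nonneg fun _ _ => norm_nonneg _, ?_⟩
    exact Finset.sum_sq_le_sq_sum_of_nonneg fun _ _ => norm_nonneg _
  have h1 : eLpNorm f 2 volume ≤ ∑ i, eLpNorm (component i f) 2 volume := by
    calc eLpNorm f 2 volume
        ≤ eLpNorm (∑ i, fun x => ‖component i f x‖) 2 volume := by
          refine eLpNorm_mono_ae_real ?_
          have hx := ae_all_iff.mpr fun i => coeFn_component i f
          filter_upwards [hx] with x hx
          rw [Finset.sum_apply]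
          refine (hE (f x)).trans_eq (Finset.sum_congr rfl fun i _ => ?_)
          rw [hx i, Complex.norm_real]
      _ ≤ ∑ i, eLpNorm (fun x => ‖component i f x‖) 2 volume :=
          eLpNorm_sum_le (fun i _ => (Lp.aestronglyMeasurable _).norm) one_le_two
      _ = _ := by simp only [eLpNorm_norm]
  simp only [Lp.norm_def]
  rw [← ENNReal.toReal_sum fun i _ => Lp.eLpNorm_ne_top _]
  exact ENNReal.toReal_mono (ENNReal.sum_ne_top.mpr fun i _ => Lp.eLpNorm_ne_top _) h1

theorem ext_component {f g : L2Field d} (h : ∀ i, component i f = component i g) : f = g := by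
  have h1 := norm_le_sum_component (f - g)
  simp only [map_sub, h, sub_self, norm_zero, Finset.sum_const_zero] at h1
  exact sub_eq_zero.mp (norm_le_zero_iff.mp h1)

theorem norm_le_of_ae_norm_le {E : Type*} [NormedAddCommGroup E] (hT : 0 < T) {f : ℝ → E} {K : ℝ}
    (hf : ContinuousOn f (Icc 0 T)) (h : ∀ᵐ t ∂volume.restrict (Ioo 0 T), ‖f t‖ ≤ K) :
    ∀ t ∈ Icc 0 T, ‖f t‖ ≤ K := by
  have h1 : EqOn (fun t => max ‖f t‖ K) (fun _ => K) (Icc 0 T) := by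
    refine Measure.eqOn_Icc_of_ae_eq volume hT.ne ?_
      (hf.norm.sup continuousOn_const) continuousOn_const
    rw [← Measure.restrict_congr_set Ioo_ae_eq_Icc]
    filter_upwards [h] with t ht
    exact max_eq_right ht
  exact fun t ht => max_eq_right_iff.mp (h1 ht)

theorem ae_norm_le_of_eLpNorm_le {A : ℝ → L2Field d} {M : ℝ≥0}
    (h : eLpNorm A ∞ (volume.restrict (Ioo 0 T)) ≤ M) :
    ∀ᵐ t ∂volume.restrict (Ioo 0 T), ‖A t‖ ≤ M := by
  filter_upwards [enorm_ae_le_eLpNormEssSup A (volume.restrict (Ioo 0 T))] with t ht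
  rw [← eLpNorm_exponent_top] at ht
  have := ht.trans h
  rwa [enorm_le_coe] at this

variable {v : ℝ → Fin d → ScalarLinf d} {g : ℝ → Fin d → Fin d → ScalarLinf d} {L : ℝ → ℝ}
  {u : ℝ → L2Field d}

theorem IsVelocity.isFlux_component (hv : IsVelocity T v g L) {A : ℝ → L2Field d} {K : ℝ}
    (hA : AEStronglyMeasurable A (volume.restrict (Ioo 0 T)))
    (hK : ∀ᵐ t ∂volume.restrict (Ioo 0 T), ‖A t‖ ≤ K) :
    IsFlux T (fun t => flux (v t) fun i => component i (A t)) (fun t => 2 * K * L t) := by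
  refine hv.isFlux (fun i k => (continuous_coeff_component i k).comp_aestronglyMeasurable hA) ?_
  filter_upwards [hK] with t ht i
  exact (norm_component_le i _).trans ht

/-- A solution which is continuous in time evolves from its value at `t = 0`. -/
theorem IsSolution.evolvesTo (hT : 0 < T) {A : ℝ → L2Field d} (hsol : IsSolution T A u) {K : ℝ}
    (hA : ContinuousOn A (Icc 0 T)) (hK : ∀ t ∈ Icc 0 T, ‖A t‖ ≤ K) (hv : IsVelocity T v g L)
    (hvu : ∀ᵐ t ∂volume.restrict (Ioo 0 T), ∀ j, v t j =ᵐ[volume] component j (u t))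
    {t : ℝ} (ht : t ∈ Icc 0 T) :
    EvolvesTo (fun s => flux (v s) fun i => component i (A s)) (fun i => component i (A 0))
      (fun i => component i (A t)) t := by
  intro i k
  have hAi : IntegrableOn A (Ioo 0 T) := hA.integrableOn_Icc.mono_set Ioo_subset_Icc_self
  have hG := hv.isFlux_component (K := K) hAi.aestronglyMeasurable (by
    filter_upwards [ae_restrict_mem measurableSet_Ioo] with s hs
    exact hK s (Ioo_subset_Icc_self hs))
  obtain ⟨C, hC⟩ := hsol.exists_coeff_eq hT hAi hvu hG i k
  have h1 : EqOn (fun t => coeff (component i (A t)) k)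
      (fun t => C + ∫ r in (0 : ℝ)..t, rate (flux (v r) fun i => component i (A r)) i k)
      (Icc 0 T) := by
    refine Measure.eqOn_Icc_of_ae_eq volume hT.ne ?_
      ((continuous_coeff_component i k).comp_continuousOn hA)
      ((continuousOn_primitive_Icc hT (hG.integrable_rate i k)).const_add C)
    rwa [← Measure.restrict_congr_set Ioo_ae_eq_Icc]
  have h2 := h1 (⟨le_rfl, hT.le⟩ : (0 : ℝ) ∈ Icc 0 T)
  simp only [intervalIntegral.integral_same, add_zero] at h2
  rw [h2]
  exact h1 ht

theorem neBot_nhdsGT_inf_ae : (𝓝[>] (0 : ℝ) ⊓ ae volume).NeBot := by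
  rw [inf_neBot_iff]
  intro s hs s' hs'
  obtain ⟨ε, hε, hsub⟩ := mem_nhdsGT_iff_exists_Ioo_subset.mp hs
  by_contra hne
  rw [not_nonempty_iff_eq_empty, ← disjoint_iff_inter_eq_empty] at hne
  have h1 : volume (Ioo 0 ε) ≤ volume s'ᶜ :=
    measure_mono fun x hx hx' => hne.le_bot ⟨hsub hx, hx'⟩
  rw [mem_ae_iff.mp hs', Real.volume_Ioo, sub_zero, nonpos_iff_eq_zero,
    ENNReal.ofReal_eq_zero] at h1
  exact absurd hε (not_lt.mpr h1)

theorem HasInitialTrace.tendsto_coeff {B : ℝ → L2Field d} {A₀ : L2Field d}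
    (h : HasInitialTrace B A₀) (i : Fin d) (k : Fin d → ℤ) :
    Tendsto (fun t => coeff (component i (B t)) k) (𝓝[>] 0 ⊓ ae volume)
      (𝓝 (coeff (component i A₀) k)) := by
  have hR : ∀ R : ℂ →L[ℝ] ℝ, Tendsto (fun t => R (coeff (component i (B t)) k))
      (𝓝[>] 0 ⊓ ae volume) (𝓝 (R (coeff (component i A₀) k))) := by
    intro R
    have e : ∀ f : L2Field d, R (coeff (component i f) k) =
        (EuclideanSpace.proj i : Vec d →L[ℝ] ℝ)
          (∫ x, R (UnitAddTorus.mFourier (-k) x) • f x) := fun f => by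
      have hf : Integrable f := (Lp.memLp f).integrable one_le_two
      have hc : Continuous fun x => R (UnitAddTorus.mFourier (-k) x) :=
        R.continuous.comp (UnitAddTorus.mFourier (-k)).continuous
      have hi : Integrable fun x => R (UnitAddTorus.mFourier (-k) x) • f x := by
        obtain ⟨C, hC⟩ := isCompact_univ.exists_bound_of_continuousOn hc.continuousOn
        exact hf.bdd_smul C hc.aestronglyMeasurable (Eventually.of_forall fun x => hC x trivial)
      rw [← ContinuousLinearMap.integral_comp_comm _ hi, coeff_component]
      have h1 := integral_comp_mFourier_mul R (-k) 1 (integrable_apply f i)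
      simp only [one_mul] at h1
      rw [← h1]
      simp
    simp only [e]
    exact ((EuclideanSpace.proj i : Vec d →L[ℝ] ℝ).continuous.tendsto _).comp
      (h _ (isSmooth_comp_mFourier R (-k)))
  have h1 := (Complex.continuous_ofReal.tendsto _).comp (hR Complex.reCLM)
  have h2 := (Complex.continuous_ofReal.tendsto _).comp (hR Complex.imCLM)
  have h3 := h1.add (h2.mul_const Complex.I)
  simpa [Function.comp_def, Complex.re_add_im] using h3

/-- A bounded solution evolves from its initial trace, at almost every time. -/
theorem IsSolution.ae_evolvesTo (hT : 0 < T) {B : ℝ → L2Field d} {A₀ : L2Field d}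
    (hsol : IsSolution T B u) (htr : HasInitialTrace B A₀) (hB : IntegrableOn B (Ioo 0 T))
    {γ : ℝ → ℝ}
    (hG : IsFlux T (fun t => flux (v t) fun i => component i (B t)) γ)
    (hvu : ∀ᵐ t ∂volume.restrict (Ioo 0 T), ∀ j, v t j =ᵐ[volume] component j (u t)) :
    ∀ᵐ t ∂volume.restrict (Ioo 0 T),
      EvolvesTo (fun s => flux (v s) fun i => component i (B s)) (fun i => component i A₀)
        (fun i => component i (B t)) t := by
  refine ae_all_iff.mpr fun i => ae_all_iff.mpr fun k => ?_
  obtain ⟨C, hC⟩ := hsol.exists_coeff_eq hT hB hvu hG i k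
  have hne := neBot_nhdsGT_inf_ae
  have h1 : Tendsto (fun t => C + ∫ r in (0 : ℝ)..t,
      rate (flux (v r) fun i => component i (B r)) i k) (𝓝[>] 0 ⊓ ae volume) (𝓝 C) := by
    have h2 := ((continuousOn_primitive_Icc hT (hG.integrable_rate i k)).const_add C) 0
      ⟨le_rfl, hT.le⟩
    have h3 : Tendsto _ (𝓝[Icc 0 T] 0) (𝓝 _) := h2
    simp only [intervalIntegral.integral_same, add_zero] at h3
    refine h3.mono_left (inf_le_left.trans ?_)
    rw [← nhdsWithin_Ioo_eq_nhdsGT hT]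
    exact nhdsWithin_mono _ Ioo_subset_Icc_self
  have h4 : C = coeff (component i A₀) k := by
    refine tendsto_nhds_unique (h1.congr' ?_) (htr.tendsto_coeff i k)
    rw [ae_restrict_iff' measurableSet_Ioo] at hC
    filter_upwards [mem_inf_of_left (Ioo_mem_nhdsGT hT), mem_inf_of_right hC] with t ht h
    exact (h ht).symm
  rw [← h4]
  exact hC

theorem energy_sub_self (A : Fin d → ScalarL2 d) : energy 1 (fun i => A i - A i) = 0 := by
  simp [energy, coeff]

/-- Solutions in `L^∞(0,T; L²)` with the same initial datum coincide. -/
theorem ae_eq_of_evolvesTo (hT : 0 < T) {A B : ℝ → L2Field d} {A₀ : L2Field d} {K : ℝ}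
    (hv : IsVelocity T v g L)
    (hAs : ∀ᵐ t ∂volume.restrict (Ioo 0 T), IsSolenoidal fun i => component i (A t))
    (hBs : ∀ᵐ t ∂volume.restrict (Ioo 0 T), IsSolenoidal fun i => component i (B t))
    (hAm : AEStronglyMeasurable A (volume.restrict (Ioo 0 T)))
    (hBm : AEStronglyMeasurable B (volume.restrict (Ioo 0 T)))
    (hAK : ∀ᵐ t ∂volume.restrict (Ioo 0 T), ‖A t‖ ≤ K)
    (hBK : ∀ᵐ t ∂volume.restrict (Ioo 0 T), ‖B t‖ ≤ K)
    (hA : ∀ᵐ t ∂volume.restrict (Ioo 0 T),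
      EvolvesTo (fun s => flux (v s) fun i => component i (A s)) (fun i => component i A₀)
        (fun i => component i (A t)) t)
    (hB : ∀ᵐ t ∂volume.restrict (Ioo 0 T),
      EvolvesTo (fun s => flux (v s) fun i => component i (B s)) (fun i => component i A₀)
        (fun i => component i (B t)) t) :
    B =ᵐ[volume.restrict (Ioo 0 T)] A := by
  have hK : 0 ≤ K := by
    have : (ae (volume.restrict (Ioo (0 : ℝ) T))).NeBot := by
      rw [ae_neBot, Ne, Measure.restrict_eq_zero, Real.volume_Ioo, sub_zero,
        ENNReal.ofReal_eq_zero, not_le]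
      exact hT
    obtain ⟨t, ht⟩ := hAK.exists
    exact (norm_nonneg _).trans ht
  obtain ⟨C, -, hstab⟩ := exists_energy_stability d hT hv.nonneg hv.integrable
  have hGA := hv.isFlux_component hAm hAK
  have hGB := hv.isFlux_component hBm hBK
  have e : (fun s i j => flux (v s) (fun i => component i (B s) - component i (A s)) i j
      + (fun _ _ _ => 0 : ℝ → Fin d → Fin d → ScalarL2 d) s i j) = fun s i j =>
      flux (v s) (fun i => component i (B s)) i j -
        flux (v s) (fun i => component i (A s)) i j := by
    funext s i j
    rw [flux_sub, add_zero]
  have hev : ∀ᵐ t ∂volume.restrict (Ioo 0 T), EvolvesTo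
      (fun s i j => flux (v s) (fun i => component i (B s) - component i (A s)) i j
        + (fun _ _ _ => 0 : ℝ → Fin d → Fin d → ScalarL2 d) s i j)
      (fun i => component i A₀ - component i A₀) (fun i => component i (B t) - component i (A t))
      t := by
    rw [e]
    filter_upwards [hA, hB, ae_restrict_mem measurableSet_Ioo] with t h1 h2 ht
    exact h2.sub hGB hGA (Ioo_subset_Icc_self ht) h1
  have hst := hstab v g (fun s i => component i (B s) - component i (A s))
    (fun i => component i A₀ - component i A₀) (fun _ _ _ => 0) (fun _ => 0) _ (2 * K)
    (by positivity) hv.lip (by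
      filter_upwards [hAs, hBs] with s h1 h2
      exact h2.sub h1) (by rw [e]; exact hGB.sub hGA) (fun _ => le_rfl) integrableOn_zero
    (Eventually.of_forall fun s i j => norm_zero.le) (by
      filter_upwards [hAK, hBK] with s h1 h2 i
      exact (norm_sub_le _ _).trans
        (by linarith [(norm_component_le i (A s)).trans h1, (norm_component_le i (B s)).trans h2]))
    hev
  filter_upwards [hev, ae_restrict_mem measurableSet_Ioo] with t h1 ht
  have h2 := hst t (Ioo_subset_Icc_self ht) h1
  rw [energy_sub_self, integral_zero, mul_zero, add_zero, mul_zero] at h2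
  refine ext_component fun i => ext_coeff fun k => ?_
  have h3 := (resSymbol_mul_sq_coeff_le one_pos.le
    (fun i => component i (B t) - component i (A t)) i k).trans h2
  have h4 : ‖coeff (component i (B t) - component i (A t)) k‖ ^ 2 ≤ 0 := by
    by_contra hcon
    exact absurd h3 (not_le.mpr (mul_pos (resSymbol_pos one_pos.le k) (not_le.mp hcon)))
  have h5 : coeff (component i (B t) - component i (A t)) k = 0 :=
    norm_eq_zero.mp (pow_eq_zero_iff two_ne_zero |>.mp (le_antisymm h4 (sq_nonneg _)))
  rw [coeff_sub] at h5
  exact sub_eq_zero.mp h5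

theorem MemTimeSobolev.integral_norm_le {u : ℝ → L2Field d} (hu : MemTimeSobolev T 1 ∞ u) :
    ∫ t in Ioo 0 T, ‖u t‖ ≤ (timeSobolevNorm T 1 ∞ u).toReal := by
  rw [integral_norm_eq_lintegral_enorm hu.1]
  refine ENNReal.toReal_mono hu.2.ne ?_
  rw [timeSobolevNorm, eLpNorm_one_eq_lintegral_enorm]
  exact lintegral_mono fun t => norm_le_sobolevNorm (u t)

end

/-! ### The compactness theorem -/

section

variable {d : ℕ} {T : ℝ}

/-- Solutions in `C([0,T]; L²)` which are bounded, and whose velocities converge, are an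
approximation in the sense of `IsApproximation`, with the limit velocity represented by fixed
functions `v`, `g` and `L`. -/
theorem exists_isApproximation (hT : 0 < T) {A u : ℕ → ℝ → L2Field d} {u₀ : ℝ → L2Field d}
    {A₀ : L2Field d} {K : ℝ} (hA : ∀ n, ContinuousOn (A n) (Icc 0 T))
    (hK : ∀ n, ∀ t ∈ Icc 0 T, ‖A n t‖ ≤ K) (hu : ∀ n, MemTimeSobolev T 1 ∞ (u n))
    (hsol : ∀ n, IsSolution T (A n) (u n)) (hA₀ : Tendsto (fun n => A n 0) atTop (𝓝 A₀))
    (hu₀ : MemTimeSobolev T 1 ∞ u₀) (hdiv : IsDivFree T u₀)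
    (hz : ∀ n, MemTimeSobolev T 1 ∞ (fun t => u n t - u₀ t))
    (hlim : Tendsto (fun n => timeSobolevNorm T 1 ∞ (fun t => u n t - u₀ t)) atTop (𝓝 0))
    {v : ℝ → Fin d → ScalarLinf d} {g : ℝ → Fin d → Fin d → ScalarLinf d} {L : ℝ → ℝ}
    (hv : IsVelocity T v g L)
    (hvu : ∀ᵐ t ∂volume.restrict (Ioo 0 T), ∀ j, v t j =ᵐ[volume] component j (u₀ t)) :
    ∃ z h R, IsApproximation T K v g L z h R (fun n t i => component i (A n t))
      (fun i => component i A₀) := by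
  have hAi : ∀ n, IntegrableOn (A n) (Ioo 0 T) := fun n =>
    (hA n).integrableOn_Icc.mono_set Ioo_subset_Icc_self
  have hzs : ∀ n, ∀ᵐ t ∂volume.restrict (Ioo 0 T),
      IsSolenoidal fun j => component j (u n t - u₀ t) := fun n => by
    filter_upwards [(hsol n).div_right.ae_isSolenoidal (hu n).integrableOn,
      hdiv.ae_isSolenoidal hu₀.integrableOn] with t h1 h2
    simp only [map_sub]
    exact h1.sub h2
  choose z h R hzR hzu hR using fun n => (hz n).exists_isVelocity (hzs n)
  have hcomp : ∀ i : Fin d, Continuous (component i : L2Field d →L[ℝ] ScalarL2 d) := fun i =>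
    (component i).continuous
  refine ⟨z, h, R, hv, hzR, ?_, (norm_nonneg _).trans (hK 0 0 ⟨le_rfl, hT.le⟩),
    fun n t ht i => (norm_component_le i _).trans (hK n t ht),
    fun n i => (hcomp i).comp_continuousOn (hA n),
    fun n => (hsol n).div_left.ae_isSolenoidal (hAi n), fun n t ht => ?_,
    fun i => ((hcomp i).tendsto _).comp hA₀⟩
  · refine squeeze_zero (fun n => integral_nonneg (hzR n).nonneg) hR ?_
    simpa using ((ENNReal.tendsto_toReal ENNReal.zero_ne_top).comp hlim).const_mul 2
  · refine (hsol n).evolvesTo hT (hA n) (hK n) (hv.add (hzR n)) ?_ ht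
    filter_upwards [hvu, hzu n] with s h1 h2 j
    have h3 : component j (u n s) = component j (u₀ s) + component j (u n s - u₀ s) := by
      rw [← map_add, add_sub_cancel]
    rw [h3]
    filter_upwards [h1 j, h2 j, Lp.coeFn_add (v s j) (z n s j),
      Lp.coeFn_add (component j (u₀ s)) (component j (u n s - u₀ s))] with x e1 e2 e3 e4
    rw [e3, e4, Pi.add_apply, Pi.add_apply, e1, e2]

/-- Fields whose components converge uniformly on a set converge uniformly. -/
theorem exists_tendstoUniformlyOn_of_component {A : ℕ → ℝ → L2Field d}
    {w : ℝ → Fin d → ScalarL2 d} {s : Set ℝ}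
    (h : ∀ i, TendstoUniformlyOn (fun n t => component i (A n t)) (fun t => w t i) atTop s) :
    ∃ B : ℝ → L2Field d, TendstoUniformlyOn A B atTop s ∧
      ∀ t ∈ s, ∀ i, component i (B t) = w t i := by
  have h1 : UniformCauchySeqOn A atTop s := by
    rw [Metric.uniformCauchySeqOn_iff]
    intro ε hε
    have h2 : ∀ i, ∃ N, ∀ m ≥ N, ∀ n ≥ N, ∀ t ∈ s,
        dist (component i (A m t)) (component i (A n t)) < ε / (d + 1) := fun i =>
      Metric.uniformCauchySeqOn_iff.mp (h i).uniformCauchySeqOn _ (by positivity)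
    choose N hN using h2
    refine ⟨Finset.univ.sup N, fun m hm n hn t ht => ?_⟩
    rw [dist_eq_norm]
    have hi : ∀ i, N i ≤ Finset.univ.sup N := fun i => Finset.le_sup (Finset.mem_univ i)
    calc ‖A m t - A n t‖ ≤ ∑ i, ‖component i (A m t - A n t)‖ := norm_le_sum_component _
      _ ≤ ∑ _i : Fin d, ε / (d + 1) := Finset.sum_le_sum fun i _ => by
          rw [map_sub, ← dist_eq_norm]
          exact (hN i m ((hi i).trans hm) n ((hi i).trans hn) t ht).le
      _ = ε * (d / (d + 1)) := by
          rw [Finset.sum_const, nsmul_eq_mul, Finset.card_univ, Fintype.card_fin]; ring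
      _ < ε := by
          refine mul_lt_of_lt_one_right hε ?_
          rw [div_lt_one (by positivity)]
          linarith
  have h2 : ∀ t, ∃ b, t ∈ s → Tendsto (fun n => A n t) atTop (𝓝 b) := fun t => by
    by_cases ht : t ∈ s
    · obtain ⟨b, hb⟩ := cauchySeq_tendsto_of_complete (h1.cauchySeq ht)
      exact ⟨b, fun _ => hb⟩
    · exact ⟨0, fun hh => (ht hh).elim⟩
  choose B hB using h2
  refine ⟨B, h1.tendstoUniformlyOn_of_tendsto hB, fun t ht i => ?_⟩
  exact tendsto_nhds_unique
    (((component i : L2Field d →L[ℝ] ScalarL2 d).continuous.tendsto _).comp (hB t ht))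
    ((h i).tendsto_at ht)

end

end ActiveVector

theorem lemma3p1 (d : ℕ) (hd : d = 2 ∨ d = 3) (T : ℝ) (hT : 0 < T)
    (A v : ℕ → ℝ → ActiveVector.L2Field d) (A₀n : ℕ → ActiveVector.L2Field d)
    (A₀ : ActiveVector.L2Field d) (v_lim : ℝ → ActiveVector.L2Field d) (M : ℝ≥0)
    -- `Aₙ ∈ C([0,T]; L²)` and `vₙ ∈ L²(0,T; H¹) ∩ L¹(0,T; W^{1,∞})`
    (hA : ∀ n, ContinuousOn (A n) (Icc 0 T))
    (hv₂ : ∀ n, ActiveVector.MemTimeSobolev T 2 2 (v n))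
    (hv₁ : ∀ n, ActiveVector.MemTimeSobolev T 1 ∞ (v n))
    -- the uniform bound
    (hM : ∀ n, eLpNorm (A n) ∞ (volume.restrict (Ioo 0 T))
      + ActiveVector.timeSobolevNorm T 2 2 (v n)
      + ActiveVector.timeSobolevNorm T 1 ∞ (v n) ≤ (M : ℝ≥0∞))
    -- the equation with its initial datum
    (hsol : ∀ n, ActiveVector.IsSolution T (A n) (v n))
    (hinit : ∀ n, A n 0 = A₀n n)
    -- `A₀ₙ → A₀` in `L²` and `vₙ → v` in `L¹(0,T; W^{1,∞})`
    (hA₀ : Tendsto A₀n atTop (𝓝 A₀))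
    (hv_lim : ActiveVector.MemTimeSobolev T 1 ∞ v_lim)
    (hv_tendsto : Tendsto
      (fun n => ActiveVector.timeSobolevNorm T 1 ∞ (fun t => v n t - v_lim t)) atTop (𝓝 0)) :
    ∃ (σ : ℕ → ℕ) (A_lim : ℝ → ActiveVector.L2Field d), StrictMono σ ∧
      -- strong convergence in `C([0,T]; L²)`
      ContinuousOn A_lim (Icc 0 T) ∧
      TendstoUniformlyOn (fun n => A (σ n)) A_lim atTop (Icc 0 T) ∧
      -- the limit solves the limit problem
      ActiveVector.IsSolution T A_lim v_lim ∧
      A_lim 0 = A₀ ∧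
      -- and is its only solution in `L^∞(0,T; L²)`
      ∀ B : ℝ → ActiveVector.L2Field d,
        MemLp B ∞ (volume.restrict (Ioo 0 T)) →
        ActiveVector.IsSolution T B v_lim →
        ActiveVector.HasInitialTrace B A₀ →
        B =ᵐ[volume.restrict (Ioo 0 T)] A_lim := by
  -- only the tail of the sequence has velocities at finite distance from the limit
  obtain ⟨n₀, hn₀⟩ := eventually_atTop.mp (hv_tendsto.eventually (gt_mem_nhds ENNReal.zero_lt_top))
  have hσ : Tendsto (fun n => n + n₀) atTop atTop := tendsto_add_atTop_nat n₀
  have hz : ∀ n, ActiveVector.MemTimeSobolev T 1 ∞ (fun t => v (n + n₀) t - v_lim t) := fun n =>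
    ⟨(hv₁ _).1.sub hv_lim.1, hn₀ _ (Nat.le_add_left _ _)⟩
  have hlim : Tendsto (fun n => ActiveVector.timeSobolevNorm T 1 ∞
      (fun t => v (n + n₀) t - v_lim t)) atTop (𝓝 0) := hv_tendsto.comp hσ
  have hL1 : Tendsto (fun n => ∫ t in Ioo 0 T, ‖v (n + n₀) t - v_lim t‖) atTop (𝓝 0) := by
    refine squeeze_zero (fun n => integral_nonneg fun t => norm_nonneg _)
      (fun n => (hz n).integral_norm_le) ?_
    exact (ENNReal.tendsto_toReal ENNReal.zero_ne_top).comp hlim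
  have hdiv : ActiveVector.IsDivFree T v_lim :=
    ActiveVector.IsDivFree.of_tendsto (fun n => (hsol (n + n₀)).div_right)
      (fun n => (hv₁ _).integrableOn) hv_lim.integrableOn hL1
  have hbound : ∀ n, ∀ t ∈ Icc 0 T, ‖A n t‖ ≤ M := fun n =>
    ActiveVector.norm_le_of_ae_norm_le hT (hA n) (ActiveVector.ae_norm_le_of_eLpNorm_le
      (le_self_add.trans (le_self_add.trans (hM n))))
  have h0 : (0 : ℝ) ∈ Icc 0 T := ⟨le_rfl, hT.le⟩
  have hinit' : Tendsto (fun n => A (n + n₀) 0) atTop (𝓝 A₀) := by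
    simp only [hinit]
    exact hA₀.comp hσ
  obtain ⟨V, g, L, hV, hVu, -⟩ := hv_lim.exists_isVelocity
    (hdiv.ae_isSolenoidal hv_lim.integrableOn)
  obtain ⟨z, h, R, H⟩ := ActiveVector.exists_isApproximation hT (fun n => hA (n + n₀))
    (fun n => hbound (n + n₀)) (fun n => hv₁ (n + n₀)) (fun n => hsol (n + n₀)) hinit' hv_lim hdiv
    hz hlim hV hVu
  obtain ⟨w, hw, hwK⟩ := H.exists_weak_limit hT
  obtain ⟨A_lim, hunif, hcomp⟩ := ActiveVector.exists_tendstoUniformlyOn_of_component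
    (H.tendstoUniformlyOn hw hwK hT)
  have hc : ContinuousOn A_lim (Icc 0 T) :=
    hunif.continuousOn (Eventually.of_forall fun n => hA (n + n₀)).frequently
  have hK : ∀ t ∈ Icc 0 T, ‖A_lim t‖ ≤ M := fun t ht =>
    le_of_tendsto (hunif.tendsto_at ht).norm (Eventually.of_forall fun n => hbound (n + n₀) t ht)
  have hA_sol : ActiveVector.IsSolution T A_lim v_lim :=
    ActiveVector.IsSolution.of_tendsto (fun n => hsol (n + n₀)) (fun n => hA (n + n₀)) hc
      (fun n => hbound (n + n₀)) hK hunif (fun n => (hv₁ _).integrableOn) hv_lim.integrableOn hL1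
  have hA_zero : A_lim 0 = A₀ := tendsto_nhds_unique (hunif.tendsto_at h0) hinit'
  refine ⟨fun n => n + n₀, A_lim, fun m n hmn => Nat.add_lt_add_right hmn n₀, hc, hunif, hA_sol,
    hA_zero, fun B hB hB_sol hB_tr => ?_⟩
  have hAi : IntegrableOn A_lim (Ioo 0 T) := hc.integrableOn_Icc.mono_set Ioo_subset_Icc_self
  have hBi : IntegrableOn B (Ioo 0 T) := hB.integrable le_top
  obtain ⟨K, hBK⟩ : ∃ K : ℝ≥0, ∀ᵐ t ∂volume.restrict (Ioo 0 T), ‖B t‖ ≤ K := by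
    lift eLpNorm B ∞ (volume.restrict (Ioo 0 T)) to ℝ≥0 using hB.2.ne with K hK
    exact ⟨K, ActiveVector.ae_norm_le_of_eLpNorm_le hK.ge⟩
  have hBK' : ∀ᵐ t ∂volume.restrict (Ioo 0 T), ‖B t‖ ≤ max (M : ℝ) K := by
    filter_upwards [hBK] with t ht
    exact ht.trans (le_max_right _ _)
  refine ActiveVector.ae_eq_of_evolvesTo hT hV (hA_sol.div_left.ae_isSolenoidal hAi)
    (hB_sol.div_left.ae_isSolenoidal hBi) hAi.aestronglyMeasurable hB.1
    ?_ hBK' ?_ (hB_sol.ae_evolvesTo hT hB_tr hBi (hV.isFlux_component hB.1 hBK') hVu)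
  · filter_upwards [ae_restrict_mem measurableSet_Ioo] with t ht
    exact (hK t (Ioo_subset_Icc_self ht)).trans (le_max_left _ _)
  · filter_upwards [ae_restrict_mem measurableSet_Ioo] with t ht
    have h1 := hA_sol.evolvesTo hT hc hK hV hVu (Ioo_subset_Icc_self ht)
    rwa [hA_zero] at h1
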